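/- Let $d\ge 3$ be an integer, let $n>d$ be a real number and let $\alpha\in\mathbb R$. Let $(\mathfrak M,g)$ be a smooth compact connected Riemannian manifold of dimension $d-1$ without boundary, with volume measure $dv_g$, gradient $\nabla$, Laplace–Beltrami operator $\Delta$ and Ricci tensor $\mathrm{Ric}_g$. Let $\lambda_1^{\mathfrak M}$ be the lowest positive eigenvalue of $-\Delta$ on $L^2(\mathfrak M,dv_g)$, let $\kappa$ be the infimum of $\mathrm{Ric}_g(\xi,\xi)$ over all unit tangent vectors $\xi$ of $\mathfrak M$, and set $$\delta=\frac{n-d}{(d-1)(n-1)},\qquad \theta_\star=\frac{(d-2)(n-1)\big(3n+1-d(3n+5)\big)}{(d+1)\big(d(n^2-n-4)-n^2+3n+2\big)},$$ $$\lambda_\star=\Big(1+\delta\,\theta_\star\,\frac{d-1}{d-2}\Big)\kappa+\delta\,(1-\theta_\star)\,\lambda_1^{\mathfrak M}.$$ For a function $p\in C^3(\mathfrak M)$ let $$\mathsf k_{\mathfrak M}[p]=\tfrac12\,\Delta|\nabla p|^2-\nabla p\cdot\nabla\Delta p-\tfrac1{n-1}(\Delta p)^2-(n-2)\,\alpha^2\,|\nabla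 p|^2.$$ Then every positive function $p\in C^3(\mathfrak M)$ satisfies $$\int_{\mathfrak M}\mathsf k_{\mathfrak M}[p]\,p^{1-n}\,dv_g\ \ge\ \big[\lambda_\star-(n-2)\alpha^2\big]\int_{\mathfrak M}|\nabla p|^2\,p^{1-n}\,dv_g .$$ Moreover, for all $d\ge3$ and $n>d$ there is a constant $\zeta_\star>0$, depending only on $d$ and $n$, such that for $\mathfrak M=\mathbb S^{d-1}$, the unit sphere of $\mathbb R^d$ with its standard metric, every $\alpha\in\mathbb R$ and every positive $p\in C^3(\mathbb S^{d-1})$ satisfy $$\int_{\mathbb S^{d-1}}\mathsf k_{\mathfrak M}[p]\,p^{1-n}\,dv_g\ \ge\ \big[\lambda_\star-(n-2)\alpha^2\big]\int_{\mathbb S^{d-1}}|\nabla p|^2\,p^{1-n}\,dv_g+\zeta_\star\,(n-d)\int_{\mathbb S^{d-1}}\frac{|\nabla p|^4}{p^2}\,p^{1-n}\,dv_g .$$ -/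

import Mathlib

open scoped Manifold ContDiff

noncomputable section

namespace CylinderRigidity

/-! ### Riemannian geometry in charts

Manifolds are smooth, without boundary, modelled on `ℝ^m`. For a chart `e`, all coordinate
expressions are functions on the open set `e.target ⊆ ℝ^m`. -/

/-- Smooth Riemannian metrics on the `m`-dimensional smooth manifold `M`. -/
abbrev RMetric (m : ℕ) (M : Type*) [TopologicalSpace M] [ChartedSpace (EuclideanSpace ℝ (Fin m)) M]
    [IsManifold (𝓡 m) ∞ M] :=
  Bundle.ContMDiffRiemannianMetric (𝓡 m) ∞ (EuclideanSpace ℝ (Fin m))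
    (fun x : M => TangentSpace (𝓡 m) x)

/-- The partial derivative `∂_i F (y)` in `ℝ^m`. -/
def pd {m : ℕ} (i : Fin m) (F : EuclideanSpace ℝ (Fin m) → ℝ) (y : EuclideanSpace ℝ (Fin m)) : ℝ :=
  fderiv ℝ F y (EuclideanSpace.single i 1)

section Charts

variable {m : ℕ} {M : Type*} [TopologicalSpace M] [ChartedSpace (EuclideanSpace ℝ (Fin m)) M]
  [IsManifold (𝓡 m) ∞ M]

/-- The coordinate vector field `∂_i` of the chart `e`, at the point with coordinates `y`. -/
def coordVec (e : OpenPartialHomeomorph M (EuclideanSpace ℝ (Fin m)))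
    (y : EuclideanSpace ℝ (Fin m)) (i : Fin m) : TangentSpace (𝓡 m) (e.symm y) :=
  mfderiv (𝓡 m) (𝓡 m) e.symm y (EuclideanSpace.single i (1 : ℝ) : EuclideanSpace ℝ (Fin m))

/-- The matrix `(g_{ij})` of the metric in the chart `e`. -/
def gram (g : RMetric m M) (e : OpenPartialHomeomorph M (EuclideanSpace ℝ (Fin m)))
    (y : EuclideanSpace ℝ (Fin m)) : Matrix (Fin m) (Fin m) ℝ :=
  Matrix.of fun i j => g.inner (e.symm y) (coordVec e y i) (coordVec e y j)

/-- The inverse matrix `(g^{ij})`. -/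
def gramInv (g : RMetric m M) (e : OpenPartialHomeomorph M (EuclideanSpace ℝ (Fin m)))
    (y : EuclideanSpace ℝ (Fin m)) : Matrix (Fin m) (Fin m) ℝ :=
  (gram g e y)⁻¹

/-- The Christoffel symbols `Γ^k_{ij}` of the Levi-Civita connection in the chart `e`. -/
def christoffel (g : RMetric m M) (e : OpenPartialHomeomorph M (EuclideanSpace ℝ (Fin m)))
    (k i j : Fin m) (y : EuclideanSpace ℝ (Fin m)) : ℝ :=
  (1 / 2) * ∑ l, gramInv g e y k l *
    (pd i (fun z => gram g e z j l) y + pd j (fun z => gram g e z i l) y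
      - pd l (fun z => gram g e z i j) y)

/-- The components `(H f)_{ij} = ∂_i ∂_j f - Γ^k_{ij} ∂_k f` of the Hessian in the chart `e`. -/
def hessianCoord (g : RMetric m M) (e : OpenPartialHomeomorph M (EuclideanSpace ℝ (Fin m)))
    (f : M → ℝ) (i j : Fin m) (y : EuclideanSpace ℝ (Fin m)) : ℝ :=
  pd i (pd j (f ∘ e.symm)) y - ∑ k, christoffel g e k i j y * pd k (f ∘ e.symm) y

/-- The components of the Ricci tensor in the chart `e`,
`R_{ij} = ∂_k Γ^k_{ij} - ∂_j Γ^k_{ik} + Γ^k_{kl} Γ^l_{ij} - Γ^k_{jl} Γ^l_{ik}`. -/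
def ricciCoord (g : RMetric m M) (e : OpenPartialHomeomorph M (EuclideanSpace ℝ (Fin m)))
    (i j : Fin m) (y : EuclideanSpace ℝ (Fin m)) : ℝ :=
  (∑ k, pd k (christoffel g e k i j) y) - (∑ k, pd j (christoffel g e k i k) y)
    + (∑ k, ∑ l, christoffel g e k k l y * christoffel g e l i j y)
    - ∑ k, ∑ l, christoffel g e k j l y * christoffel g e l i k y

/-- The Laplace-Beltrami operator `Δ f = Tr (H f) = g^{ij} (H f)_{ij}`. -/
def laplacian (g : RMetric m M) (f : M → ℝ) (x : M) : ℝ :=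
  ∑ i, ∑ j, gramInv g (chartAt _ x) (chartAt _ x x) i j *
    hessianCoord g (chartAt _ x) f i j (chartAt _ x x)

/-- The scalar product of gradients `∇f · ∇h = g^{ij} ∂_i f ∂_j h`. -/
def gradDot (g : RMetric m M) (f h : M → ℝ) (x : M) : ℝ :=
  ∑ i, ∑ j, gramInv g (chartAt _ x) (chartAt _ x x) i j *
    (pd i (f ∘ (chartAt (EuclideanSpace ℝ (Fin m)) x).symm) (chartAt _ x x) *
      pd j (h ∘ (chartAt (EuclideanSpace ℝ (Fin m)) x).symm) (chartAt _ x x))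

/-- The squared length `|∇f|²`. -/
def gradSq (g : RMetric m M) (f : M → ℝ) (x : M) : ℝ := gradDot g f f x

/-- The components of a tangent vector at `x` in the preferred chart at `x`. -/
def vecCoord (x : M) (v : TangentSpace (𝓡 m) x) : EuclideanSpace ℝ (Fin m) :=
  mfderiv (𝓡 m) (𝓡 m) (chartAt (EuclideanSpace ℝ (Fin m)) x) x v

/-- The Ricci tensor `Ric_g(v, w)`. -/
def ricci (g : RMetric m M) (x : M) (v w : TangentSpace (𝓡 m) x) : ℝ :=
  ∑ i, ∑ j, ricciCoord g (chartAt _ x) i j (chartAt _ x x) * vecCoord x v i * vecCoord x w j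

/-- `κ`, the infimum of `Ric_g(ξ, ξ)` over all unit tangent vectors `ξ`. -/
def kappa (g : RMetric m M) : ℝ :=
  sInf {r : ℝ | ∃ (x : M) (v : TangentSpace (𝓡 m) x), g.inner x v v = 1 ∧ r = ricci g x v v}

section Measure

variable [MeasurableSpace M] [BorelSpace M]

/-- The measure `√(det g) dy` on the domain of the chart `e`, extended by zero to `M`. -/
def chartVolume (g : RMetric m M) (e : OpenPartialHomeomorph M (EuclideanSpace ℝ (Fin m))) :
    MeasureTheory.Measure M :=
  ((MeasureTheory.volume.restrict e.target).withDensity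
    (fun y => ENNReal.ofReal (Real.sqrt (gram g e y).det))).map e.symm

/-- The Riemannian volume measure `v_g`. Any two of the measures `chartVolume g e` agree on the
overlap of the chart domains, so that their supremum in the lattice of measures is the measure
which coincides with `√(det g) dy` in each of the charts. -/
def vol (g : RMetric m M) : MeasureTheory.Measure M :=
  ⨆ x : M, chartVolume g (chartAt (EuclideanSpace ℝ (Fin m)) x)

/-- `μ` is an eigenvalue of the (self-adjoint) operator `-Δ_g` on `L²(M, v_g)`: there is a nonzero
`u ∈ L²` such that `-Δ_g u = μ u`, in the sense of distributions. -/
def IsEigenvalue (g : RMetric m M) (μ : ℝ) : Prop :=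
  ∃ u : M → ℝ, MeasureTheory.MemLp u 2 (vol g) ∧ ¬ (u =ᵐ[vol g] 0) ∧
    ∀ φ : M → ℝ, ContMDiff (𝓡 m) 𝓘(ℝ, ℝ) ∞ φ →
      ∫ x, u x * (-laplacian g φ x) ∂(vol g) = μ * ∫ x, u x * φ x ∂(vol g)

/-- `λ₁`, the lowest positive eigenvalue of `-Δ_g`. -/
def lambdaOne (g : RMetric m M) : ℝ := sInf {μ : ℝ | 0 < μ ∧ IsEigenvalue g μ}

/-- `λ_θ = (1 + δ θ (d-1)/(d-2)) κ + δ (1-θ) λ₁` with `δ = (n-d) / ((d-1)(n-1))`, where the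
dimension of `M` is `d - 1`. -/
def lambdaTheta (g : RMetric m M) (d n θ : ℝ) : ℝ :=
  (1 + (n - d) / ((d - 1) * (n - 1)) * θ * ((d - 1) / (d - 2))) * kappa g
    + (n - d) / ((d - 1) * (n - 1)) * (1 - θ) * lambdaOne g

end Measure

/-- `k_M[p] = ½ Δ|∇p|² - ∇p·∇Δp - (Δp)²/(n-1) - (n-2) α² |∇p|²`. -/
def kM (g : RMetric m M) (n α : ℝ) (p : M → ℝ) (x : M) : ℝ :=
  1 / 2 * laplacian g (gradSq g p) x - gradDot g p (laplacian g p) x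
    - 1 / (n - 1) * (laplacian g p x) ^ 2 - (n - 2) * α ^ 2 * gradSq g p x

end Charts

/-- The number `θ_⋆`. -/
def thetaStar (d n : ℝ) : ℝ :=
  (d - 2) * (n - 1) * (3 * n + 1 - d * (3 * n + 5)) /
    ((d + 1) * (d * (n ^ 2 - n - 4) - n ^ 2 + 3 * n + 2))

/-- `λ_⋆ = λ_{θ_⋆}`. -/
def lambdaStar {m : ℕ} {M : Type*} [TopologicalSpace M]
    [ChartedSpace (EuclideanSpace ℝ (Fin m)) M] [IsManifold (𝓡 m) ∞ M]
    [MeasurableSpace M] [BorelSpace M] (g : RMetric m M) (d n : ℝ) : ℝ :=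
  lambdaTheta g d n (thetaStar d n)

/-! ### The round sphere -/

/-- The unit sphere of `ℝ^{m+1}`, with its standard smooth structure. -/
abbrev UnitSphere (m : ℕ) : Type := Metric.sphere (0 : EuclideanSpace ℝ (Fin (m + 1))) 1

/-- The differential of the inclusion of the unit sphere. -/
def sphereDeriv (m : ℕ) (x : UnitSphere m) :
    TangentSpace (𝓡 m) x →L[ℝ] EuclideanSpace ℝ (Fin (m + 1)) :=
  mvfderiv (𝓡 m) (fun y : UnitSphere m => (y : EuclideanSpace ℝ (Fin (m + 1)))) x

/-- The scalar product induced on the tangent spaces of the sphere by that of `ℝ^{m+1}`. -/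
def roundInner (m : ℕ) (x : UnitSphere m) :
    TangentSpace (𝓡 m) x →L[ℝ] TangentSpace (𝓡 m) x →L[ℝ] ℝ :=
  (ContinuousLinearMap.precomp ℝ (sphereDeriv m x)) ∘L (innerSL ℝ ∘L sphereDeriv m x)

theorem roundInner_apply (m : ℕ) (x : UnitSphere m) (v w : TangentSpace (𝓡 m) x) :
    roundInner m x v w = inner ℝ (sphereDeriv m x v) (sphereDeriv m x w) := rfl

theorem sphereDeriv_injective (m : ℕ) (x : UnitSphere m) :
    Function.Injective (sphereDeriv m x) := by
  have : Fact (Module.finrank ℝ (EuclideanSpace ℝ (Fin (m + 1))) = m + 1) := ⟨by simp⟩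
  exact injective_mvfderiv_subtypeVal_sphere x

theorem roundInner_contMDiff (m : ℕ) :
    ContMDiff (𝓡 m)
      ((𝓡 m).prod 𝓘(ℝ, EuclideanSpace ℝ (Fin m) →L[ℝ] EuclideanSpace ℝ (Fin m) →L[ℝ] ℝ)) ∞
      (fun b : UnitSphere m ↦
        Bundle.TotalSpace.mk' (EuclideanSpace ℝ (Fin m) →L[ℝ] EuclideanSpace ℝ (Fin m) →L[ℝ] ℝ)
        (E := fun b : UnitSphere m =>
          TangentSpace (𝓡 m) b →L[ℝ] TangentSpace (𝓡 m) b →L[ℝ] ℝ) b (roundInner m b)) := by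
  have : Fact (Module.finrank ℝ (EuclideanSpace ℝ (Fin (m + 1))) = m + 1) := ⟨by simp⟩
  intro x₀
  rw [contMDiffAt_hom_bundle]
  refine ⟨contMDiffAt_id, ?_⟩
  have hT := ContMDiffAt.mfderiv_const (m := ∞) (n := ∞) (I := 𝓡 m)
    (I' := 𝓘(ℝ, EuclideanSpace ℝ (Fin (m + 1))))
    (contMDiff_coe_sphere (m := ∞) (n := m)
      (E := EuclideanSpace ℝ (Fin (m + 1)))).contMDiffAt (x₀ := x₀) (by simp)
  set T := inTangentCoordinates (𝓡 m) 𝓘(ℝ, EuclideanSpace ℝ (Fin (m + 1))) id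
    (fun y : UnitSphere m => (y : EuclideanSpace ℝ (Fin (m + 1))))
    (fun x : UnitSphere m => mfderiv (𝓡 m) 𝓘(ℝ, EuclideanSpace ℝ (Fin (m + 1)))
      (fun y : UnitSphere m => (y : EuclideanSpace ℝ (Fin (m + 1)))) x) x₀ with hTdef
  have key : ContMDiffAt (𝓡 m)
      𝓘(ℝ, EuclideanSpace ℝ (Fin m) →L[ℝ] EuclideanSpace ℝ (Fin m) →L[ℝ] ℝ) ∞
      (fun x => (ContinuousLinearMap.precomp ℝ (T x)) ∘L (innerSL ℝ ∘L T x)) x₀ := by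
    have hΨ : ContDiff ℝ ∞
        (fun A : EuclideanSpace ℝ (Fin m) →L[ℝ] EuclideanSpace ℝ (Fin (m + 1)) =>
        (((ContinuousLinearMap.compL ℝ (EuclideanSpace ℝ (Fin m))
            (EuclideanSpace ℝ (Fin (m + 1))) ℝ).flip A).comp
          ((innerSL ℝ : EuclideanSpace ℝ (Fin (m + 1)) →L[ℝ]
            EuclideanSpace ℝ (Fin (m + 1)) →L[ℝ] ℝ).comp A))) :=
      (ContinuousLinearMap.contDiff _).clm_comp (contDiff_const.clm_comp contDiff_id)
    exact hΨ.contMDiff.contMDiffAt.comp x₀ hT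
  refine key.congr_of_eventuallyEq ?_
  filter_upwards [(trivializationAt (EuclideanSpace ℝ (Fin m))
    (TangentSpace (𝓡 m)) x₀).open_baseSet.mem_nhds
      (FiberBundle.mem_baseSet_trivializationAt' x₀)] with x hx
  have hTx (v : EuclideanSpace ℝ (Fin m)) : T x v = sphereDeriv m x
      ((trivializationAt (EuclideanSpace ℝ (Fin m)) (TangentSpace (𝓡 m)) x₀).symm x v) := by
    rw [← Bundle.Trivialization.symmL_apply (R := ℝ) _ hx]
    simp [hTdef, inTangentCoordinates, ContinuousLinearMap.inCoordinates]
    rfl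
  ext v w
  rw [inCoordinates_apply_eq₂ hx hx (by simp)]
  simp [hTx, roundInner]

/-- The standard (round) metric of the unit sphere `S^m ⊆ ℝ^{m+1}`. -/
def roundMetric (m : ℕ) : RMetric m (UnitSphere m) where
  inner := roundInner m
  symm x v w := by rw [roundInner_apply, roundInner_apply, real_inner_comm]
  pos x v hv := by
    rw [roundInner_apply]
    refine real_inner_self_pos.2 fun h => hv (sphereDeriv_injective m x ?_)
    rw [h, map_zero]
  isVonNBounded x := by
    let A : EuclideanSpace ℝ (Fin m) →L[ℝ] EuclideanSpace ℝ (Fin (m + 1)) := sphereDeriv m x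
    obtain ⟨K, -, hK⟩ := (A : EuclideanSpace ℝ (Fin m) →ₗ[ℝ]
      EuclideanSpace ℝ (Fin (m + 1))).exists_antilipschitzWith
        (LinearMap.ker_eq_bot.2 (sphereDeriv_injective m x))
    change Bornology.IsVonNBounded ℝ {v : EuclideanSpace ℝ (Fin m) | inner ℝ (A v) (A v) < 1}
    rw [NormedSpace.isVonNBounded_iff, isBounded_iff_forall_norm_le]
    refine ⟨K, fun v hv => ?_⟩
    have h1 : ‖A v‖ ≤ 1 := by
      simp only [Set.mem_ofPred_eq, real_inner_self_eq_norm_sq] at hv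
      nlinarith [norm_nonneg (A v)]
    have h2 : ‖v‖ ≤ K * ‖A v‖ := by simpa using hK.le_mul_norm_sub v 0
    nlinarith [K.2, norm_nonneg (A v), K.coe_nonneg]
  contMDiff := roundInner_contMDiff m

end CylinderRigidity

end

/-!
# An integral inequality for the operator `k_M` on compact Riemannian manifolds

Let `Γ₂[p] = ½ Δ|∇p|² - ∇p · ∇Δp`, so that `k_M[p] = Γ₂[p] - (Δp)² / (n-1) - (n-2) α² |∇p|²`. The
inequality is a combination, with weights `A, B ≥ 0`, of two estimates for the weighted integrals
`E = ∫ |∇p|² p^{1-n}`, `X = ∫ (Δp)² p^{1-n}`, `Y = ∫ Δp |∇p|² p^{-n}` and `Z = ∫ |∇p|⁴ p^{-n-1}`.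

* *Curvature.* Bochner's formula `gammaTwo_eq` reads `Γ₂[p] = |Hess p|² + Ric(∇p, ∇p)`. The Hessian is
  bounded from below by `|Hess p + s g + (t/p) dp ⊗ dp|² ≥ 0`, with `s` optimal at every point; this
  estimates `κ E` (`kappa_mul_gradSq_le`, `kappa_mul_weightedIntegral_le`).
* *Spectral gap.* The inequality `λ₁ ∫ |∇f|² ≤ ∫ (Δf)²`, applied to `f = p^{(3-n)/2}`, estimates `λ₁ E`
  (`lambdaOne_mul_integral_gradSq_le`, `lambdaOne_mul_weightedIntegral_le`).

Green's formula (`integral_gradDot`) expresses the remaining integrals in terms of `X`, `Y` and `Z`. The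
weights of `κ` and `λ₁` in `λ_θ` are exactly those for which `X` cancels, `t` is chosen to cancel `Y`,
and `θ_⋆` is the value of `θ` for which `Z` cancels as well (`remainder_thetaStar_eq_zero`). On the
sphere, `κ ≥ d - 2` and `λ₁ ≤ d - 1`, so that the weights of `θ = 1` give a constant at least equal to
`λ_⋆`, while the coefficient of `Z` becomes positive (`lambdaStar_round_le`, `remainder_one_pos`).

The geometry is developed in coordinates. The Laplacian is independent of the chart because the Hessian
is determined by iterated scalar products of gradients (`lapLoc_eq_sum_gradDot`). Green's formula comes
from the divergence theorem for compactly supported fields and a partition of unity. The spectral gap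
does not need elliptic regularity: the inverse of `1 - Δ` is realised as `K K*`, where `K` is the
inclusion of the completion of `C¹` for the norm of `H¹` in `L²`; `K` is compact by the Rellich theorem
(`exists_integral_sq_le_gradSq`, from Poincaré inequalities on small cubes), and the eigenvectors given
by the spectral theorem for compact self-adjoint operators are eigenfunctions in the sense of
distributions (`inner_sub_nonneg_of_spectral_gap`). On the sphere, the Ricci tensor and the
eigenfunctions of lowest degree are computed at the centre of stereographic charts.
-/


open scoped Manifold ContDiff

noncomputable section

set_option linter.unusedSectionVars false

namespace CylinderRigidity

/-! ### Partial derivatives -/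

section PartialDerivatives

variable {m : ℕ} {F H : EuclideanSpace ℝ (Fin m) → ℝ} {y : EuclideanSpace ℝ (Fin m)}

theorem pd_congr (i : Fin m) (h : F =ᶠ[nhds y] H) : pd i F y = pd i H y := by
  simp only [pd, h.fderiv_eq]

theorem pd_add (i : Fin m) (hF : DifferentiableAt ℝ F y) (hH : DifferentiableAt ℝ H y) :
    pd i (fun z => F z + H z) y = pd i F y + pd i H y := by
  simp only [pd, fderiv_fun_add hF hH, add_apply]

theorem pd_sub (i : Fin m) (hF : DifferentiableAt ℝ F y) (hH : DifferentiableAt ℝ H y) :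
    pd i (fun z => F z - H z) y = pd i F y - pd i H y := by
  simp only [pd, fderiv_fun_sub hF hH, sub_apply]

theorem pd_mul (i : Fin m) (hF : DifferentiableAt ℝ F y) (hH : DifferentiableAt ℝ H y) :
    pd i (fun z => F z * H z) y = pd i F y * H y + F y * pd i H y := by
  simp only [pd, fderiv_fun_mul hF hH, add_apply, smul_apply,
    smul_eq_mul]
  ring

theorem pd_const_mul (i : Fin m) (c : ℝ) (hF : DifferentiableAt ℝ F y) :
    pd i (fun z => c * F z) y = c * pd i F y := by
  simp only [pd, fderiv_const_mul hF, smul_apply, smul_eq_mul]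

theorem pd_const (i : Fin m) (c : ℝ) : pd i (fun _ => c) y = 0 := by
  simp [pd]

theorem pd_sum {ι : Type*} (s : Finset ι) (i : Fin m) {Φ : ι → EuclideanSpace ℝ (Fin m) → ℝ}
    (hΦ : ∀ a ∈ s, DifferentiableAt ℝ (Φ a) y) :
    pd i (fun z => ∑ a ∈ s, Φ a z) y = ∑ a ∈ s, pd i (Φ a) y := by
  simp only [pd, fderiv_fun_sum hΦ, sum_apply]

/-- The chain rule for the composition with a function of one real variable. -/
theorem pd_comp_real (i : Fin m) {φ : ℝ → ℝ} {φ' : ℝ} (hφ : HasDerivAt φ φ' (F y))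
    (hF : DifferentiableAt ℝ F y) : pd i (fun z => φ (F z)) y = φ' * pd i F y := by
  have := hφ.comp_hasFDerivAt y hF.hasFDerivAt
  simp only [pd]
  rw [show (fun z => φ (F z)) = φ ∘ F from rfl, this.fderiv]
  simp

theorem pd_sum_mul {ι : Type*} (s : Finset ι) (i : Fin m)
    {Φ Ψ : ι → EuclideanSpace ℝ (Fin m) → ℝ} (hΦ : ∀ a ∈ s, DifferentiableAt ℝ (Φ a) y)
    (hΨ : ∀ a ∈ s, DifferentiableAt ℝ (Ψ a) y) :
    pd i (fun z => ∑ a ∈ s, Φ a z * Ψ a z) y =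
      ∑ a ∈ s, (pd i (Φ a) y * Ψ a y + Φ a y * pd i (Ψ a) y) := by
  have := pd_sum (y := y) s i (Φ := fun a z => Φ a z * Ψ a z)
    fun a ha => (hΦ a ha).mul (hΨ a ha)
  rw [this]
  exact Finset.sum_congr rfl fun a ha => pd_mul i (hΦ a ha) (hΨ a ha)

theorem contDiffAt_pd {k l : WithTop ℕ∞} (i : Fin m) (hF : ContDiffAt ℝ l F y)
    (hkl : k + 1 ≤ l := by norm_num) : ContDiffAt ℝ k (pd i F) y :=
  (hF.fderiv_right hkl).clm_apply contDiffAt_const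

theorem differentiableAt_pd (i : Fin m) (hF : ContDiffAt ℝ 2 F y) :
    DifferentiableAt ℝ (pd i F) y :=
  (contDiffAt_pd (k := 1) i hF).differentiableAt (by simp)

theorem contDiffAt_pd_top (i : Fin m) (hF : ContDiffAt ℝ ∞ F y) :
    ContDiffAt ℝ ∞ (pd i F) y :=
  contDiffAt_pd i hF (by simp)

theorem pd_comm (i j : Fin m) (hF : ContDiffAt ℝ 2 F y) :
    pd i (pd j F) y = pd j (pd i F) y := by
  have hs : IsSymmSndFDerivAt ℝ F y := hF.isSymmSndFDerivAt (by simp)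
  have hd : DifferentiableAt ℝ (fderiv ℝ F) y :=
    (hF.fderiv_right (m := 1) (by norm_num)).differentiableAt (by simp)
  have key (a b : Fin m) : pd a (pd b F) y =
      fderiv ℝ (fderiv ℝ F) y (EuclideanSpace.single a 1) (EuclideanSpace.single b 1) := by
    have h := (hd.hasFDerivAt.clm_apply
      (hasFDerivAt_const (EuclideanSpace.single b (1 : ℝ)) y)).fderiv
    change fderiv ℝ (fun z => fderiv ℝ F z (EuclideanSpace.single b 1)) y _ = _
    rw [h]
    simp
  rw [key, key, hs.eq]

theorem fderiv_eq_sum_pd (F : EuclideanSpace ℝ (Fin m) → ℝ) (y v : EuclideanSpace ℝ (Fin m)) :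
    fderiv ℝ F y v = ∑ i, v i * pd i F y := by
  have : v = ∑ i, v i • EuclideanSpace.single i (1 : ℝ) := by
    ext j; simp [Finset.sum_apply, Pi.single_apply]
  conv_lhs => rw [this]
  simp [pd, map_sum]

/-- The chain rule for partial derivatives. -/
theorem pd_comp (i : Fin m) {ψ : EuclideanSpace ℝ (Fin m) → EuclideanSpace ℝ (Fin m)}
    (hF : DifferentiableAt ℝ F (ψ y)) (hψ : DifferentiableAt ℝ ψ y) :
    pd i (F ∘ ψ) y = ∑ j, pd i (fun z => ψ z j) y * pd j F (ψ y) := by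
  have hj (j : Fin m) : pd i (fun z => ψ z j) y =
      (fderiv ℝ ψ y (EuclideanSpace.single i 1)) j := by
    have := ((EuclideanSpace.proj j : EuclideanSpace ℝ (Fin m) →L[ℝ] ℝ).hasFDerivAt
      (x := ψ y)).comp y hψ.hasFDerivAt
    simp only [pd]
    rw [show (fun z => ψ z j) = (EuclideanSpace.proj j : EuclideanSpace ℝ (Fin m) →L[ℝ] ℝ) ∘ ψ
      from rfl, this.fderiv]
    rfl
  simp only [hj]
  rw [← fderiv_eq_sum_pd, pd, fderiv_comp y hF hψ]
  rfl

end PartialDerivatives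

section MatrixSmooth

variable {m : ℕ} {E : Type*} [NormedAddCommGroup E] [NormedSpace ℝ E] {k : WithTop ℕ∞}
  {A : E → Matrix (Fin m) (Fin m) ℝ} {y : E}

theorem contDiffAt_det {l : ℕ} {A : E → Matrix (Fin l) (Fin l) ℝ}
    (hA : ∀ i j, ContDiffAt ℝ k (fun z => A z i j) y) :
    ContDiffAt ℝ k (fun z => (A z).det) y := by
  simp only [Matrix.det_apply]
  refine ContDiffAt.sum fun σ _ => ContDiffAt.const_smul _ ?_
  exact contDiffAt_prod fun i _ => hA _ _

theorem contDiffAt_inv (hA : ∀ i j, ContDiffAt ℝ k (fun z => A z i j) y)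
    (h0 : (A y).det ≠ 0) (i j : Fin m) : ContDiffAt ℝ k (fun z => (A z)⁻¹ i j) y := by
  simp only [Matrix.inv_def, Matrix.smul_apply, Ring.inverse_eq_inv, Matrix.adjugate_apply,
    smul_eq_mul]
  refine ((contDiffAt_det hA).inv h0).mul (contDiffAt_det fun a b => ?_)
  by_cases h : a = j
  · subst h; simp only [Matrix.updateRow_self]; exact contDiffAt_const
  · simp only [Matrix.updateRow_ne h]; exact hA a b

end MatrixSmooth

/-! ### The metric in a chart -/

section Charts

variable {m : ℕ} {M : Type*} [TopologicalSpace M] [ChartedSpace (EuclideanSpace ℝ (Fin m)) M]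
  [IsManifold (𝓡 m) ∞ M] {g : RMetric m M}
  {e e' : OpenPartialHomeomorph M (EuclideanSpace ℝ (Fin m))} {y : EuclideanSpace ℝ (Fin m)}

theorem gram_symm (i j : Fin m) : gram g e y i j = gram g e y j i := by
  simp [gram, g.symm]

theorem mdifferentiable_of_mem_maximalAtlas
    (he : e ∈ IsManifold.maximalAtlas (𝓡 m) ∞ M) : e.MDifferentiable (𝓡 m) (𝓡 m) :=
  ⟨(contMDiffOn_of_mem_maximalAtlas he).mdifferentiableOn (by simp),
    (contMDiffOn_symm_of_mem_maximalAtlas he).mdifferentiableOn (by simp)⟩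

theorem gram_posDef (he : e ∈ IsManifold.maximalAtlas (𝓡 m) ∞ M) (hy : y ∈ e.target) :
    (gram g e y).PosDef := by
  have hinj := (mdifferentiable_of_mem_maximalAtlas he).symm.mfderiv_injective hy
  refine Matrix.PosDef.of_dotProduct_mulVec_pos ?_ fun v hv => ?_
  · ext i j; simp [gram_symm i j]
  · let D : EuclideanSpace ℝ (Fin m) →L[ℝ] TangentSpace (𝓡 m) (e.symm y) :=
      mfderiv (𝓡 m) (𝓡 m) e.symm y
    let w : EuclideanSpace ℝ (Fin m) := WithLp.toLp 2 v
    have hw : w = ∑ i, v i • EuclideanSpace.single i (1 : ℝ) := by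
      ext j; simp [w, Finset.sum_apply, Pi.single_apply]
    have hDw : D w = ∑ i, v i • coordVec e y i := by
      rw [hw, map_sum]; simp only [map_smul]; rfl
    have h0 : D w ≠ 0 := fun h => by
      have : w = 0 := hinj (h.trans (map_zero D).symm)
      exact hv (by ext i; simpa [w] using congrArg (fun u => u i) this)
    have := g.pos _ _ h0
    rw [hDw] at this
    simp only [map_sum, map_smul, sum_apply, smul_apply, smul_eq_mul] at this
    refine this.trans_eq ?_
    simp only [dotProduct, Matrix.mulVec, gram, Matrix.of_apply, star_trivial]
    refine Finset.sum_congr rfl fun i _ => ?_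
    congr 1
    exact Finset.sum_congr rfl fun j _ => by rw [g.symm]; ring

theorem gram_contDiffAt (he : e ∈ IsManifold.maximalAtlas (𝓡 m) ∞ M) (hy : y ∈ e.target)
    (i j : Fin m) : ContDiffAt ℝ ∞ (fun z => gram g e z i j) y := by
  rw [← contMDiffAt_iff_contDiffAt]
  -- the coordinate vector fields are smooth sections, being images under the tangent map of `e.symm`
  -- of the constant vector fields of `ℝ^m`
  have hsec (i : Fin m) : ContMDiffAt (𝓡 m) (𝓡 m).tangent ∞
      (fun z => Bundle.TotalSpace.mk' (EuclideanSpace ℝ (Fin m))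
        (E := fun x : M => TangentSpace (𝓡 m) x) (e.symm z) (coordVec e z i)) y := by
    have h1 : ContMDiff (𝓡 m) (𝓡 m).tangent ∞
        (fun z : EuclideanSpace ℝ (Fin m) =>
          (⟨z, EuclideanSpace.single i (1 : ℝ)⟩ :
            TangentBundle (𝓡 m) (EuclideanSpace ℝ (Fin m)))) := by
      intro z
      exact contMDiffAt_vectorSpace_iff_contDiffAt.2 contDiffAt_const
    have h2 := ((contMDiffOn_symm_of_mem_maximalAtlas he).contMDiffOn_tangentMapWithin
      (m := ∞) (by simp) e.open_target.uniqueMDiffOn)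
    have h3 := h2.comp (s := e.target) h1.contMDiffOn (fun z hz => hz)
    refine (h3.contMDiffAt (e.open_target.mem_nhds hy)).congr_of_eventuallyEq ?_
    filter_upwards [e.open_target.mem_nhds hy] with z hz
    simp only [tangentMapWithin, Function.comp_apply, coordVec]
    rw [mfderivWithin_of_isOpen e.open_target hz]
  have hg : ContMDiffAt (𝓡 m)
      ((𝓡 m).prod 𝓘(ℝ, EuclideanSpace ℝ (Fin m) →L[ℝ] EuclideanSpace ℝ (Fin m) →L[ℝ] ℝ)) ∞
      (fun z => Bundle.TotalSpace.mk'
        (EuclideanSpace ℝ (Fin m) →L[ℝ] EuclideanSpace ℝ (Fin m) →L[ℝ] ℝ)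
        (E := fun b : M => TangentSpace (𝓡 m) b →L[ℝ] TangentSpace (𝓡 m) b →L[ℝ] ℝ)
        (e.symm z) (g.inner (e.symm z))) y :=
    (g.contMDiff.contMDiffAt).comp y (contMDiffAt_symm_of_mem_maximalAtlas he hy)
  have : ContMDiffAt (𝓡 m) ((𝓡 m).prod 𝓘(ℝ)) ∞
      (fun z => Bundle.TotalSpace.mk' ℝ (E := Bundle.Trivial M ℝ) (e.symm z)
        (g.inner (e.symm z) (coordVec e z i) (coordVec e z j))) y :=
    ContMDiffAt.clm_bundle_apply₂ (F₁ := EuclideanSpace ℝ (Fin m))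
      (F₂ := EuclideanSpace ℝ (Fin m)) hg (hsec i) (hsec j)
  -- a smooth section of the trivial line bundle is a smooth function
  rw [← contMDiffWithinAt_univ, Bundle.contMDiffWithinAt_totalSpace] at this
  exact this.2

end Charts

/-! ### The Levi-Civita connection, gradients and Hessians in a chart -/

section LocalCalculus

variable {m : ℕ} {M : Type*} [TopologicalSpace M] [ChartedSpace (EuclideanSpace ℝ (Fin m)) M]
  [IsManifold (𝓡 m) ∞ M] {g : RMetric m M}
  {e e' : OpenPartialHomeomorph M (EuclideanSpace ℝ (Fin m))} {y : EuclideanSpace ℝ (Fin m)}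
  {F H : EuclideanSpace ℝ (Fin m) → ℝ}

theorem gramInv_symm (i j : Fin m) : gramInv g e y i j = gramInv g e y j i := by
  have h : (gram g e y).transpose = gram g e y := by
    ext i j; exact gram_symm j i
  have h2 : ((gram g e y)⁻¹).transpose = (gram g e y)⁻¹ := by
    rw [Matrix.transpose_nonsing_inv, h]
  exact congrFun (congrFun h2 j) i

theorem gram_det_pos (he : e ∈ IsManifold.maximalAtlas (𝓡 m) ∞ M) (hy : y ∈ e.target) :
    0 < (gram g e y).det := (gram_posDef he hy).det_pos

theorem gram_mul_gramInv (he : e ∈ IsManifold.maximalAtlas (𝓡 m) ∞ M) (hy : y ∈ e.target) :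
    gram g e y * gramInv g e y = 1 :=
  Matrix.mul_nonsing_inv _ (gram_det_pos he hy).ne'.isUnit

theorem gramInv_mul_gram (he : e ∈ IsManifold.maximalAtlas (𝓡 m) ∞ M) (hy : y ∈ e.target) :
    gramInv g e y * gram g e y = 1 :=
  Matrix.nonsing_inv_mul _ (gram_det_pos he hy).ne'.isUnit

theorem gramInv_posDef (he : e ∈ IsManifold.maximalAtlas (𝓡 m) ∞ M) (hy : y ∈ e.target) :
    (gramInv g e y).PosDef := (gram_posDef he hy).inv

theorem gramInv_contDiffAt (he : e ∈ IsManifold.maximalAtlas (𝓡 m) ∞ M) (hy : y ∈ e.target)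
    (i j : Fin m) : ContDiffAt ℝ ∞ (fun z => gramInv g e z i j) y :=
  contDiffAt_inv (fun i j => gram_contDiffAt he hy i j) (gram_det_pos he hy).ne' i j

theorem christoffel_contDiffAt (he : e ∈ IsManifold.maximalAtlas (𝓡 m) ∞ M) (hy : y ∈ e.target)
    (k i j : Fin m) : ContDiffAt ℝ ∞ (christoffel g e k i j) y := by
  unfold christoffel
  refine contDiffAt_const.mul (ContDiffAt.sum fun l _ => (gramInv_contDiffAt he hy k l).mul ?_)
  exact ((contDiffAt_pd_top _ (gram_contDiffAt he hy _ _)).add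
    (contDiffAt_pd_top _ (gram_contDiffAt he hy _ _))).sub
    (contDiffAt_pd_top _ (gram_contDiffAt he hy _ _))

theorem christoffel_symm (k i j : Fin m) : christoffel g e k i j y = christoffel g e k j i y := by
  unfold christoffel
  congr 1
  refine Finset.sum_congr rfl fun l _ => ?_
  have : (fun z => gram g e z i j) = fun z => gram g e z j i := by
    funext z; exact gram_symm i j
  rw [this]; ring

/-- The Christoffel symbols of the first kind. -/
theorem sum_gram_mul_christoffel (he : e ∈ IsManifold.maximalAtlas (𝓡 m) ∞ M)
    (hy : y ∈ e.target) (a i j : Fin m) :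
    ∑ k, gram g e y a k * christoffel g e k i j y =
      (1 / 2) * (pd i (fun z => gram g e z j a) y + pd j (fun z => gram g e z i a) y
        - pd a (fun z => gram g e z i j) y) := by
  set w : Fin m → ℝ := fun l => (1 / 2) * (pd i (fun z => gram g e z j l) y
    + pd j (fun z => gram g e z i l) y - pd l (fun z => gram g e z i j) y) with hw
  have h1 : (fun k => christoffel g e k i j y) = (gramInv g e y).mulVec w := by
    funext k
    simp only [christoffel, Matrix.mulVec, dotProduct, hw, Finset.mul_sum]
    exact Finset.sum_congr rfl fun l _ => by ring
  have h2 : (gram g e y).mulVec (fun k => christoffel g e k i j y) = w := by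
    rw [h1, Matrix.mulVec_mulVec, gram_mul_gramInv he hy, Matrix.one_mulVec]
  exact congrFun h2 a

/-- Compatibility of the Levi-Civita connection with the metric, in coordinates. -/
theorem pd_gram (he : e ∈ IsManifold.maximalAtlas (𝓡 m) ∞ M) (hy : y ∈ e.target)
    (k i j : Fin m) : pd k (fun z => gram g e z i j) y =
      ∑ l, christoffel g e l k i y * gram g e y l j +
        ∑ l, gram g e y i l * christoffel g e l k j y := by
  have h1 := sum_gram_mul_christoffel (g := g) he hy j k i
  have h2 := sum_gram_mul_christoffel (g := g) he hy i k j
  have h3 : ∑ l, christoffel g e l k i y * gram g e y l j =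
      ∑ l, gram g e y j l * christoffel g e l k i y :=
    Finset.sum_congr rfl fun l _ => by rw [gram_symm l j]; ring
  have hs (a b : Fin m) : (fun z => gram g e z a b) = fun z => gram g e z b a := by
    funext z; exact gram_symm a b
  rw [h3, h1, h2, hs j i]; ring

/-- The inverse metric is parallel: differentiate `g g⁻¹ = 1` and use that `g` is parallel. -/
theorem pd_gramInv (he : e ∈ IsManifold.maximalAtlas (𝓡 m) ∞ M) (hy : y ∈ e.target)
    (k i j : Fin m) : pd k (fun z => gramInv g e z i j) y =
      -(∑ l, christoffel g e i k l y * gramInv g e y l j) -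
        ∑ l, christoffel g e j k l y * gramInv g e y i l := by
  set G := gram g e y with hG
  set P := gramInv g e y with hP
  set dG : Matrix (Fin m) (Fin m) ℝ := Matrix.of fun i j => pd k (fun z => gram g e z i j) y
  set dP : Matrix (Fin m) (Fin m) ℝ := Matrix.of fun i j => pd k (fun z => gramInv g e z i j) y
  set C : Matrix (Fin m) (Fin m) ℝ := Matrix.of fun i l => christoffel g e i k l y
  have hdiffG (i j : Fin m) : DifferentiableAt ℝ (fun z => gram g e z i j) y :=
    (gram_contDiffAt he hy i j).differentiableAt (by simp)
  have hdiffP (i j : Fin m) : DifferentiableAt ℝ (fun z => gramInv g e z i j) y :=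
    (gramInv_contDiffAt he hy i j).differentiableAt (by simp)
  have h1 : dG = C.transpose * G + G * C := by
    ext a b
    simp only [dG, C, Matrix.of_apply, Matrix.add_apply, Matrix.mul_apply, Matrix.transpose_apply]
    exact pd_gram he hy k a b
  have h2 : dG * P + G * dP = 0 := by
    ext a b
    have : pd k (fun z => ∑ l, gram g e z a l * gramInv g e z l b) y = 0 := by
      rw [pd_congr (H := fun _ => (1 : Matrix (Fin m) (Fin m) ℝ) a b), pd_const]
      filter_upwards [e.open_target.mem_nhds hy] with z hz
      rw [← gram_mul_gramInv (g := g) he hz, Matrix.mul_apply]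
    rw [pd_sum_mul _ _ (fun l _ => hdiffG a l) (fun l _ => hdiffP l b),
      Finset.sum_add_distrib] at this
    simpa [dG, dP, Matrix.mul_apply] using this
  have hPG : P * G = 1 := gramInv_mul_gram he hy
  have hGP : G * P = 1 := gram_mul_gramInv he hy
  have h3 : dP = -(C * P) - P * C.transpose := by
    have : P * (dG * P + G * dP) = 0 := by rw [h2, Matrix.mul_zero]
    rw [Matrix.mul_add, ← Matrix.mul_assoc P G dP, hPG, Matrix.one_mul, h1] at this
    rw [eq_neg_of_add_eq_zero_right this]
    simp only [Matrix.add_mul, Matrix.mul_add, Matrix.mul_assoc, hGP, Matrix.mul_one]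
    rw [← Matrix.mul_assoc P G, hPG, Matrix.one_mul]
    abel
  have := congrFun (congrFun h3 i) j
  simp only [dP, C, Matrix.of_apply, Matrix.sub_apply, Matrix.neg_apply, Matrix.mul_apply,
    Matrix.transpose_apply] at this
  rw [this]
  congr 1
  exact Finset.sum_congr rfl fun l _ => mul_comm _ _

/-- The component `g^{ij} ∂_j F` of the gradient, for a function of the coordinates. -/
def gradComp (g : RMetric m M) (e : OpenPartialHomeomorph M (EuclideanSpace ℝ (Fin m)))
    (F : EuclideanSpace ℝ (Fin m) → ℝ) (i : Fin m) (y : EuclideanSpace ℝ (Fin m)) : ℝ :=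
  ∑ j, gramInv g e y i j * pd j F y

/-- The component `∂_i ∂_j F - Γ^k_{ij} ∂_k F` of the Hessian, for a function of the
coordinates. -/
def hessLoc (g : RMetric m M) (e : OpenPartialHomeomorph M (EuclideanSpace ℝ (Fin m)))
    (F : EuclideanSpace ℝ (Fin m) → ℝ) (i j : Fin m) (y : EuclideanSpace ℝ (Fin m)) : ℝ :=
  pd i (pd j F) y - ∑ k, christoffel g e k i j y * pd k F y

/-- The Laplace-Beltrami operator, for a function of the coordinates. -/
def lapLoc (g : RMetric m M) (e : OpenPartialHomeomorph M (EuclideanSpace ℝ (Fin m)))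
    (F : EuclideanSpace ℝ (Fin m) → ℝ) (y : EuclideanSpace ℝ (Fin m)) : ℝ :=
  ∑ i, ∑ j, gramInv g e y i j * hessLoc g e F i j y

/-- The scalar product of gradients, for functions of the coordinates. -/
def gradDotLoc (g : RMetric m M) (e : OpenPartialHomeomorph M (EuclideanSpace ℝ (Fin m)))
    (F H : EuclideanSpace ℝ (Fin m) → ℝ) (y : EuclideanSpace ℝ (Fin m)) : ℝ :=
  ∑ i, ∑ j, gramInv g e y i j * (pd i F y * pd j H y)

theorem hessLoc_symm (hF : ContDiffAt ℝ 2 F y) (i j : Fin m) :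
    hessLoc g e F i j y = hessLoc g e F j i y := by
  unfold hessLoc
  rw [pd_comm i j hF]
  simp only [christoffel_symm (y := y) _ i j]

theorem gradDotLoc_eq_left : gradDotLoc g e F H y = ∑ i, gradComp g e F i y * pd i H y := by
  unfold gradDotLoc gradComp
  rw [Finset.sum_comm]
  refine Finset.sum_congr rfl fun i _ => ?_
  rw [Finset.sum_mul]
  exact Finset.sum_congr rfl fun j _ => by rw [gramInv_symm i j]; ring

theorem gradDotLoc_comm : gradDotLoc g e F H y = gradDotLoc g e H F y := by
  unfold gradDotLoc
  rw [Finset.sum_comm]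
  refine Finset.sum_congr rfl fun i _ => Finset.sum_congr rfl fun j _ => ?_
  rw [gramInv_symm i j]; ring

theorem gradComp_contDiffAt {k : ℕ∞} {l : WithTop ℕ∞}
    (he : e ∈ IsManifold.maximalAtlas (𝓡 m) ∞ M) (hy : y ∈ e.target)
    (hF : ContDiffAt ℝ l F y) (i : Fin m) (hkl : (k : WithTop ℕ∞) + 1 ≤ l := by norm_num) :
    ContDiffAt ℝ k (gradComp g e F i) y := by
  unfold gradComp
  exact ContDiffAt.sum fun j _ => ((gramInv_contDiffAt he hy i j).of_le
    (by exact_mod_cast le_top)).mul (contDiffAt_pd j hF hkl)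

theorem differentiableAt_gradComp (he : e ∈ IsManifold.maximalAtlas (𝓡 m) ∞ M)
    (hy : y ∈ e.target) (hF : ContDiffAt ℝ 2 F y) (i : Fin m) :
    DifferentiableAt ℝ (gradComp g e F i) y :=
  (gradComp_contDiffAt (k := 1) he hy hF i).differentiableAt (by simp)

/-- The covariant derivative of the gradient is the Hessian with an index raised. -/
theorem pd_gradComp (he : e ∈ IsManifold.maximalAtlas (𝓡 m) ∞ M) (hy : y ∈ e.target)
    (hF : ContDiffAt ℝ 2 F y) (k i : Fin m) :
    pd k (gradComp g e F i) y + ∑ l, christoffel g e i k l y * gradComp g e F l y =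
      ∑ j, gramInv g e y i j * hessLoc g e F k j y := by
  have hdP (i j : Fin m) : DifferentiableAt ℝ (fun z => gramInv g e z i j) y :=
    (gramInv_contDiffAt he hy i j).differentiableAt (by simp)
  have hdF (j : Fin m) : DifferentiableAt ℝ (pd j F) y :=
    differentiableAt_pd j hF
  have h1 : pd k (gradComp g e F i) y = ∑ j, (pd k (fun z => gramInv g e z i j) y * pd j F y
      + gramInv g e y i j * pd k (pd j F) y) := by
    exact pd_sum_mul _ _ (fun j _ => hdP i j) (fun j _ => hdF j)
  rw [h1]
  simp only [pd_gramInv he hy, hessLoc, gradComp, mul_sub, sub_mul, Finset.sum_add_distrib,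
    Finset.sum_sub_distrib, Finset.mul_sum, Finset.sum_mul, neg_mul, Finset.sum_neg_distrib]
  have e1 : ∑ j, ∑ l, christoffel g e i k l y * gramInv g e y l j * pd j F y =
      ∑ l, ∑ j, christoffel g e i k l y * (gramInv g e y l j * pd j F y) := by
    rw [Finset.sum_comm]
    exact Finset.sum_congr rfl fun _ _ => Finset.sum_congr rfl fun _ _ => by ring
  have e2 : ∑ j, ∑ l, christoffel g e j k l y * gramInv g e y i l * pd j F y =
      ∑ l, ∑ j, gramInv g e y i l * (christoffel g e j k l y * pd j F y) := by
    rw [Finset.sum_comm]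
    exact Finset.sum_congr rfl fun _ _ => Finset.sum_congr rfl fun _ _ => by ring
  rw [e1, e2]; ring

/-- The Laplace-Beltrami operator is the divergence of the gradient. -/
theorem lapLoc_eq_div (he : e ∈ IsManifold.maximalAtlas (𝓡 m) ∞ M) (hy : y ∈ e.target)
    (hF : ContDiffAt ℝ 2 F y) : lapLoc g e F y =
      ∑ i, (pd i (gradComp g e F i) y +
        ∑ l, christoffel g e i i l y * gradComp g e F l y) := by
  simp only [pd_gradComp he hy hF]
  rfl

/-- The differential of `∇F · ∇H`. -/
theorem pd_gradDotLoc (he : e ∈ IsManifold.maximalAtlas (𝓡 m) ∞ M) (hy : y ∈ e.target)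
    (hF : ContDiffAt ℝ 2 F y) (hH : ContDiffAt ℝ 2 H y) (k : Fin m) :
    pd k (gradDotLoc g e F H) y = ∑ j, hessLoc g e F k j y * gradComp g e H j y +
      ∑ j, hessLoc g e H k j y * gradComp g e F j y := by
  have hX (i : Fin m) : DifferentiableAt ℝ (gradComp g e F i) y :=
    differentiableAt_gradComp he hy hF i
  have hdH (j : Fin m) : DifferentiableAt ℝ (pd j H) y :=
    differentiableAt_pd j hH
  have h0 : gradDotLoc g e F H = fun z => ∑ i, gradComp g e F i z * pd i H z := by
    funext z; exact gradDotLoc_eq_left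
  rw [h0, pd_sum_mul _ _ (fun i _ => hX i) (fun i _ => hdH i)]
  have h1 (i : Fin m) : pd k (gradComp g e F i) y =
      ∑ j, gramInv g e y i j * hessLoc g e F k j y -
        ∑ l, christoffel g e i k l y * gradComp g e F l y := by
    rw [← pd_gradComp he hy hF k i]; ring
  have h2 (i : Fin m) : pd k (pd i H) y = hessLoc g e H k i y +
      ∑ l, christoffel g e l k i y * pd l H y := by
    simp [hessLoc]
  have e1 : ∑ i, (∑ j, gramInv g e y i j * hessLoc g e F k j y) * pd i H y =
      ∑ j, hessLoc g e F k j y * gradComp g e H j y := by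
    simp only [Finset.sum_mul, gradComp, Finset.mul_sum]
    rw [Finset.sum_comm]
    refine Finset.sum_congr rfl fun i _ => Finset.sum_congr rfl fun j _ => ?_
    rw [gramInv_symm i j]; ring
  have e2 : ∑ i, (∑ l, christoffel g e i k l y * gradComp g e F l y) * pd i H y =
      ∑ i, gradComp g e F i y * ∑ l, christoffel g e l k i y * pd l H y := by
    simp only [Finset.sum_mul, Finset.mul_sum]
    rw [Finset.sum_comm]
    exact Finset.sum_congr rfl fun i _ => Finset.sum_congr rfl fun j _ => by ring
  simp only [h1, h2, sub_mul, mul_add, Finset.sum_add_distrib, Finset.sum_sub_distrib]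
  rw [e1, e2]
  simp only [mul_comm (gradComp g e F _ y) (hessLoc g e H k _ y)]
  ring

/-- The scalar identity behind Bochner's formula: `x` stands for the components of the gradient,
`x1` and `x2` for their derivatives, `c` for the Christoffel symbols, `dc` for the derivatives of
these, and `B` for the covariant derivative of the gradient. -/
theorem bochner_algebra (x : Fin m → ℝ) (x1 : Fin m → Fin m → ℝ) (x2 : Fin m → Fin m → Fin m → ℝ)
    (c : Fin m → Fin m → Fin m → ℝ) (dc : Fin m → Fin m → Fin m → Fin m → ℝ)
    (B : Fin m → Fin m → ℝ) (hx2 : ∀ a l i, x2 a l i = x2 l a i)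
    (hc : ∀ k i j, c k i j = c k j i) (hB : ∀ l i, B l i = x1 l i + ∑ k, c i l k * x k) :
    (∑ i, (∑ l, ((x2 i l i + ∑ k, (dc i i l k * x k + c i l k * x1 i k)) * x l + B l i * x1 i l)
        + ∑ k, c i i k * ∑ l, B l k * x l))
      - ∑ l, x l * ∑ i, (x2 l i i + ∑ k, (dc l i i k * x k + c i i k * x1 l k)) =
    ∑ i, ∑ l, B l i * B i l + ∑ l, ∑ k, ((∑ i, dc i i l k) - (∑ i, dc l i i k)
      + (∑ i, ∑ j, c i i j * c j l k) - ∑ i, ∑ j, c i l j * c j i k) * x l * x k := by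
  -- `N` is the difference between covariant and partial derivatives; each of the identities below
  -- matches one group of terms: third derivatives cancel by symmetry, derivatives of the Christoffel
  -- symbols and their products assemble into the Ricci tensor
  set N : Fin m → Fin m → ℝ := fun i l => ∑ k, c i l k * x k with hN
  have hB' (l i : Fin m) : B l i = x1 l i + N i l := hB l i
  have a1 : ∑ i, ∑ l, (∑ k, c i l k * x1 i k) * x l = ∑ i, ∑ k, N i k * x1 i k := by
    refine Finset.sum_congr rfl fun i _ => ?_
    simp only [hN, Finset.sum_mul]
    rw [Finset.sum_comm]
    exact Finset.sum_congr rfl fun k _ => Finset.sum_congr rfl fun l _ => by rw [hc i l k]; ring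
  have a2 : ∑ i, ∑ k, c i i k * ∑ l, B l k * x l =
      (∑ l, x l * ∑ i, ∑ k, c i i k * x1 l k) +
        ∑ l, ∑ k, (∑ i, ∑ j, c i i j * c j l k) * x l * x k := by
    have b1 (i : Fin m) : ∑ k, c i i k * ∑ l, B l k * x l =
        ∑ l, (x l * ∑ k, c i i k * x1 l k + ∑ k, (∑ j, c i i j * c j l k) * x l * x k) := by
      simp only [hB', hN, add_mul, Finset.sum_add_distrib, mul_add, Finset.mul_sum, Finset.sum_mul]
      congr 1
      · rw [Finset.sum_comm]
        exact Finset.sum_congr rfl fun k _ => Finset.sum_congr rfl fun l _ => by ring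
      · rw [Finset.sum_comm]
        refine Finset.sum_congr rfl fun l _ => ?_
        rw [Finset.sum_comm]
        exact Finset.sum_congr rfl fun k _ => Finset.sum_congr rfl fun l _ => by ring
    simp only [b1]
    rw [Finset.sum_comm, ← Finset.sum_add_distrib]
    refine Finset.sum_congr rfl fun l _ => ?_
    rw [Finset.sum_add_distrib, Finset.mul_sum, Finset.sum_comm (f := fun i k => _ * x l * x k)]
    congr 1
    exact Finset.sum_congr rfl fun k _ => by rw [Finset.sum_mul, Finset.sum_mul]
  have a3 : ∑ i, ∑ l, x2 i l i * x l = ∑ l, x l * ∑ i, x2 l i i := by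
    rw [Finset.sum_comm]
    refine Finset.sum_congr rfl fun l _ => ?_
    rw [Finset.mul_sum]
    exact Finset.sum_congr rfl fun i _ => by rw [hx2 i l i]; ring
  have a4 : ∑ i, ∑ l, (∑ k, dc i i l k * x k) * x l =
      ∑ l, ∑ k, (∑ i, dc i i l k) * x l * x k := by
    rw [Finset.sum_comm]
    refine Finset.sum_congr rfl fun l _ => ?_
    simp only [Finset.sum_mul]
    rw [Finset.sum_comm]
    exact Finset.sum_congr rfl fun i _ => Finset.sum_congr rfl fun k _ => by ring
  have a5 : ∑ l, x l * ∑ i, ∑ k, dc l i i k * x k =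
      ∑ l, ∑ k, (∑ i, dc l i i k) * x l * x k := by
    refine Finset.sum_congr rfl fun l _ => ?_
    simp only [Finset.sum_mul, Finset.mul_sum]
    rw [Finset.sum_comm]
    exact Finset.sum_congr rfl fun i _ => Finset.sum_congr rfl fun k _ => by ring
  have a6 : ∑ l, ∑ k, (∑ i, ∑ j, c i l j * c j i k) * x l * x k = ∑ i, ∑ l, N i l * N l i := by
    have b1 (i j : Fin m) : N i j * N j i = ∑ l, ∑ k, c i l j * c j i k * x l * x k := by
      simp only [hN]
      rw [Finset.sum_mul_sum]
      exact Finset.sum_congr rfl fun l _ => Finset.sum_congr rfl fun k _ => by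
        rw [hc i j l]; ring
    simp only [b1, Finset.sum_mul]
    calc _ = ∑ l, ∑ i, ∑ k, ∑ j, c i l j * c j i k * x l * x k :=
          Finset.sum_congr rfl fun l _ => Finset.sum_comm
      _ = ∑ i, ∑ l, ∑ k, ∑ j, c i l j * c j i k * x l * x k := Finset.sum_comm
      _ = ∑ i, ∑ l, ∑ j, ∑ k, c i l j * c j i k * x l * x k :=
          Finset.sum_congr rfl fun l _ => Finset.sum_congr rfl fun i _ => Finset.sum_comm
      _ = _ := Finset.sum_congr rfl fun l _ => Finset.sum_comm
  have a7 : ∑ i, ∑ l, N l i * x1 l i = ∑ i, ∑ l, N i l * x1 i l := Finset.sum_comm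
  have a8 : ∑ i, ∑ l, B l i * B i l = (∑ i, ∑ l, B l i * x1 i l) + (∑ i, ∑ l, N i l * x1 i l)
      + ∑ i, ∑ l, N i l * N l i := by
    rw [← a7]
    simp only [← Finset.sum_add_distrib]
    exact Finset.sum_congr rfl fun i _ => Finset.sum_congr rfl fun l _ => by
      rw [hB' l i, hB' i l]; ring
  simp only [Finset.sum_add_distrib, mul_add, add_mul, sub_mul, Finset.sum_sub_distrib]
  rw [a1, a2, a3, a4, a5, a6, a8]
  ring

end LocalCalculus

/-! ### Bochner's formula in a chart -/

section LocalBochner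

variable {m : ℕ} {M : Type*} [TopologicalSpace M] [ChartedSpace (EuclideanSpace ℝ (Fin m)) M]
  [IsManifold (𝓡 m) ∞ M] {g : RMetric m M}
  {e e' : OpenPartialHomeomorph M (EuclideanSpace ℝ (Fin m))} {y : EuclideanSpace ℝ (Fin m)}
  {F H : EuclideanSpace ℝ (Fin m) → ℝ}

theorem gradDotLoc_contDiffAt {k : ℕ∞} {l : WithTop ℕ∞}
    (he : e ∈ IsManifold.maximalAtlas (𝓡 m) ∞ M) (hy : y ∈ e.target)
    (hF : ContDiffAt ℝ l F y) (hH : ContDiffAt ℝ l H y)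
    (hkl : (k : WithTop ℕ∞) + 1 ≤ l := by norm_num) :
    ContDiffAt ℝ k (gradDotLoc g e F H) y := by
  unfold gradDotLoc
  exact ContDiffAt.sum fun i _ => ContDiffAt.sum fun j _ => ((gramInv_contDiffAt he hy i j).of_le
    (by exact_mod_cast le_top)).mul ((contDiffAt_pd i hF hkl).mul (contDiffAt_pd j hH hkl))

theorem lapLoc_contDiffAt {k : ℕ∞} {l : WithTop ℕ∞}
    (he : e ∈ IsManifold.maximalAtlas (𝓡 m) ∞ M) (hy : y ∈ e.target)
    (hF : ContDiffAt ℝ l F y) (hkl : (k : WithTop ℕ∞) + 1 + 1 ≤ l := by norm_num) :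
    ContDiffAt ℝ k (lapLoc g e F) y := by
  have h1 : (k : WithTop ℕ∞) + 1 ≤ l := le_trans le_self_add hkl
  unfold lapLoc hessLoc
  refine ContDiffAt.sum fun i _ => ContDiffAt.sum fun j _ => ((gramInv_contDiffAt he hy i j).of_le
    (by exact_mod_cast le_top)).mul (ContDiffAt.sub ?_ (ContDiffAt.sum fun a _ => ?_))
  · exact contDiffAt_pd i (contDiffAt_pd j hF hkl) le_rfl
  · exact ((christoffel_contDiffAt he hy a i j).of_le (by exact_mod_cast le_top)).mul
      (contDiffAt_pd a hF h1)

theorem gradDotLoc_congr {F' H' : EuclideanSpace ℝ (Fin m) → ℝ} (hF : F =ᶠ[nhds y] F')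
    (hH : H =ᶠ[nhds y] H') : gradDotLoc g e F H y = gradDotLoc g e F' H' y := by
  simp only [gradDotLoc, pd_congr _ hF, pd_congr _ hH]

theorem pd_eventuallyEq {F' : EuclideanSpace ℝ (Fin m) → ℝ} (i : Fin m)
    (hF : F =ᶠ[nhds y] F') : pd i F =ᶠ[nhds y] pd i F' := by
  filter_upwards [hF.eventuallyEq_nhds] with z hz using pd_congr i hz

theorem lapLoc_congr {F' : EuclideanSpace ℝ (Fin m) → ℝ} (hF : F =ᶠ[nhds y] F') :
    lapLoc g e F y = lapLoc g e F' y := by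
  simp only [lapLoc, hessLoc, pd_congr _ hF, pd_congr _ (pd_eventuallyEq _ hF)]

/-- The covariant derivative `∇_l X^i` of the gradient `X` of `F`. -/
def covGrad (g : RMetric m M) (e : OpenPartialHomeomorph M (EuclideanSpace ℝ (Fin m)))
    (F : EuclideanSpace ℝ (Fin m) → ℝ) (l i : Fin m) (y : EuclideanSpace ℝ (Fin m)) : ℝ :=
  pd l (gradComp g e F i) y + ∑ k, christoffel g e i l k y * gradComp g e F k y

/-- Bochner's formula in a chart. -/
theorem bochner_loc (he : e ∈ IsManifold.maximalAtlas (𝓡 m) ∞ M) (hy : y ∈ e.target)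
    (hF : ContDiffAt ℝ 3 F y) :
    1 / 2 * lapLoc g e (gradDotLoc g e F F) y - gradDotLoc g e F (lapLoc g e F) y =
      ∑ i, ∑ l, covGrad g e F l i y * covGrad g e F i l y +
        ∑ i, ∑ j, ricciCoord g e i j y * gradComp g e F i y * gradComp g e F j y := by
  have hev : ∀ᶠ z in nhds y, z ∈ e.target ∧ ContDiffAt ℝ 3 F z :=
    (e.open_target.eventually_mem hy).and (hF.eventually (by simp))
  have hle : (2 : WithTop ℕ∞) ≤ 3 := by norm_num
  have hX2 (i : Fin m) : ContDiffAt ℝ 2 (gradComp g e F i) y :=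
    gradComp_contDiffAt (k := 2) he hy hF i
  have hX1 (i : Fin m) : DifferentiableAt ℝ (gradComp g e F i) y :=
    (hX2 i).differentiableAt (by simp)
  have hpdX (l i : Fin m) : DifferentiableAt ℝ (pd l (gradComp g e F i)) y :=
    differentiableAt_pd l (hX2 i)
  have hΓ (k i j : Fin m) : DifferentiableAt ℝ (christoffel g e k i j) y :=
    (christoffel_contDiffAt he hy k i j).differentiableAt (by simp)
  have hΓX (i l : Fin m) : DifferentiableAt ℝ
      (fun z => ∑ k, christoffel g e i l k z * gradComp g e F k z) y :=
    DifferentiableAt.fun_sum fun k _ => (hΓ i l k).mul (hX1 k)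
  have hB (l i : Fin m) : DifferentiableAt ℝ (covGrad g e F l i) y := (hpdX l i).add (hΓX i l)
  -- the derivative of the covariant derivative of the gradient
  have hdB (a l i : Fin m) : pd a (covGrad g e F l i) y = pd a (pd l (gradComp g e F i)) y +
      ∑ k, (pd a (christoffel g e i l k) y * gradComp g e F k y +
        christoffel g e i l k y * pd a (gradComp g e F k) y) := by
    unfold covGrad
    rw [pd_add a (hpdX l i) (hΓX i l), pd_sum_mul _ _ (fun k _ => hΓ i l k) (fun k _ => hX1 k)]
  -- the gradient of `|∇F|²`
  have hu : ContDiffAt ℝ 2 (gradDotLoc g e F F) y := gradDotLoc_contDiffAt (k := 2) he hy hF hF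
  have hgu (i : Fin m) : gradComp g e (gradDotLoc g e F F) i =ᶠ[nhds y]
      fun z => 2 * ∑ l, covGrad g e F l i z * gradComp g e F l z := by
    filter_upwards [hev] with z hz
    have h2 := hz.2.of_le hle
    have key : ∑ j, gramInv g e z i j * ∑ l, hessLoc g e F j l z * gradComp g e F l z =
        ∑ l, covGrad g e F l i z * gradComp g e F l z := by
      simp only [covGrad, pd_gradComp he hz.1 h2, Finset.mul_sum, Finset.sum_mul]
      rw [Finset.sum_comm]
      exact Finset.sum_congr rfl fun l _ => Finset.sum_congr rfl fun j _ => by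
        rw [hessLoc_symm h2 j l]; ring
    change ∑ j, gramInv g e z i j * pd j (gradDotLoc g e F F) z = _
    simp only [pd_gradDotLoc he hz.1 h2 h2, ← two_mul, ← key, Finset.mul_sum]
    exact Finset.sum_congr rfl fun l _ => Finset.sum_congr rfl fun j _ => by ring
  have hS (i : Fin m) : pd i (gradComp g e (gradDotLoc g e F F) i) y =
      2 * ∑ l, (pd i (covGrad g e F l i) y * gradComp g e F l y +
        covGrad g e F l i y * pd i (gradComp g e F l) y) := by
    rw [pd_congr i (hgu i), pd_const_mul (F := fun z => ∑ l, covGrad g e F l i z *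
      gradComp g e F l z) i 2 (DifferentiableAt.fun_sum fun l _ => (hB l i).mul (hX1 l)),
      pd_sum_mul _ _ (fun l _ => hB l i) (fun l _ => hX1 l)]
  -- the differential of the Laplacian, seen as the trace of the covariant derivative
  have hD : lapLoc g e F =ᶠ[nhds y] fun z => ∑ i, covGrad g e F i i z := by
    filter_upwards [hev] with z hz using lapLoc_eq_div he hz.1 (hz.2.of_le hle)
  have hpdD (l : Fin m) : pd l (lapLoc g e F) y = ∑ i, pd l (covGrad g e F i i) y := by
    rw [pd_congr l hD, pd_sum _ _ fun i _ => hB i i]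
  have key := bochner_algebra (fun i => gradComp g e F i y) (fun l i => pd l (gradComp g e F i) y)
    (fun a l i => pd a (pd l (gradComp g e F i)) y) (fun k i j => christoffel g e k i j y)
    (fun a k i j => pd a (christoffel g e k i j) y) (fun l i => covGrad g e F l i y)
    (fun a l i => pd_comm a l (hX2 i)) (fun k i j => christoffel_symm k i j) (fun l i => rfl)
  rw [lapLoc_eq_div he hy hu, gradDotLoc_eq_left]
  simp only [hS, hpdD, hdB, fun i => (hgu i).eq_of_nhds]
  refine Eq.trans ?_ (key.trans ?_)
  · congr 1
    rw [Finset.mul_sum]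
    refine Finset.sum_congr rfl fun i _ => ?_
    rw [mul_add, ← mul_assoc, Finset.mul_sum (Finset.univ) (fun l => christoffel g e i i l y * _)]
    congr 1
    · norm_num
    · exact Finset.sum_congr rfl fun k _ => by ring
  · congr 1
    have hs (k i j : Fin m) : christoffel g e k i j = christoffel g e k j i :=
      funext fun z => christoffel_symm k i j
    rw [Finset.sum_comm]
    refine Finset.sum_congr rfl fun i _ => Finset.sum_congr rfl fun j _ => ?_
    simp only [ricciCoord, hs _ j i, hs _ _ i]
    ring

end LocalBochner

/-! ### Independence of the chart -/

section ChangeOfCharts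

variable {m : ℕ} {M : Type*} [TopologicalSpace M] [ChartedSpace (EuclideanSpace ℝ (Fin m)) M]
  [IsManifold (𝓡 m) ∞ M] {g : RMetric m M}
  {e e' : OpenPartialHomeomorph M (EuclideanSpace ℝ (Fin m))} {y : EuclideanSpace ℝ (Fin m)}
  {x : M} {u v f : M → ℝ}

/-- The Jacobian matrix of the change of charts from `e` to `e'`; rows are indexed by the
coordinates of `e`. -/
def transJac (e e' : OpenPartialHomeomorph M (EuclideanSpace ℝ (Fin m)))
    (y : EuclideanSpace ℝ (Fin m)) : Matrix (Fin m) (Fin m) ℝ :=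
  Matrix.of fun i j => pd i (fun z => e' (e.symm z) j) y

theorem contDiffAt_comp_symm {k : WithTop ℕ∞} (hk : k ≤ ∞)
    (he : e ∈ IsManifold.maximalAtlas (𝓡 m) ∞ M) (hy : y ∈ e.target)
    (hf : ContMDiffAt (𝓡 m) 𝓘(ℝ, ℝ) k f (e.symm y)) : ContDiffAt ℝ k (f ∘ e.symm) y := by
  rw [← contMDiffAt_iff_contDiffAt]
  exact hf.comp y ((contMDiffAt_symm_of_mem_maximalAtlas he hy).of_le hk)

theorem contMDiffAt_of_comp_symm {k : WithTop ℕ∞} (hk : k ≤ ∞)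
    (he : e ∈ IsManifold.maximalAtlas (𝓡 m) ∞ M) (hx : x ∈ e.source)
    (hf : ContDiffAt ℝ k (f ∘ e.symm) (e x)) : ContMDiffAt (𝓡 m) 𝓘(ℝ, ℝ) k f x := by
  have h1 : ContMDiffAt (𝓡 m) 𝓘(ℝ, ℝ) k ((f ∘ e.symm) ∘ e) x :=
    ContMDiffAt.comp x (contMDiffAt_iff_contDiffAt.2 hf)
      ((contMDiffAt_of_mem_maximalAtlas he hx).of_le hk)
  refine h1.congr_of_eventuallyEq ?_
  filter_upwards [e.open_source.mem_nhds hx] with z hz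
  simp [e.left_inv hz]

theorem contDiffAt_trans (he : e ∈ IsManifold.maximalAtlas (𝓡 m) ∞ M)
    (he' : e' ∈ IsManifold.maximalAtlas (𝓡 m) ∞ M) (hy : y ∈ e.target)
    (hy' : e.symm y ∈ e'.source) : ContDiffAt ℝ ∞ (fun z => e' (e.symm z)) y := by
  rw [← contMDiffAt_iff_contDiffAt]
  exact (contMDiffAt_of_mem_maximalAtlas he' hy').comp y
    (contMDiffAt_symm_of_mem_maximalAtlas he hy)

theorem contMDiffAt_coord (he : e ∈ IsManifold.maximalAtlas (𝓡 m) ∞ M) (hx : x ∈ e.source)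
    (a : Fin m) : ContMDiffAt (𝓡 m) 𝓘(ℝ, ℝ) ∞ (fun z => e z a) x :=
  ContMDiffAt.comp x
    (contMDiffAt_iff_contDiffAt.2
      (EuclideanSpace.proj a : EuclideanSpace ℝ (Fin m) →L[ℝ] ℝ).contDiff.contDiffAt)
    (contMDiffAt_of_mem_maximalAtlas he hx)

theorem pd_trans (he : e ∈ IsManifold.maximalAtlas (𝓡 m) ∞ M)
    (he' : e' ∈ IsManifold.maximalAtlas (𝓡 m) ∞ M) (hy : y ∈ e.target)
    (hy' : e.symm y ∈ e'.source) (hu : ContMDiffAt (𝓡 m) 𝓘(ℝ, ℝ) 1 u (e.symm y)) (i : Fin m) :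
    pd i (u ∘ e.symm) y =
      ∑ j, transJac e e' y i j * pd j (u ∘ e'.symm) (e' (e.symm y)) := by
  have h1 : u ∘ e.symm =ᶠ[nhds y] (u ∘ e'.symm) ∘ fun z => e' (e.symm z) := by
    have : ∀ᶠ z in nhds y, e.symm z ∈ e'.source :=
      (e.continuousAt_symm hy).eventually_mem (e'.open_source.mem_nhds hy')
    filter_upwards [this] with z hz
    simp [e'.left_inv hz]
  rw [pd_congr i h1]
  refine pd_comp i ?_ ((contDiffAt_trans he he' hy hy').differentiableAt (by simp))
  refine (contDiffAt_comp_symm (k := 1) (by simp) he' (e'.map_source hy') ?_).differentiableAt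
    (by simp)
  rwa [e'.left_inv hy']

theorem gram_trans (he : e ∈ IsManifold.maximalAtlas (𝓡 m) ∞ M)
    (he' : e' ∈ IsManifold.maximalAtlas (𝓡 m) ∞ M) (hy : y ∈ e.target)
    (hy' : e.symm y ∈ e'.source) :
    gram g e y = transJac e e' y * gram g e' (e' (e.symm y)) * (transJac e e' y).transpose := by
  have hψ := (contDiffAt_trans he he' hy hy').differentiableAt (by simp)
  let V : Fin m → EuclideanSpace ℝ (Fin m) := fun j => coordVec e' (e' (e.symm y)) j
  let B : M → EuclideanSpace ℝ (Fin m) →L[ℝ] EuclideanSpace ℝ (Fin m) →L[ℝ] ℝ := g.inner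
  -- the chain rule for `e.symm = e'.symm ∘ (e' ∘ e.symm)` expresses `∂_i` in the frame of `e'`
  have hvec (i : Fin m) : (coordVec e y i : EuclideanSpace ℝ (Fin m)) =
      ∑ j, transJac e e' y i j • V j := by
    have h1 : (e.symm : EuclideanSpace ℝ (Fin m) → M) =ᶠ[nhds y]
        e'.symm ∘ fun z => e' (e.symm z) := by
      have : ∀ᶠ z in nhds y, e.symm z ∈ e'.source :=
        (e.continuousAt_symm hy).eventually_mem (e'.open_source.mem_nhds hy')
      filter_upwards [this] with z hz
      simp [e'.left_inv hz]
    have h2 : HasMFDerivAt (𝓡 m) (𝓡 m) e.symm y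
        ((mfderiv (𝓡 m) (𝓡 m) e'.symm (e' (e.symm y))).comp
          (fderiv ℝ (fun z => e' (e.symm z)) y)) := by
      refine HasMFDerivAt.congr_of_eventuallyEq ?_ h1
      exact HasMFDerivAt.comp y (((mdifferentiable_of_mem_maximalAtlas he').mdifferentiableAt_symm
        (e'.map_source hy')).hasMFDerivAt) hψ.hasFDerivAt.hasMFDerivAt
    let D : EuclideanSpace ℝ (Fin m) →L[ℝ] EuclideanSpace ℝ (Fin m) :=
      mfderiv (𝓡 m) (𝓡 m) e'.symm (e' (e.symm y))
    have h3 : (coordVec e y i : EuclideanSpace ℝ (Fin m)) =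
        D (fderiv ℝ (fun z => e' (e.symm z)) y (EuclideanSpace.single i 1)) := by
      unfold coordVec
      rw [h2.mfderiv]; rfl
    have h4 : fderiv ℝ (fun z => e' (e.symm z)) y (EuclideanSpace.single i 1) =
        ∑ j, transJac e e' y i j • EuclideanSpace.single j (1 : ℝ) := by
      ext a
      have := ((EuclideanSpace.proj a : EuclideanSpace ℝ (Fin m) →L[ℝ] ℝ).hasFDerivAt
        (x := e' (e.symm y))).comp y hψ.hasFDerivAt
      have h5 : transJac e e' y i a =
          (fderiv ℝ (fun z => e' (e.symm z)) y (EuclideanSpace.single i 1)) a := by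
        simp only [transJac, Matrix.of_apply, pd]
        rw [show (fun z => (e' (e.symm z)) a) = (EuclideanSpace.proj a :
          EuclideanSpace ℝ (Fin m) →L[ℝ] ℝ) ∘ fun z => e' (e.symm z) from rfl, this.fderiv]
        rfl
      rw [← h5]
      simp [Finset.sum_apply, Pi.single_apply]
    rw [h3, h4, map_sum]
    simp only [map_smul]
    rfl
  have hB : B (e.symm y) = B (e'.symm (e' (e.symm y))) := by rw [e'.left_inv hy']
  ext i j
  change B (e.symm y) (coordVec e y i) (coordVec e y j) = _
  rw [hB, hvec i, hvec j]
  simp only [map_sum, map_smul, sum_apply, smul_apply, smul_eq_mul, Matrix.mul_apply,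
    Matrix.transpose_apply, Finset.sum_mul, Finset.mul_sum]
  refine Finset.sum_congr rfl fun a _ => Finset.sum_congr rfl fun b _ => ?_
  change _ = _ * B _ (V _) (V _) * _
  ring

theorem gramInv_trans (he : e ∈ IsManifold.maximalAtlas (𝓡 m) ∞ M)
    (he' : e' ∈ IsManifold.maximalAtlas (𝓡 m) ∞ M) (hy : y ∈ e.target)
    (hy' : e.symm y ∈ e'.source) :
    gramInv g e' (e' (e.symm y)) =
      (transJac e e' y).transpose * gramInv g e y * transJac e e' y := by
  set J := transJac e e' y
  set G' := gram g e' (e' (e.symm y)) with hG'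
  have h1 : J * (G' * J.transpose * gramInv g e y) = 1 := by
    rw [← gram_mul_gramInv (g := g) he hy, gram_trans he he' hy hy']
    simp only [Matrix.mul_assoc, J, hG']
  have h2 : G' * (J.transpose * gramInv g e y * J) = 1 := by
    have := mul_eq_one_comm.1 h1
    simpa only [Matrix.mul_assoc] using this
  exact Matrix.inv_eq_right_inv h2

/-- The scalar product of gradients can be computed in any chart. -/
theorem gradDotLoc_trans (he : e ∈ IsManifold.maximalAtlas (𝓡 m) ∞ M)
    (he' : e' ∈ IsManifold.maximalAtlas (𝓡 m) ∞ M) (hy : y ∈ e.target)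
    (hy' : e.symm y ∈ e'.source) (hu : ContMDiffAt (𝓡 m) 𝓘(ℝ, ℝ) 1 u (e.symm y))
    (hv : ContMDiffAt (𝓡 m) 𝓘(ℝ, ℝ) 1 v (e.symm y)) :
    gradDotLoc g e (u ∘ e.symm) (v ∘ e.symm) y =
      gradDotLoc g e' (u ∘ e'.symm) (v ∘ e'.symm) (e' (e.symm y)) := by
  have key (e : OpenPartialHomeomorph M (EuclideanSpace ℝ (Fin m)))
      (F H : EuclideanSpace ℝ (Fin m) → ℝ) (y : EuclideanSpace ℝ (Fin m)) :
      gradDotLoc g e F H y =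
        (fun i => pd i F y) ⬝ᵥ (gramInv g e y).mulVec (fun j => pd j H y) := by
    simp only [gradDotLoc, dotProduct, Matrix.mulVec, Finset.mul_sum]
    exact Finset.sum_congr rfl fun i _ => Finset.sum_congr rfl fun j _ => by ring
  have hpd {w : M → ℝ} (hw : ContMDiffAt (𝓡 m) 𝓘(ℝ, ℝ) 1 w (e.symm y)) :
      (fun i => pd i (w ∘ e.symm) y) =
        (transJac e e' y).mulVec (fun j => pd j (w ∘ e'.symm) (e' (e.symm y))) := by
    funext i
    exact pd_trans he he' hy hy' hw i
  rw [key, key, hpd hu, hpd hv, gramInv_trans he he' hy hy', Matrix.mulVec_mulVec,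
    Matrix.dotProduct_mulVec, ← Matrix.vecMul_transpose, Matrix.vecMul_vecMul,
    ← Matrix.dotProduct_mulVec, Matrix.mul_assoc]

theorem gradDot_eq_gradDotLoc (he : e ∈ IsManifold.maximalAtlas (𝓡 m) ∞ M) (hx : x ∈ e.source)
    (hu : ContMDiffAt (𝓡 m) 𝓘(ℝ, ℝ) 1 u x) (hv : ContMDiffAt (𝓡 m) 𝓘(ℝ, ℝ) 1 v x) :
    gradDot g u v x = gradDotLoc g e (u ∘ e.symm) (v ∘ e.symm) (e x) := by
  have hx' := mem_chart_source (EuclideanSpace ℝ (Fin m)) x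
  have h := gradDotLoc_trans (g := g) (u := u) (v := v)
    (IsManifold.chart_mem_maximalAtlas (I := 𝓡 m) (n := ∞) x) he
    (OpenPartialHomeomorph.map_source _ hx') (by rwa [OpenPartialHomeomorph.left_inv _ hx'])
    (by rwa [OpenPartialHomeomorph.left_inv _ hx']) (by rwa [OpenPartialHomeomorph.left_inv _ hx'])
  rw [OpenPartialHomeomorph.left_inv _ hx'] at h
  exact h

theorem eventually_contMDiffAt {k : WithTop ℕ∞} (hu : ContMDiffAt (𝓡 m) 𝓘(ℝ, ℝ) k u x)
    (hk : k ≤ ∞ := by simp) (hk' : k ≠ ∞ := by simp) :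
    ∀ᶠ z in nhds x, ContMDiffAt (𝓡 m) 𝓘(ℝ, ℝ) k u z := by
  have : IsManifold (𝓡 m) k M := IsManifold.of_le hk
  exact contMDiffAt_iff_contMDiffAt_nhds hk' |>.1 hu

theorem eventually_comp_symm (hx : x ∈ e.source) {p : M → Prop} (h : ∀ᶠ z in nhds x, p z) :
    ∀ᶠ y in nhds (e x), p (e.symm y) := by
  have := e.continuousAt_symm (e.map_source hx)
  rw [ContinuousAt, e.left_inv hx] at this
  exact this.eventually h

theorem gradDot_comp_symm (he : e ∈ IsManifold.maximalAtlas (𝓡 m) ∞ M) (hx : x ∈ e.source)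
    (hu : ContMDiffAt (𝓡 m) 𝓘(ℝ, ℝ) 1 u x) (hv : ContMDiffAt (𝓡 m) 𝓘(ℝ, ℝ) 1 v x) :
    gradDot g u v ∘ e.symm =ᶠ[nhds (e x)] gradDotLoc g e (u ∘ e.symm) (v ∘ e.symm) := by
  filter_upwards [eventually_comp_symm hx (eventually_contMDiffAt hu),
    eventually_comp_symm hx (eventually_contMDiffAt hv),
    e.open_target.mem_nhds (e.map_source hx)] with z h1 h2 h3
  rw [Function.comp_apply, gradDot_eq_gradDotLoc he (e.map_target h3) h1 h2, e.right_inv h3]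

theorem gradDot_contMDiffAt {k : ℕ∞} {l : ℕ∞} (hkl : k + 1 ≤ l)
    (hu : ContMDiffAt (𝓡 m) 𝓘(ℝ, ℝ) l u x) (hv : ContMDiffAt (𝓡 m) 𝓘(ℝ, ℝ) l v x) :
    ContMDiffAt (𝓡 m) 𝓘(ℝ, ℝ) k (gradDot g u v) x := by
  have he := IsManifold.chart_mem_maximalAtlas (I := 𝓡 m) (n := ∞) x
  have hx := mem_chart_source (EuclideanSpace ℝ (Fin m)) x
  have h1 : (1 : WithTop ℕ∞) ≤ l := by exact_mod_cast le_trans le_add_self hkl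
  have hl : (l : WithTop ℕ∞) ≤ ∞ := by exact_mod_cast le_top
  refine contMDiffAt_of_comp_symm (by exact_mod_cast le_top) he hx ?_
  refine ContDiffAt.congr_of_eventuallyEq ?_
    (gradDot_comp_symm he hx (hu.of_le h1) (hv.of_le h1))
  have hy := OpenPartialHomeomorph.map_source _ hx
  exact gradDotLoc_contDiffAt he hy
    (contDiffAt_comp_symm hl he hy (by rwa [OpenPartialHomeomorph.left_inv _ hx]))
    (contDiffAt_comp_symm hl he hy (by rwa [OpenPartialHomeomorph.left_inv _ hx]))
    (by exact_mod_cast hkl)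

theorem gradDot_comm : gradDot g u v x = gradDot g v u x :=
  gradDotLoc_comm (g := g) (e := chartAt _ x)

end ChangeOfCharts

/-! ### The Laplace-Beltrami operator and Bochner's formula on the manifold -/

theorem two_le_infty : (2 : WithTop ℕ∞) ≤ ∞ := WithTop.coe_le_coe.2 (le_top (a := (2 : ℕ∞)))

theorem three_le_infty : (3 : WithTop ℕ∞) ≤ ∞ := WithTop.coe_le_coe.2 (le_top (a := (3 : ℕ∞)))

theorem two_ne_infty : (2 : WithTop ℕ∞) ≠ ∞ :=
  fun h => ENat.natCast_ne_top 2 (WithTop.coe_injective h)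

section Invariance

variable {m : ℕ} {M : Type*} [TopologicalSpace M] [ChartedSpace (EuclideanSpace ℝ (Fin m)) M]
  [IsManifold (𝓡 m) ∞ M] {g : RMetric m M}
  {e e' : OpenPartialHomeomorph M (EuclideanSpace ℝ (Fin m))} {y : EuclideanSpace ℝ (Fin m)}
  {F U V : EuclideanSpace ℝ (Fin m) → ℝ} {x : M} {u v f p : M → ℝ}

/-- The Hessian is determined by the scalar products of gradients. -/
theorem two_mul_hessLoc_gradComp (he : e ∈ IsManifold.maximalAtlas (𝓡 m) ∞ M)
    (hy : y ∈ e.target) (hF : ContDiffAt ℝ 2 F y) (hU : ContDiffAt ℝ 2 U y)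
    (hV : ContDiffAt ℝ 2 V y) :
    2 * ∑ k, ∑ j, hessLoc g e F k j y * gradComp g e U k y * gradComp g e V j y =
      gradDotLoc g e U (gradDotLoc g e F V) y + gradDotLoc g e V (gradDotLoc g e F U) y
        - gradDotLoc g e F (gradDotLoc g e U V) y := by
  set S : (EuclideanSpace ℝ (Fin m) → ℝ) → (EuclideanSpace ℝ (Fin m) → ℝ) →
      (EuclideanSpace ℝ (Fin m) → ℝ) → ℝ := fun F U V =>
    ∑ k, ∑ j, hessLoc g e F k j y * gradComp g e U k y * gradComp g e V j y with hS
  have hsymm {F U V : EuclideanSpace ℝ (Fin m) → ℝ} (hF : ContDiffAt ℝ 2 F y) :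
      S F U V = S F V U := by
    simp only [hS]
    rw [Finset.sum_comm]
    exact Finset.sum_congr rfl fun i _ => Finset.sum_congr rfl fun j _ => by
      rw [hessLoc_symm hF i j]; ring
  have key {F U V : EuclideanSpace ℝ (Fin m) → ℝ} (hF : ContDiffAt ℝ 2 F y)
      (hV : ContDiffAt ℝ 2 V y) :
      gradDotLoc g e U (gradDotLoc g e F V) y = S F U V + S V U F := by
    rw [gradDotLoc_eq_left]
    simp only [pd_gradDotLoc he hy hF hV, hS, mul_add, Finset.sum_add_distrib, Finset.mul_sum]
    congr 1 <;>
    exact Finset.sum_congr rfl fun i _ => Finset.sum_congr rfl fun j _ => by ring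
  rw [key hF hV, key hF hU, key hU hV, hsymm hF (U := V), hsymm hU (U := V), hsymm hV (U := U)]
  simp only [hS]; ring

/-- A formula for the Laplace-Beltrami operator in the chart `e` which only involves scalar
products of gradients of `f` and of the coordinates of another chart `e'`. Its right side does not
depend on `e`, which avoids the transformation law of the Christoffel symbols. -/
theorem lapLoc_eq_sum_gradDot (he : e ∈ IsManifold.maximalAtlas (𝓡 m) ∞ M)
    (he' : e' ∈ IsManifold.maximalAtlas (𝓡 m) ∞ M) (hx : x ∈ e.source) (hx' : x ∈ e'.source)
    (hf : ContMDiffAt (𝓡 m) 𝓘(ℝ, ℝ) 2 f x) :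
    lapLoc g e (f ∘ e.symm) (e x) = 1 / 2 * ∑ a, ∑ b, gram g e' (e' x) a b *
      (gradDot g (fun z => e' z a) (gradDot g f (fun z => e' z b)) x +
        gradDot g (fun z => e' z b) (gradDot g f (fun z => e' z a)) x -
        gradDot g f (gradDot g (fun z => e' z a) (fun z => e' z b)) x) := by
  have hy := e.map_source hx
  have hl := e.left_inv hx
  have hc (a : Fin m) : ContMDiffAt (𝓡 m) 𝓘(ℝ, ℝ) 2 (fun z => e' z a) x :=
    (contMDiffAt_coord he' hx' a).of_le two_le_infty
  have h21 : (1 : WithTop ℕ∞) ≤ 2 := by norm_num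
  have hloc {u v w : M → ℝ} (hu : ContMDiffAt (𝓡 m) 𝓘(ℝ, ℝ) 2 u x)
      (hv : ContMDiffAt (𝓡 m) 𝓘(ℝ, ℝ) 2 v x) (hw : ContMDiffAt (𝓡 m) 𝓘(ℝ, ℝ) 2 w x) :
      gradDot g u (gradDot g v w) x = gradDotLoc g e (u ∘ e.symm)
        (gradDotLoc g e (v ∘ e.symm) (w ∘ e.symm)) (e x) := by
    rw [gradDot_eq_gradDotLoc he hx (hu.of_le h21)
      (gradDot_contMDiffAt (k := 1) (l := 2) (by norm_num) hv hw)]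
    exact gradDotLoc_congr Filter.EventuallyEq.rfl
      (gradDot_comp_symm he hx (hv.of_le h21) (hw.of_le h21))
  have hcs {u : M → ℝ} (hu : ContMDiffAt (𝓡 m) 𝓘(ℝ, ℝ) 2 u x) :
      ContDiffAt ℝ 2 (u ∘ e.symm) (e x) :=
    contDiffAt_comp_symm two_le_infty he hy (by rwa [hl])
  simp only [hloc (hc _) hf (hc _), hloc hf (hc _) (hc _),
    ← two_mul_hessLoc_gradComp he hy (hcs hf) (hcs (hc _)) (hcs (hc _))]
  set J := transJac e e' (e x) with hJ
  set P := gramInv g e (e x) with hP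
  have hgc (a i : Fin m) : gradComp g e ((fun z => e' z a) ∘ e.symm) i (e x) = (P * J) i a := by
    rw [Matrix.mul_apply]; rfl
  -- the gradients of the coordinates of `e'` are the columns of `P J`, and `g_{e'}` contracts two of
  -- them to the inverse metric `P` of `e`
  have hPJ : P * J * gram g e' (e' x) * (P * J).transpose = P := by
    have h1 := gram_trans (g := g) he he' hy (by rwa [hl])
    rw [hl] at h1
    have hPt : P.transpose = P := by ext i j; exact gramInv_symm j i
    rw [Matrix.transpose_mul, hPt]
    calc _ = P * (J * gram g e' (e' x) * J.transpose) * P := by simp only [Matrix.mul_assoc]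
      _ = P := by rw [← h1, gramInv_mul_gram he hy, Matrix.one_mul]
  simp only [hgc]
  have hsum (k j : Fin m) : P k j =
      ∑ a, ∑ b, gram g e' (e' x) a b * (P * J) k a * (P * J) j b := by
    conv_lhs => rw [← hPJ]
    rw [Matrix.mul_apply]
    simp only [Matrix.mul_apply (M := P * J) (N := gram g e' (e' x)), Finset.sum_mul,
      Matrix.transpose_apply]
    rw [Finset.sum_comm]
    exact Finset.sum_congr rfl fun a _ => Finset.sum_congr rfl fun b _ => by ring
  have hflip (Φ : Fin m → Fin m → Fin m → Fin m → ℝ) :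
      ∑ k, ∑ j, ∑ a, ∑ b, Φ k j a b = ∑ a, ∑ b, ∑ k, ∑ j, Φ k j a b := by
    calc _ = ∑ k, ∑ a, ∑ j, ∑ b, Φ k j a b := Finset.sum_congr rfl fun _ _ => Finset.sum_comm
      _ = ∑ a, ∑ k, ∑ j, ∑ b, Φ k j a b := Finset.sum_comm
      _ = ∑ a, ∑ k, ∑ b, ∑ j, Φ k j a b := Finset.sum_congr rfl fun _ _ =>
          Finset.sum_congr rfl fun _ _ => Finset.sum_comm
      _ = _ := Finset.sum_congr rfl fun _ _ => Finset.sum_comm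
  have hlap : lapLoc g e (f ∘ e.symm) (e x) =
      ∑ k, ∑ j, P k j * hessLoc g e (f ∘ e.symm) k j (e x) := rfl
  rw [hlap]
  simp only [hsum, Finset.sum_mul, Finset.mul_sum]
  rw [hflip]
  exact Finset.sum_congr rfl fun _ _ => Finset.sum_congr rfl fun _ _ =>
    Finset.sum_congr rfl fun _ _ => Finset.sum_congr rfl fun _ _ => by ring

/-- The Laplace-Beltrami operator can be computed in any chart. -/
theorem laplacian_eq_lapLoc (he : e ∈ IsManifold.maximalAtlas (𝓡 m) ∞ M) (hx : x ∈ e.source)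
    (hf : ContMDiffAt (𝓡 m) 𝓘(ℝ, ℝ) 2 f x) :
    laplacian g f x = lapLoc g e (f ∘ e.symm) (e x) := by
  rw [lapLoc_eq_sum_gradDot he he hx hx hf]
  exact lapLoc_eq_sum_gradDot (IsManifold.chart_mem_maximalAtlas (I := 𝓡 m) (n := ∞) x) he
    (mem_chart_source _ x) hx hf

theorem laplacian_comp_symm (he : e ∈ IsManifold.maximalAtlas (𝓡 m) ∞ M) (hx : x ∈ e.source)
    (hf : ContMDiffAt (𝓡 m) 𝓘(ℝ, ℝ) 2 f x) :
    laplacian g f ∘ e.symm =ᶠ[nhds (e x)] lapLoc g e (f ∘ e.symm) := by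
  filter_upwards [eventually_comp_symm hx (eventually_contMDiffAt hf two_le_infty two_ne_infty),
    e.open_target.mem_nhds (e.map_source hx)] with z h1 h3
  rw [Function.comp_apply, laplacian_eq_lapLoc he (e.map_target h3) h1, e.right_inv h3]

theorem laplacian_contMDiffAt {k l : ℕ∞} (hkl : k + 2 ≤ l)
    (hf : ContMDiffAt (𝓡 m) 𝓘(ℝ, ℝ) l f x) :
    ContMDiffAt (𝓡 m) 𝓘(ℝ, ℝ) k (laplacian g f) x := by
  have he := IsManifold.chart_mem_maximalAtlas (I := 𝓡 m) (n := ∞) x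
  have hx := mem_chart_source (EuclideanSpace ℝ (Fin m)) x
  have h1 : (2 : WithTop ℕ∞) ≤ l :=
    WithTop.coe_le_coe.2 (le_trans le_add_self hkl)
  have hl : (l : WithTop ℕ∞) ≤ ∞ := by exact_mod_cast le_top
  refine contMDiffAt_of_comp_symm (by exact_mod_cast le_top) he hx ?_
  refine ContDiffAt.congr_of_eventuallyEq ?_ (laplacian_comp_symm he hx (hf.of_le h1))
  have hy := OpenPartialHomeomorph.map_source _ hx
  refine lapLoc_contDiffAt he hy
    (contDiffAt_comp_symm hl he hy (by rwa [OpenPartialHomeomorph.left_inv _ hx])) ?_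
  rw [add_assoc, one_add_one_eq_two]
  exact WithTop.coe_le_coe.2 hkl

/-- The iterated carré du champ `½ Δ|∇f|² - ∇f · ∇Δf`. -/
def gammaTwo (g : RMetric m M) (f : M → ℝ) (x : M) : ℝ :=
  1 / 2 * laplacian g (gradSq g f) x - gradDot g f (laplacian g f) x

theorem gradSq_contMDiffAt {k l : ℕ∞} (hkl : k + 1 ≤ l)
    (hf : ContMDiffAt (𝓡 m) 𝓘(ℝ, ℝ) l f x) :
    ContMDiffAt (𝓡 m) 𝓘(ℝ, ℝ) k (gradSq g f) x :=
  gradDot_contMDiffAt hkl hf hf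

/-- Bochner's formula. -/
theorem gammaTwo_eq (he : e ∈ IsManifold.maximalAtlas (𝓡 m) ∞ M) (hx : x ∈ e.source)
    (hf : ContMDiffAt (𝓡 m) 𝓘(ℝ, ℝ) 3 f x) :
    gammaTwo g f x =
      ∑ i, ∑ l, covGrad g e (f ∘ e.symm) l i (e x) * covGrad g e (f ∘ e.symm) i l (e x) +
        ∑ i, ∑ j, ricciCoord g e i j (e x) * gradComp g e (f ∘ e.symm) i (e x) *
          gradComp g e (f ∘ e.symm) j (e x) := by
  have hy := e.map_source hx
  have h1 : (1 : WithTop ℕ∞) ≤ 3 := by norm_num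
  have h2 : (2 : WithTop ℕ∞) ≤ 3 := by norm_num
  have hF : ContDiffAt ℝ 3 (f ∘ e.symm) (e x) :=
    contDiffAt_comp_symm three_le_infty he hy (by rwa [e.left_inv hx])
  rw [← bochner_loc he hy hF, gammaTwo,
    laplacian_eq_lapLoc he hx (gradSq_contMDiffAt (k := 2) (l := 3) (by norm_num) hf),
    gradDot_eq_gradDotLoc he hx (hf.of_le h1)
      (laplacian_contMDiffAt (k := 1) (l := 3) (by norm_num) hf),
    lapLoc_congr (F := gradSq g f ∘ e.symm) (gradDot_comp_symm he hx (hf.of_le h1) (hf.of_le h1)),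
    gradDotLoc_congr Filter.EventuallyEq.rfl (laplacian_comp_symm he hx (hf.of_le h2))]

end Invariance

/-! ### The trace inequality for shifted Hessians -/

section PositiveMatrices

variable {m : ℕ}

/-- With `P = Bᵀ B`, the trace of `(S P)²` is the squared Frobenius norm of the symmetric matrix
`B S Bᵀ`. -/
theorem trace_sq_nonneg {S P : Matrix (Fin m) (Fin m) ℝ} (hS : S.transpose = S)
    (hP : P.PosDef) : 0 ≤ ∑ i, ∑ l, (S * P) l i * (S * P) i l := by
  obtain ⟨B, hB⟩ : ∃ B : Matrix (Fin m) (Fin m) ℝ, P = B.transpose * B := by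
    open scoped MatrixOrder in
    obtain ⟨B, hB⟩ := CStarAlgebra.nonneg_iff_eq_star_mul_self.1
      (Matrix.nonneg_iff_posSemidef.2 hP.posSemidef)
    exact ⟨B, hB⟩
  have h1 : ∑ i, ∑ l, (S * P) l i * (S * P) i l = (S * P * (S * P)).trace := by
    simp only [Matrix.trace, Matrix.diag, Matrix.mul_apply (M := S * P)]
    exact Finset.sum_congr rfl fun _ _ => Finset.sum_congr rfl fun _ _ => mul_comm _ _
  have h2 : (S * P * (S * P)).trace =
      ((B * S * B.transpose) * (B * S * B.transpose)).trace := by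
    rw [hB]
    calc _ = ((S * B.transpose * B * S * B.transpose) * B).trace := by
          simp only [Matrix.mul_assoc]
      _ = (B * (S * B.transpose * B * S * B.transpose)).trace := Matrix.trace_mul_comm _ _
      _ = _ := by simp only [Matrix.mul_assoc]
  have h3 : (B * S * B.transpose).transpose = B * S * B.transpose := by
    simp only [Matrix.transpose_mul, Matrix.transpose_transpose, hS, Matrix.mul_assoc]
  rw [h1, h2]
  simp only [Matrix.trace, Matrix.diag, Matrix.mul_apply (M := B * S * B.transpose)]
  refine Finset.sum_nonneg fun i _ => Finset.sum_nonneg fun j _ => ?_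
  have h4 : (B * S * B.transpose) j i = (B * S * B.transpose) i j :=
    congrFun (congrFun h3 i) j
  rw [h4]
  exact mul_self_nonneg _

/-- The Cauchy-Schwarz inequality for the scalar product defined by `A`, which compares it with
the coordinates. -/
theorem sq_le_inv_diag_mul {A : Matrix (Fin m) (Fin m) ℝ} (hA : A.PosDef) (w : Fin m → ℝ)
    (i : Fin m) : w i ^ 2 ≤ A⁻¹ i i * ∑ j, ∑ k, A j k * w j * w k := by
  have hpos : 0 < A⁻¹ i i := hA.inv.diag_pos
  set b := A⁻¹ i i with hb
  have hsymm (j k : Fin m) : A j k = A k j := by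
    have := hA.isHermitian.apply k j
    simpa using this
  have hAinv (j k : Fin m) : ∑ l, A j l * A⁻¹ l k = if j = k then 1 else 0 := by
    have := Matrix.mul_nonsing_inv A hA.det_pos.ne'.isUnit
    rw [← Matrix.mul_apply, this, Matrix.one_apply]
  set s := w i / b with hs
  -- positivity at `w - s A⁻¹ e_i`, where this choice of `s` minimises the quadratic form
  have h0 : 0 ≤ ∑ j, ∑ k, A j k * (w j - s * A⁻¹ j i) * (w k - s * A⁻¹ k i) := by
    have := hA.posSemidef.dotProduct_mulVec_nonneg (fun j => w j - s * A⁻¹ j i)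
    refine this.trans_eq ?_
    simp only [dotProduct, Matrix.mulVec, star_trivial, Finset.mul_sum, Pi.star_apply]
    exact Finset.sum_congr rfl fun j _ => Finset.sum_congr rfl fun k _ => by ring
  have e1 : ∑ j, ∑ k, A j k * w j * (s * A⁻¹ k i) = s * w i := by
    have : ∀ j, ∑ k, A j k * w j * (s * A⁻¹ k i) = s * w j * ∑ k, A j k * A⁻¹ k i := fun j => by
      rw [Finset.mul_sum]; exact Finset.sum_congr rfl fun k _ => by ring
    simp [this, hAinv]
  have e2 : ∑ j, ∑ k, A j k * (s * A⁻¹ j i) * w k = s * w i := by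
    rw [Finset.sum_comm, ← e1]
    exact Finset.sum_congr rfl fun j _ => Finset.sum_congr rfl fun k _ => by
      rw [hsymm k j]; ring
  have e3 : ∑ j, ∑ k, A j k * (s * A⁻¹ j i) * (s * A⁻¹ k i) = s ^ 2 * b := by
    have : ∀ j, ∑ k, A j k * (s * A⁻¹ j i) * (s * A⁻¹ k i) =
        s ^ 2 * A⁻¹ j i * ∑ k, A j k * A⁻¹ k i := fun j => by
      rw [Finset.mul_sum]; exact Finset.sum_congr rfl fun k _ => by ring
    simp [this, hAinv, hb]
  have h1 : ∑ j, ∑ k, A j k * (w j - s * A⁻¹ j i) * (w k - s * A⁻¹ k i) =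
      (∑ j, ∑ k, A j k * w j * w k) - s * w i - s * w i + s ^ 2 * b := by
    rw [← e3]
    nth_rewrite 1 [← e1]
    rw [← e2]
    simp only [← Finset.sum_sub_distrib, ← Finset.sum_add_distrib]
    exact Finset.sum_congr rfl fun j _ => Finset.sum_congr rfl fun k _ => by ring
  rw [h1] at h0
  have h2 : s * b = w i := by rw [hs]; field_simp
  have h3 : s * w i * b = w i ^ 2 := by rw [mul_right_comm, h2]; ring
  have h4 : s ^ 2 * b * b = w i ^ 2 := by
    rw [← h2]; ring
  have := mul_nonneg h0 hpos.le
  nlinarith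

end PositiveMatrices

section CurvatureDimension

variable {m : ℕ} {M : Type*} [TopologicalSpace M] [ChartedSpace (EuclideanSpace ℝ (Fin m)) M]
  [IsManifold (𝓡 m) ∞ M] {g : RMetric m M}
  {e e' : OpenPartialHomeomorph M (EuclideanSpace ℝ (Fin m))} {y : EuclideanSpace ℝ (Fin m)}
  {F : EuclideanSpace ℝ (Fin m) → ℝ} {x : M} {f : M → ℝ}

theorem covGrad_eq (he : e ∈ IsManifold.maximalAtlas (𝓡 m) ∞ M) (hy : y ∈ e.target)
    (hF : ContDiffAt ℝ 2 F y) (l i : Fin m) : covGrad g e F l i y =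
      (Matrix.of (fun a b => hessLoc g e F a b y) * gramInv g e y) l i := by
  rw [covGrad, pd_gradComp he hy hF, Matrix.mul_apply]
  exact Finset.sum_congr rfl fun j _ => by rw [gramInv_symm i j, Matrix.of_apply]; ring

theorem sum_gram_gradComp (he : e ∈ IsManifold.maximalAtlas (𝓡 m) ∞ M) (hy : y ∈ e.target) :
    ∑ i, ∑ j, gram g e y i j * gradComp g e F i y * gradComp g e F j y =
      gradDotLoc g e F F y := by
  have h (i : Fin m) : ∑ j, gram g e y i j * gradComp g e F j y = pd i F y := by
    have h1 : (gram g e y).mulVec ((gramInv g e y).mulVec fun j => pd j F y) i = pd i F y := by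
      rw [Matrix.mulVec_mulVec, gram_mul_gramInv he hy, Matrix.one_mulVec]
    exact h1
  rw [gradDotLoc_eq_left]
  refine Finset.sum_congr rfl fun i _ => ?_
  rw [← h i, Finset.mul_sum]
  exact Finset.sum_congr rfl fun j _ => by ring

/-- The trace of the square of `Hess F + s g + t dF ⊗ dF` is nonnegative. -/
theorem trace_shifted_hessian_nonneg (he : e ∈ IsManifold.maximalAtlas (𝓡 m) ∞ M)
    (hy : y ∈ e.target) (hF : ContDiffAt ℝ 2 F y) (s t : ℝ) :
    0 ≤ ∑ i, ∑ l, covGrad g e F l i y * covGrad g e F i l y + s ^ 2 * m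
      + t ^ 2 * gradDotLoc g e F F y ^ 2 + 2 * s * lapLoc g e F y
      + t * gradDotLoc g e F (gradDotLoc g e F F) y + 2 * s * t * gradDotLoc g e F F y := by
  set Hs : Matrix (Fin m) (Fin m) ℝ := Matrix.of (fun a b => hessLoc g e F a b y) with hHs
  set G := gram g e y
  set P := gramInv g e y with hP
  set dF : Fin m → ℝ := fun i => pd i F y with hdF
  set X : Fin m → ℝ := fun i => gradComp g e F i y with hX
  set T : Matrix (Fin m) (Fin m) ℝ := Matrix.of fun i j => dF i * dF j with hT
  have hsymm : (Hs + s • G + t • T).transpose = Hs + s • G + t • T := by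
    ext i j
    simp only [Matrix.transpose_apply, Matrix.add_apply, Matrix.smul_apply, smul_eq_mul]
    rw [show Hs j i = Hs i j from hessLoc_symm hF j i, show G j i = G i j from gram_symm j i,
      show T j i = T i j from mul_comm _ _]
  have hentry (l i : Fin m) : ((Hs + s • G + t • T) * P) l i =
      covGrad g e F l i y + s * (1 : Matrix (Fin m) (Fin m) ℝ) l i + t * (dF l * X i) := by
    rw [Matrix.add_mul, Matrix.add_mul, Matrix.smul_mul, Matrix.smul_mul,
      gram_mul_gramInv he hy, covGrad_eq he hy hF]
    simp only [Matrix.add_apply, Matrix.smul_apply, smul_eq_mul]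
    congr 2
    simp only [Matrix.mul_apply, hT, Matrix.of_apply, hX, gradComp, Finset.mul_sum]
    exact Finset.sum_congr rfl fun j _ => by rw [hP, gramInv_symm j i]; ring
  have h0 := trace_sq_nonneg (P := P) hsymm (gramInv_posDef (g := g) he hy)
  simp only [hentry] at h0
  have ha : gradDotLoc g e F F y = ∑ i, X i * dF i := gradDotLoc_eq_left
  have hD : lapLoc g e F y = ∑ i, covGrad g e F i i y := lapLoc_eq_div he hy hF
  have hh : gradDotLoc g e F (gradDotLoc g e F F) y =
      2 * ∑ i, (∑ l, covGrad g e F i l y * dF l) * X i := by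
    have h1 (l : Fin m) : ∑ j, hessLoc g e F l j y * gradComp g e F j y =
        ∑ i, covGrad g e F l i y * dF i := by
      have hc (i : Fin m) : covGrad g e F l i y = ∑ j, gramInv g e y i j * hessLoc g e F l j y :=
        pd_gradComp he hy hF l i
      simp only [hc, gradComp, Finset.mul_sum, Finset.sum_mul]
      rw [Finset.sum_comm]
      exact Finset.sum_congr rfl fun i _ => Finset.sum_congr rfl fun j _ => by
        rw [gramInv_symm i j]; ring
    rw [gradDotLoc_eq_left]
    simp only [pd_gradDotLoc he hy hF hF, h1]
    rw [Finset.mul_sum]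
    exact Finset.sum_congr rfl fun l _ => by ring
  refine h0.trans_eq ?_
  have e1 (i l : Fin m) : (covGrad g e F l i y + s * (1 : Matrix (Fin m) (Fin m) ℝ) l i
      + t * (dF l * X i)) * (covGrad g e F i l y + s * (1 : Matrix (Fin m) (Fin m) ℝ) i l
      + t * (dF i * X l)) = covGrad g e F l i y * covGrad g e F i l y
      + s ^ 2 * (if i = l then 1 else 0) + t ^ 2 * ((X i * dF i) * (X l * dF l))
      + 2 * s * (if i = l then covGrad g e F i i y else 0)
      + t * (covGrad g e F l i y * dF i * X l) + t * (covGrad g e F i l y * dF l * X i)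
      + 2 * s * t * (if i = l then X i * dF i else 0) := by
    by_cases h : i = l
    · subst h; simp only [Matrix.one_apply_eq, if_true]; ring
    · simp only [Matrix.one_apply_ne h, Matrix.one_apply_ne (Ne.symm h), if_neg h]; ring
  simp only [e1, Finset.sum_add_distrib, ← Finset.mul_sum, ← Finset.sum_mul,
    Finset.sum_ite_eq, Finset.mem_univ, if_true]
  rw [Finset.sum_comm (f := fun i l => covGrad g e F l i y * dF i * X l), hh, hD, ha]
  simp only [Finset.sum_const, Finset.card_univ, Fintype.card_fin, nsmul_eq_mul, mul_one,
    ← Finset.sum_mul]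
  ring

end CurvatureDimension

/-! ### Lower bounds for the Ricci curvature -/

section Ricci

variable {m : ℕ} {M : Type*} [TopologicalSpace M] [ChartedSpace (EuclideanSpace ℝ (Fin m)) M]
  [IsManifold (𝓡 m) ∞ M] {g : RMetric m M}
  {e e' : OpenPartialHomeomorph M (EuclideanSpace ℝ (Fin m))} {y : EuclideanSpace ℝ (Fin m)}
  {F : EuclideanSpace ℝ (Fin m) → ℝ} {x : M} {f : M → ℝ}

theorem inner_eq_sum_gram (x : M) (v : TangentSpace (𝓡 m) x) :
    g.inner x v v = ∑ i, ∑ j, gram g (chartAt _ x) (chartAt _ x x) i j *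
      vecCoord x v i * vecCoord x v j := by
  set e := chartAt (EuclideanSpace ℝ (Fin m)) x with hedef
  have hx : x ∈ e.source := mem_chart_source _ x
  have he : e ∈ IsManifold.maximalAtlas (𝓡 m) ∞ M := IsManifold.chart_mem_maximalAtlas x
  let B : M → EuclideanSpace ℝ (Fin m) →L[ℝ] EuclideanSpace ℝ (Fin m) →L[ℝ] ℝ := g.inner
  let D : EuclideanSpace ℝ (Fin m) →L[ℝ] EuclideanSpace ℝ (Fin m) :=
    mfderiv (𝓡 m) (𝓡 m) e.symm (e x)
  let w : EuclideanSpace ℝ (Fin m) := vecCoord x v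
  let V : Fin m → EuclideanSpace ℝ (Fin m) := fun i => coordVec e (e x) i
  have hw : w = ∑ i, w i • EuclideanSpace.single i (1 : ℝ) := by
    ext j; simp [Finset.sum_apply, Pi.single_apply]
  have h1 : (v : EuclideanSpace ℝ (Fin m)) = D w := by
    have := (mdifferentiable_of_mem_maximalAtlas he).symm_comp_deriv hx
    exact (DFunLike.congr_fun this v).symm
  have h2 : D w = ∑ i, w i • V i := by
    conv_lhs => rw [hw]
    rw [map_sum]
    simp only [map_smul]
    rfl
  have hB : B x = B (e.symm (e x)) := by rw [e.left_inv hx]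
  have h3 : B x v v = B (e.symm (e x)) (∑ i, w i • V i) (∑ i, w i • V i) := by
    rw [hB]
    exact congrArg (fun u => B (e.symm (e x)) u u) (h1.trans h2)
  refine h3.trans ?_
  simp only [map_sum, map_smul, sum_apply, smul_apply, smul_eq_mul, Finset.mul_sum]
  rw [Finset.sum_comm]
  refine Finset.sum_congr rfl fun a _ => Finset.sum_congr rfl fun b _ => ?_
  change _ = B _ (V _) (V _) * w _ * w _
  ring

theorem vecCoord_surjective (x : M) (w : Fin m → ℝ) :
    ∃ v : TangentSpace (𝓡 m) x, ∀ i, vecCoord x v i = w i := by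
  have he : chartAt (EuclideanSpace ℝ (Fin m)) x ∈ IsManifold.maximalAtlas (𝓡 m) ∞ M :=
    IsManifold.chart_mem_maximalAtlas x
  obtain ⟨v, hv⟩ := (mdifferentiable_of_mem_maximalAtlas he).mfderiv_surjective
    (mem_chart_source (EuclideanSpace ℝ (Fin m)) x) (WithLp.toLp 2 w)
  refine ⟨v, fun i => ?_⟩
  rw [vecCoord, hv]

theorem differentiableAt_coord (j : Fin m) :
    DifferentiableAt ℝ (fun z : EuclideanSpace ℝ (Fin m) => z j) y :=
  (EuclideanSpace.proj j : EuclideanSpace ℝ (Fin m) →L[ℝ] ℝ).differentiableAt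

theorem pd_coord (i j : Fin m) : pd i (fun z => z j) y = if i = j then 1 else 0 := by
  have h : fderiv ℝ (fun z : EuclideanSpace ℝ (Fin m) => z j) y =
      (EuclideanSpace.proj j : EuclideanSpace ℝ (Fin m) →L[ℝ] ℝ) :=
    (EuclideanSpace.proj j : EuclideanSpace ℝ (Fin m) →L[ℝ] ℝ).hasFDerivAt.fderiv
  rw [pd, h]
  simp [eq_comm]

theorem differentiableAt_affine (b : Fin m → ℝ) (y z : EuclideanSpace ℝ (Fin m)) :
    DifferentiableAt ℝ (fun z : EuclideanSpace ℝ (Fin m) => ∑ j, b j * (z j - y j)) z :=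
  DifferentiableAt.fun_sum fun j _ => (differentiableAt_const _).mul
    ((differentiableAt_coord j).sub (differentiableAt_const _))

theorem pd_coord_sub (k j : Fin m) (y z : EuclideanSpace ℝ (Fin m)) :
    pd k (fun z => z j - y j) z = if k = j then 1 else 0 := by
  rw [pd_sub k (differentiableAt_coord j) (differentiableAt_const _), pd_coord, pd_const, sub_zero]

theorem pd_affine (b : Fin m → ℝ) (y z : EuclideanSpace ℝ (Fin m)) (k : Fin m) :
    pd k (fun z => ∑ j, b j * (z j - y j)) z = b k := by
  have hd (j : Fin m) : DifferentiableAt ℝ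
      (fun z : EuclideanSpace ℝ (Fin m) => z j - y j) z :=
    (differentiableAt_coord j).sub (differentiableAt_const _)
  rw [pd_sum (Φ := fun j z => b j * (z j - y j)) _ _
    fun j _ => (differentiableAt_const _).mul (hd j)]
  simp [pd_const_mul k _ (hd _), pd_coord_sub]

/-- The partial derivatives of a polynomial of degree two. -/
theorem pd_quadratic (c : Fin m → ℝ) {b : Fin m → Fin m → ℝ} (hb : ∀ i j, b i j = b j i)
    (y z : EuclideanSpace ℝ (Fin m)) (k : Fin m) :
    pd k (fun z => ∑ i, (c i + 1 / 2 * ∑ j, b i j * (z j - y j)) * (z i - y i)) z =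
      c k + ∑ j, b k j * (z j - y j) := by
  have hc (j : Fin m) : DifferentiableAt ℝ
      (fun z : EuclideanSpace ℝ (Fin m) => z j - y j) z :=
    (differentiableAt_coord j).sub (differentiableAt_const _)
  have hl (i : Fin m) : DifferentiableAt ℝ
      (fun z : EuclideanSpace ℝ (Fin m) => c i + 1 / 2 * ∑ j, b i j * (z j - y j)) z :=
    (differentiableAt_const _).add
      ((differentiableAt_const _).mul (differentiableAt_affine _ _ _))
  rw [pd_sum_mul _ _ (fun i _ => hl i) (fun i _ => hc i)]
  have hpl (i : Fin m) : pd k (fun z => c i + 1 / 2 * ∑ j, b i j * (z j - y j)) z =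
      1 / 2 * b i k := by
    rw [pd_add (H := fun z => 1 / 2 * ∑ j, b i j * (z j - y j)) k (differentiableAt_const _)
      ((differentiableAt_const _).mul (differentiableAt_affine _ _ _)), pd_const,
      pd_const_mul k _ (differentiableAt_affine _ _ _), pd_affine, zero_add]
  simp only [hpl, pd_coord_sub]
  simp only [Finset.sum_add_distrib, mul_ite, mul_one, mul_zero, Finset.sum_ite_eq,
    Finset.mem_univ, if_true, Finset.mul_sum]
  rw [add_comm, add_assoc, ← Finset.sum_add_distrib]
  congr 1
  exact Finset.sum_congr rfl fun j _ => by rw [hb j k]; ring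

/-- Every tangent vector is the gradient at `x` of a smooth function whose Hessian vanishes
at `x`. -/
theorem exists_gradComp_eq_covGrad_eq_zero (he : e ∈ IsManifold.maximalAtlas (𝓡 m) ∞ M)
    (hx : x ∈ e.source) (w : Fin m → ℝ) : ∃ f : M → ℝ, ContMDiffAt (𝓡 m) 𝓘(ℝ, ℝ) 3 f x ∧
      (∀ i, gradComp g e (f ∘ e.symm) i (e x) = w i) ∧
      ∀ i j, covGrad g e (f ∘ e.symm) i j (e x) = 0 := by
  have hy := e.map_source hx
  set y := e x with hydef
  -- in the chart, the function is `c · (z - y) + ½ b (z - y, z - y)` where `c` is the covector dual to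
  -- `w` and `b_{ij} = Γ^k_{ij} c_k` compensates the Christoffel term of the Hessian
  set c : Fin m → ℝ := (gram g e y).mulVec w with hc
  set b : Fin m → Fin m → ℝ := fun i j => ∑ k, christoffel g e k i j y * c k with hb
  have hbs (i j : Fin m) : b i j = b j i := by
    simp only [hb, christoffel_symm (y := y) _ i j]
  set F : EuclideanSpace ℝ (Fin m) → ℝ :=
    fun z => ∑ i, (c i + 1 / 2 * ∑ j, b i j * (z j - y j)) * (z i - y i) with hF
  have hcoord (i : Fin m) : ContDiff ℝ ∞ (fun z : EuclideanSpace ℝ (Fin m) => z i - y i) :=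
    (EuclideanSpace.proj i : EuclideanSpace ℝ (Fin m) →L[ℝ] ℝ).contDiff.sub contDiff_const
  have hFs : ContDiff ℝ ∞ F := ContDiff.sum fun i _ => (contDiff_const.add
    (contDiff_const.mul (ContDiff.sum fun j _ => contDiff_const.mul (hcoord j)))).mul (hcoord i)
  have hpF (z : EuclideanSpace ℝ (Fin m)) (k : Fin m) :
      pd k F z = c k + ∑ j, b k j * (z j - y j) := pd_quadratic c hbs y z k
  have hpF0 (k : Fin m) : pd k F y = c k := by rw [hpF]; simp
  have hppF (i k : Fin m) : pd i (pd k F) y = b k i := by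
    rw [show pd k F = fun z => c k + ∑ j, b k j * (z j - y j) from funext fun z => hpF z k]
    rw [pd_add i (differentiableAt_const _) (differentiableAt_affine _ _ _), pd_const, zero_add,
      pd_affine]
  have hev : (F ∘ e) ∘ e.symm =ᶠ[nhds y] F := by
    filter_upwards [e.open_target.mem_nhds hy] with z hz
    simp [e.right_inv hz]
  have hgc (i : Fin m) : gradComp g e ((F ∘ e) ∘ e.symm) i y = w i := by
    have h1 : gradComp g e ((F ∘ e) ∘ e.symm) i y = (gramInv g e y).mulVec c i := by
      simp only [gradComp, pd_congr _ hev, hpF0]; rfl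
    rw [h1, hc, Matrix.mulVec_mulVec, gramInv_mul_gram he hy, Matrix.one_mulVec]
  have hsm : ContMDiffAt (𝓡 m) 𝓘(ℝ, ℝ) ∞ (F ∘ e) x :=
    contMDiffAt_of_comp_symm le_rfl he hx (hFs.contDiffAt.congr_of_eventuallyEq hev)
  refine ⟨F ∘ e, hsm.of_le three_le_infty, hgc, fun i j => ?_⟩
  have h2 : ContDiffAt ℝ 2 ((F ∘ e) ∘ e.symm) y :=
    contDiffAt_comp_symm two_le_infty he hy (by
      rw [hydef, e.left_inv hx]; exact hsm.of_le two_le_infty)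
  rw [covGrad, pd_gradComp he hy h2]
  refine Finset.sum_eq_zero fun a _ => ?_
  rw [hessLoc, pd_congr _ (pd_eventuallyEq _ hev), hppF]
  simp only [pd_congr _ hev, hpF0]
  rw [hbs a i, sub_self, mul_zero]

theorem ricciCoord_contDiffAt (he : e ∈ IsManifold.maximalAtlas (𝓡 m) ∞ M) (hy : y ∈ e.target)
    (i j : Fin m) : ContDiffAt ℝ ∞ (ricciCoord g e i j) y := by
  have h := fun a b c => christoffel_contDiffAt (g := g) he hy a b c
  unfold ricciCoord
  exact (((ContDiffAt.sum fun k _ => contDiffAt_pd_top _ (h k i j)).sub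
    (ContDiffAt.sum fun k _ => contDiffAt_pd_top _ (h k i k))).add
    (ContDiffAt.sum fun k _ => ContDiffAt.sum fun l _ => (h _ _ _).mul (h _ _ _))).sub
    (ContDiffAt.sum fun k _ => ContDiffAt.sum fun l _ => (h _ _ _).mul (h _ _ _))

/-- The Ricci curvatures of unit vectors are locally bounded from below. The Ricci tensor is
compared in two charts by means of Bochner's formula, applied to functions with vanishing
Hessian. -/
theorem exists_eventually_le_ricci (x₀ : M) : ∃ C : ℝ, ∀ᶠ x in nhds x₀,
    ∀ v : TangentSpace (𝓡 m) x, g.inner x v v = 1 → C ≤ ricci g x v v := by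
  set e := chartAt (EuclideanSpace ℝ (Fin m)) x₀ with hedef
  have hx₀ : x₀ ∈ e.source := mem_chart_source _ x₀
  have he : e ∈ IsManifold.maximalAtlas (𝓡 m) ∞ M := IsManifold.chart_mem_maximalAtlas x₀
  have hy₀ := e.map_source hx₀
  set φ : EuclideanSpace ℝ (Fin m) → ℝ := fun z =>
    ∑ i, ∑ j, |ricciCoord g e i j z| * (gramInv g e z i i + gramInv g e z j j) with hφ
  have hcont : ContinuousAt φ (e x₀) :=
    tendsto_finsetSum _ fun i _ => tendsto_finsetSum _ fun j _ =>
      ((ricciCoord_contDiffAt he hy₀ i j).continuousAt.abs).mul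
        ((gramInv_contDiffAt he hy₀ i i).continuousAt.add
          (gramInv_contDiffAt he hy₀ j j).continuousAt)
  have hev : ∀ᶠ x in nhds x₀, φ (e x) < φ (e x₀) + 1 :=
    (hcont.comp (e.continuousAt hx₀)).eventually (gt_mem_nhds (lt_add_one _))
  refine ⟨-(φ (e x₀) + 1), ?_⟩
  filter_upwards [hev, e.open_source.mem_nhds hx₀] with x hlt hx v hv
  set e' := chartAt (EuclideanSpace ℝ (Fin m)) x with he'def
  have hx' : x ∈ e'.source := mem_chart_source _ x
  have he' : e' ∈ IsManifold.maximalAtlas (𝓡 m) ∞ M := IsManifold.chart_mem_maximalAtlas x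
  obtain ⟨f, hf, hfw, hfA⟩ := exists_gradComp_eq_covGrad_eq_zero (g := g) he' hx'
    (fun i => vecCoord x v i)
  have hy := e.map_source hx
  have hy' := e'.map_source hx'
  -- the Hessian of `f` vanishes in the chart at `x`, so that Bochner's formula reads off the Ricci
  -- curvature there; in the fixed chart `e` the Hessian term is only known to be nonnegative
  have h1 : gammaTwo g f x = ricci g x v v := by
    rw [gammaTwo_eq he' hx' hf]
    simp only [hfA, hfw, mul_zero, Finset.sum_const_zero, zero_add]
    rfl
  have h2 := gammaTwo_eq (g := g) he hx hf
  have hF2 : ContDiffAt ℝ 2 (f ∘ e.symm) (e x) :=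
    contDiffAt_comp_symm two_le_infty he hy (by
      rw [e.left_inv hx]; exact hf.of_le (by norm_num))
  set X : Fin m → ℝ := fun i => gradComp g e (f ∘ e.symm) i (e x) with hX
  have hX1 : ∑ i, ∑ j, gram g e (e x) i j * X i * X j = 1 := by
    rw [sum_gram_gradComp he hy, ← gradDot_eq_gradDotLoc he hx (hf.of_le (by norm_num))
      (hf.of_le (by norm_num)), gradDot_eq_gradDotLoc he' hx' (hf.of_le (by norm_num))
      (hf.of_le (by norm_num)), ← sum_gram_gradComp he' hy']
    simp only [hfw]
    rw [← inner_eq_sum_gram, hv]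
  have hXi (i : Fin m) : X i ^ 2 ≤ gramInv g e (e x) i i := by
    have := sq_le_inv_diag_mul (gram_posDef (g := g) he hy) X i
    rwa [hX1, mul_one] at this
  have htr : 0 ≤ ∑ i, ∑ l, covGrad g e (f ∘ e.symm) l i (e x) *
      covGrad g e (f ∘ e.symm) i l (e x) := by
    have := trace_shifted_hessian_nonneg (g := g) he hy hF2 0 0
    simpa using this
  have hric : -φ (e x) ≤ ∑ i, ∑ j, ricciCoord g e i j (e x) * X i * X j := by
    simp only [hφ, ← Finset.sum_neg_distrib]
    refine Finset.sum_le_sum fun i _ => Finset.sum_le_sum fun j _ => ?_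
    have hXX : |X i * X j| ≤ gramInv g e (e x) i i + gramInv g e (e x) j j := by
      rw [abs_le]
      constructor <;> nlinarith [hXi i, hXi j, sq_nonneg (X i + X j), sq_nonneg (X i - X j),
        sq_nonneg (X i), sq_nonneg (X j)]
    have := mul_le_mul_of_nonneg_left hXX (abs_nonneg (ricciCoord g e i j (e x)))
    rw [← abs_mul, ← mul_assoc] at this
    linarith [neg_abs_le (ricciCoord g e i j (e x) * X i * X j)]
  rw [← h1, h2]
  linarith

/-- The infimum which defines `κ` is not the junk value of an unbounded set. -/
theorem bddBelow_ricci [CompactSpace M] (g : RMetric m M) :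
    BddBelow {r : ℝ | ∃ (x : M) (v : TangentSpace (𝓡 m) x),
      g.inner x v v = 1 ∧ r = ricci g x v v} := by
  choose C hC using exists_eventually_le_ricci (g := g)
  obtain ⟨t, -, ht⟩ := isCompact_univ.elim_nhds_subcover
    (fun x₀ => {x | ∀ v : TangentSpace (𝓡 m) x, g.inner x v v = 1 → C x₀ ≤ ricci g x v v})
    (fun x₀ _ => hC x₀)
  obtain ⟨K, hK⟩ := (t.image C).bddBelow
  refine ⟨K, ?_⟩
  rintro r ⟨x, v, hv, rfl⟩
  obtain ⟨x₀, hx₀, hx⟩ := Set.mem_iUnion₂.1 (ht (Set.mem_univ x))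
  exact (hK (Finset.mem_coe.2 (Finset.mem_image_of_mem C hx₀))).trans (hx v hv)

theorem kappa_mul_le [CompactSpace M] (x : M) (w : Fin m → ℝ) :
    kappa g * ∑ i, ∑ j, gram g (chartAt _ x) (chartAt _ x x) i j * w i * w j ≤
      ∑ i, ∑ j, ricciCoord g (chartAt _ x) i j (chartAt _ x x) * w i * w j := by
  have hpd : (gram g (chartAt (EuclideanSpace ℝ (Fin m)) x) (chartAt _ x x)).PosDef :=
    gram_posDef (IsManifold.chart_mem_maximalAtlas x)
      (OpenPartialHomeomorph.map_source _ (mem_chart_source _ x))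
  set q := ∑ i, ∑ j, gram g (chartAt (EuclideanSpace ℝ (Fin m)) x) (chartAt _ x x) i j * w i * w j
    with hq
  by_cases hw : w = 0
  · simp [hq, hw]
  have hqpos : 0 < q := by
    have := hpd.dotProduct_mulVec_pos hw
    refine this.trans_eq ?_
    simp only [dotProduct, Matrix.mulVec, star_trivial, Finset.mul_sum, Pi.star_apply, hq]
    exact Finset.sum_congr rfl fun j _ => Finset.sum_congr rfl fun k _ => by ring
  obtain ⟨v, hv⟩ := vecCoord_surjective x (fun i => w i / Real.sqrt q)
  have hsq : Real.sqrt q * Real.sqrt q = q := Real.mul_self_sqrt hqpos.le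
  have hs0 : Real.sqrt q ≠ 0 := (Real.sqrt_pos.2 hqpos).ne'
  have hdiv (A : Matrix (Fin m) (Fin m) ℝ) :
      ∑ i, ∑ j, A i j * (w i / Real.sqrt q) * (w j / Real.sqrt q) =
        (∑ i, ∑ j, A i j * w i * w j) / q := by
    simp only [Finset.sum_div]
    refine Finset.sum_congr rfl fun j _ => Finset.sum_congr rfl fun k _ => ?_
    calc _ = A j k * w j * w k / (Real.sqrt q * Real.sqrt q) := by field_simp
      _ = _ := by rw [hsq]
  have h1 : g.inner x v v = 1 := by
    rw [inner_eq_sum_gram]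
    simp only [hv]
    rw [hdiv, ← hq, div_self hqpos.ne']
  have h2 : kappa g ≤ ricci g x v v := csInf_le (bddBelow_ricci g) ⟨x, v, h1, rfl⟩
  simp only [ricci, hv] at h2
  have h3 := hdiv (Matrix.of fun i j => ricciCoord g (chartAt _ x) i j (chartAt _ x x))
  simp only [Matrix.of_apply] at h3
  rw [h3, le_div_iff₀ hqpos] at h2
  exact h2

/-- The curvature-dimension inequality reinforced by the direction of the gradient: the Hessian of
`f` is bounded from below by comparing it with all the tensors `-(s g + t df ⊗ df)`. -/
theorem kappa_mul_gradSq_le [CompactSpace M] (hf : ContMDiffAt (𝓡 m) 𝓘(ℝ, ℝ) 3 f x) (s t : ℝ) :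
    kappa g * gradSq g f x ≤ gammaTwo g f x + s ^ 2 * m + t ^ 2 * gradSq g f x ^ 2
      + 2 * s * laplacian g f x + t * gradDot g f (gradSq g f) x + 2 * s * t * gradSq g f x := by
  set e := chartAt (EuclideanSpace ℝ (Fin m)) x with hedef
  have hx : x ∈ e.source := mem_chart_source _ x
  have he : e ∈ IsManifold.maximalAtlas (𝓡 m) ∞ M := IsManifold.chart_mem_maximalAtlas x
  have hy := e.map_source hx
  have hf1 : ContMDiffAt (𝓡 m) 𝓘(ℝ, ℝ) 1 f x := hf.of_le (by norm_num)
  have hF2 : ContDiffAt ℝ 2 (f ∘ e.symm) (e x) :=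
    contDiffAt_comp_symm two_le_infty he hy (by
      rw [e.left_inv hx]; exact hf.of_le (by norm_num))
  have h1 := trace_shifted_hessian_nonneg (g := g) he hy hF2 s t
  have h2 := gammaTwo_eq (g := g) he hx hf
  have h3 := kappa_mul_le (g := g) x (fun i => gradComp g e (f ∘ e.symm) i (e x))
  rw [sum_gram_gradComp he hy] at h3
  have h4 : gradDotLoc g e (f ∘ e.symm) (gradDotLoc g e (f ∘ e.symm) (f ∘ e.symm)) (e x) =
      gradDot g f (gradSq g f) x :=
    (gradDotLoc_congr Filter.EventuallyEq.rfl (gradDot_comp_symm he hx hf1 hf1)).symm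
  have h5 : gradSq g f x = gradDotLoc g e (f ∘ e.symm) (f ∘ e.symm) (e x) := rfl
  have h6 : laplacian g f x = lapLoc g e (f ∘ e.symm) (e x) := rfl
  rw [h4, ← h5, ← h6] at h1
  rw [← h5] at h3
  linarith

end Ricci

/-! ### Product and chain rules -/

section Leibniz

variable {m : ℕ} {M : Type*} [TopologicalSpace M] [ChartedSpace (EuclideanSpace ℝ (Fin m)) M]
  [IsManifold (𝓡 m) ∞ M] {g : RMetric m M} {x : M} {u v w f : M → ℝ}

theorem contDiffAt_chart {k : WithTop ℕ∞} (hk : k ≤ ∞)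
    (hu : ContMDiffAt (𝓡 m) 𝓘(ℝ, ℝ) k u x) :
    ContDiffAt ℝ k (u ∘ (chartAt (EuclideanSpace ℝ (Fin m)) x).symm) (chartAt _ x x) := by
  have hx := mem_chart_source (EuclideanSpace ℝ (Fin m)) x
  exact contDiffAt_comp_symm hk (IsManifold.chart_mem_maximalAtlas x)
    (OpenPartialHomeomorph.map_source _ hx) (by rwa [OpenPartialHomeomorph.left_inv _ hx])

theorem differentiableAt_chart (hu : ContMDiffAt (𝓡 m) 𝓘(ℝ, ℝ) 1 u x) :
    DifferentiableAt ℝ (u ∘ (chartAt (EuclideanSpace ℝ (Fin m)) x).symm) (chartAt _ x x) :=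
  (contDiffAt_chart (by simp) hu).differentiableAt (by simp)

theorem chart_symm_apply (u : M → ℝ) (x : M) :
    (u ∘ (chartAt (EuclideanSpace ℝ (Fin m)) x).symm) (chartAt _ x x) = u x := by
  rw [Function.comp_apply,
    OpenPartialHomeomorph.left_inv _ (mem_chart_source (EuclideanSpace ℝ (Fin m)) x)]

theorem gradDot_mul_left (hu : ContMDiffAt (𝓡 m) 𝓘(ℝ, ℝ) 1 u x)
    (hv : ContMDiffAt (𝓡 m) 𝓘(ℝ, ℝ) 1 v x) :
    gradDot g (fun z => u z * v z) w x = u x * gradDot g v w x + v x * gradDot g u w x := by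
  unfold gradDot
  have h (i : Fin m) := pd_mul i (differentiableAt_chart hu) (differentiableAt_chart hv)
  simp only [chart_symm_apply] at h
  have h' (i : Fin m) : pd i ((fun z => u z * v z) ∘ (chartAt (EuclideanSpace ℝ (Fin m)) x).symm)
      (chartAt _ x x) = _ := h i
  simp only [h', Finset.mul_sum, ← Finset.sum_add_distrib]
  exact Finset.sum_congr rfl fun i _ => Finset.sum_congr rfl fun j _ => by ring

theorem gradDot_comp_left {φ : ℝ → ℝ} {φ' : ℝ} (hφ : HasDerivAt φ φ' (u x))
    (hu : ContMDiffAt (𝓡 m) 𝓘(ℝ, ℝ) 1 u x) :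
    gradDot g (fun z => φ (u z)) w x = φ' * gradDot g u w x := by
  unfold gradDot
  have h (i : Fin m) := pd_comp_real i (by rwa [chart_symm_apply]) (differentiableAt_chart hu)
  have h' (i : Fin m) : pd i ((fun z => φ (u z)) ∘ (chartAt (EuclideanSpace ℝ (Fin m)) x).symm)
      (chartAt _ x x) = _ := h i
  simp only [h', Finset.mul_sum]
  exact Finset.sum_congr rfl fun i _ => Finset.sum_congr rfl fun j _ => by ring

theorem laplacian_comp {φ φ' : ℝ → ℝ} {φ'' : ℝ} (hφ : ∀ᶠ t in nhds (f x), HasDerivAt φ (φ' t) t)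
    (hφ' : HasDerivAt φ' φ'' (f x)) (hf : ContMDiffAt (𝓡 m) 𝓘(ℝ, ℝ) 2 f x) :
    laplacian g (fun z => φ (f z)) x = φ' (f x) * laplacian g f x + φ'' * gradSq g f x := by
  set e := chartAt (EuclideanSpace ℝ (Fin m)) x
  have hF : ContDiffAt ℝ 2 (f ∘ e.symm) (e x) := contDiffAt_chart two_le_infty hf
  have hFx : (f ∘ e.symm) (e x) = f x := chart_symm_apply f x
  have hd : DifferentiableAt ℝ (f ∘ e.symm) (e x) := hF.differentiableAt (by simp)
  have h1 (j : Fin m) : pd j ((fun z => φ (f z)) ∘ e.symm) =ᶠ[nhds (e x)]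
      fun y => φ' ((f ∘ e.symm) y) * pd j (f ∘ e.symm) y := by
    have ha : ∀ᶠ y in nhds (e x), HasDerivAt φ (φ' ((f ∘ e.symm) y)) ((f ∘ e.symm) y) := by
      refine hF.continuousAt.eventually (p := fun t => HasDerivAt φ (φ' t) t) ?_
      rwa [hFx]
    filter_upwards [ha, hF.eventually (by simp)] with y hy hy2
    exact pd_comp_real j hy (hy2.differentiableAt (by simp))
  have h2 (i j : Fin m) : pd i (pd j ((fun z => φ (f z)) ∘ e.symm)) (e x) =
      φ'' * (pd i (f ∘ e.symm) (e x) * pd j (f ∘ e.symm) (e x)) +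
        φ' (f x) * pd i (pd j (f ∘ e.symm)) (e x) := by
    have hφ2 : HasDerivAt φ' φ'' ((f ∘ e.symm) (e x)) := by rwa [hFx]
    rw [pd_congr i (h1 j), pd_mul (F := fun y => φ' ((f ∘ e.symm) y)) i
      (hφ2.differentiableAt.comp _ hd) (differentiableAt_pd j hF), pd_comp_real i hφ2 hd, hFx]
    ring
  have h3 (j : Fin m) : pd j ((fun z => φ (f z)) ∘ e.symm) (e x) =
      φ' (f x) * pd j (f ∘ e.symm) (e x) := by
    rw [(h1 j).eq_of_nhds, hFx]
  simp only [laplacian, gradSq, gradDot, hessianCoord]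
  change ∑ i, ∑ j, gramInv g e (e x) i j * (pd i (pd j ((fun z => φ (f z)) ∘ e.symm)) (e x) -
    ∑ k, christoffel g e k i j (e x) * pd k ((fun z => φ (f z)) ∘ e.symm) (e x)) = _
  simp only [h2, h3, Finset.mul_sum, ← Finset.sum_add_distrib]
  refine Finset.sum_congr rfl fun i _ => Finset.sum_congr rfl fun j _ => ?_
  have : ∑ k, christoffel g e k i j (e x) * (φ' (f x) * pd k (f ∘ e.symm) (e x)) =
      φ' (f x) * ∑ k, christoffel g e k i j (e x) * pd k (f ∘ e.symm) (e x) := by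
    rw [Finset.mul_sum]
    exact Finset.sum_congr rfl fun k _ => by ring
  rw [this]; ring

end Leibniz

/-! ### The Riemannian volume -/

section Volume

open MeasureTheory

variable {m : ℕ} {M : Type*} [TopologicalSpace M] [ChartedSpace (EuclideanSpace ℝ (Fin m)) M]
  [IsManifold (𝓡 m) ∞ M] {g : RMetric m M}
  {e e' : OpenPartialHomeomorph M (EuclideanSpace ℝ (Fin m))} {B : Set M}

/-- The density `√(det g)` of the volume in a chart. -/
def volDensity (g : RMetric m M) (e : OpenPartialHomeomorph M (EuclideanSpace ℝ (Fin m)))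
    (y : EuclideanSpace ℝ (Fin m)) : ℝ :=
  Real.sqrt (gram g e y).det

theorem volDensity_nonneg (y : EuclideanSpace ℝ (Fin m)) : 0 ≤ volDensity g e y :=
  Real.sqrt_nonneg _

theorem volDensity_pos {y : EuclideanSpace ℝ (Fin m)}
    (he : e ∈ IsManifold.maximalAtlas (𝓡 m) ∞ M) (hy : y ∈ e.target) :
    0 < volDensity g e y :=
  Real.sqrt_pos.2 (gram_det_pos he hy)

theorem volDensity_contDiffAt {y : EuclideanSpace ℝ (Fin m)}
    (he : e ∈ IsManifold.maximalAtlas (𝓡 m) ∞ M) (hy : y ∈ e.target) :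
    ContDiffAt ℝ ∞ (volDensity g e) y :=
  (contDiffAt_det fun i j => gram_contDiffAt he hy i j).sqrt (gram_det_pos he hy).ne'

theorem volDensity_continuousOn (he : e ∈ IsManifold.maximalAtlas (𝓡 m) ∞ M) :
    ContinuousOn (volDensity g e) e.target :=
  fun _ hy => (volDensity_contDiffAt he hy).continuousAt.continuousWithinAt

variable [MeasurableSpace M] [BorelSpace M]

theorem aemeasurable_symm (e : OpenPartialHomeomorph M (EuclideanSpace ℝ (Fin m))) :
    AEMeasurable e.symm (volume.restrict e.target) :=
  e.continuousOn_symm.aemeasurable e.open_target.measurableSet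

theorem measurableSet_target_inter_preimage
    (e : OpenPartialHomeomorph M (EuclideanSpace ℝ (Fin m))) (hB : MeasurableSet B) :
    MeasurableSet (e.target ∩ e.symm ⁻¹' B) := by
  have h := (continuousOn_iff_continuous_domRestrict.1 e.continuousOn_symm).measurable hB
  have h2 := e.open_target.measurableSet.subtype_image h
  convert h2 using 1
  ext y
  simp [and_comm]

theorem chartVolume_apply (g : RMetric m M)
    (e : OpenPartialHomeomorph M (EuclideanSpace ℝ (Fin m))) (hB : MeasurableSet B) :
    chartVolume g e B =
      ∫⁻ y in e.target ∩ e.symm ⁻¹' B, ENNReal.ofReal (volDensity g e y) := by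
  rw [chartVolume, Measure.map_apply_of_aemeasurable
    ((aemeasurable_symm e).mono_ac (withDensity_absolutelyContinuous _ _)) hB,
    withDensity_apply', Measure.restrict_restrict' e.open_target.measurableSet, Set.inter_comm]
  rfl

/-- The densities `√(det g)` of two charts agree on the overlap, by the change of variables formula.
-/
theorem chartVolume_congr (he : e ∈ IsManifold.maximalAtlas (𝓡 m) ∞ M)
    (he' : e' ∈ IsManifold.maximalAtlas (𝓡 m) ∞ M) (hB : MeasurableSet B)
    (hBe : B ⊆ e.source) (hBe' : B ⊆ e'.source) :
    chartVolume g e B = chartVolume g e' B := by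
  rw [chartVolume_apply g e hB, chartVolume_apply g e' hB]
  set S := e.target ∩ e.symm ⁻¹' B with hS
  have hSm : MeasurableSet S := measurableSet_target_inter_preimage e hB
  have himage : e'.target ∩ e'.symm ⁻¹' B = (fun y => e' (e.symm y)) '' S := by
    ext z
    constructor
    · rintro ⟨hz, hzB⟩
      refine ⟨e (e'.symm z), ⟨e.map_source (hBe hzB), ?_⟩, ?_⟩
      · simpa [e.left_inv (hBe hzB)] using hzB
      · simp [e.left_inv (hBe hzB), e'.right_inv hz]
    · rintro ⟨y, ⟨hy, hyB⟩, rfl⟩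
      exact ⟨e'.map_source (hBe' hyB), by simpa [e'.left_inv (hBe' hyB)] using hyB⟩
  have hderiv : ∀ y ∈ S, HasFDerivWithinAt (fun y => e' (e.symm y))
      (fderiv ℝ (fun y => e' (e.symm y)) y) S y := fun y hy =>
    ((contDiffAt_trans he he' hy.1 (hBe' hy.2)).differentiableAt
      (by simp)).hasFDerivAt.hasFDerivWithinAt
  have hinj : Set.InjOn (fun y => e' (e.symm y)) S := fun y hy z hz h =>
    e.symm.injOn hy.1 hz.1 (e'.injOn (hBe' hy.2) (hBe' hz.2) h)
  rw [himage, lintegral_image_eq_lintegral_abs_det_fderiv_mul volume hSm hderiv hinj]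
  refine setLIntegral_congr_fun hSm fun y hy => ?_
  have hdet : (fderiv ℝ (fun y => e' (e.symm y)) y).det = (transJac e e' y).det := by
    have hψ := (contDiffAt_trans he he' hy.1 (hBe' hy.2)).differentiableAt (by simp)
    rw [ContinuousLinearMap.det, ← LinearMap.det_toMatrix
      (EuclideanSpace.basisFun (Fin m) ℝ).toBasis, ← Matrix.det_transpose]
    congr 1
    ext i j
    have := ((EuclideanSpace.proj j : EuclideanSpace ℝ (Fin m) →L[ℝ] ℝ).hasFDerivAt
      (x := e' (e.symm y))).comp y hψ.hasFDerivAt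
    rw [Matrix.transpose_apply, LinearMap.toMatrix_apply, transJac, Matrix.of_apply, pd,
      show (fun z => (e' (e.symm z)) j) = (EuclideanSpace.proj j :
          EuclideanSpace ℝ (Fin m) →L[ℝ] ℝ) ∘ fun z => e' (e.symm z) from rfl, this.fderiv]
    simp
  have hdens : volDensity g e y =
      |(transJac e e' y).det| * volDensity g e' (e' (e.symm y)) := by
    rw [volDensity, volDensity, gram_trans he he' hy.1 (hBe' hy.2), Matrix.det_mul,
      Matrix.det_mul, Matrix.det_transpose, ← Real.sqrt_sq_eq_abs, ← Real.sqrt_mul (sq_nonneg _)]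
    congr 1; ring
  rw [hdet, hdens, ENNReal.ofReal_mul (abs_nonneg _)]

theorem chartVolume_inter_source (hB : MeasurableSet B) :
    chartVolume g e (B ∩ e.source) = chartVolume g e B := by
  rw [chartVolume_apply g e hB, chartVolume_apply g e (hB.inter e.open_source.measurableSet)]
  congr 2
  ext y
  constructor
  · rintro ⟨h, h1, -⟩; exact ⟨h, h1⟩
  · rintro ⟨h, h1⟩; exact ⟨h, h1, e.map_target h⟩

variable [CompactSpace M]

/-- On the domain of a chart, the Riemannian volume is `√(det g) dy`. The supremum of measures which
defines `vol` is bounded by the sum of the restrictions of countably many chart measures to disjoint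
sets, the first of which is the domain of the given chart. -/
theorem vol_apply_of_subset (z : M) (hB : MeasurableSet B)
    (hBz : B ⊆ (chartAt (EuclideanSpace ℝ (Fin m)) z).source) :
    vol g B = chartVolume g (chartAt _ z) B := by
  set c : M → OpenPartialHomeomorph M (EuclideanSpace ℝ (Fin m)) := fun x => chartAt _ x with hc
  have hmem (x : M) : c x ∈ IsManifold.maximalAtlas (𝓡 m) ∞ M :=
    IsManifold.chart_mem_maximalAtlas x
  -- a sequence of charts which covers the manifold and starts with the chart at `z`
  obtain ⟨x, hx0, hx⟩ : ∃ x : ℕ → M, x 0 = z ∧ ⋃ n, (c (x n)).source = Set.univ := by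
    obtain ⟨t, ht⟩ := isCompact_univ.elim_nhds_subcover (fun x => (c x).source)
      (fun x _ => (c x).open_source.mem_nhds (mem_chart_source _ x))
    obtain ⟨f, hf⟩ := (t.countable_toSet.insert z).exists_eq_range (Set.insert_nonempty _ _)
    refine ⟨fun n => Nat.casesOn n z f, rfl, Set.eq_univ_of_forall fun y => ?_⟩
    obtain ⟨w, hw, hyw⟩ := Set.mem_iUnion₂.1 (ht.2 (Set.mem_univ y))
    obtain ⟨n, hn⟩ : w ∈ Set.range f := hf ▸ Set.mem_insert_of_mem _ hw
    exact Set.mem_iUnion.2 ⟨n + 1, by simpa [hn] using hyw⟩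
  set A : ℕ → Set M := disjointed fun n => (c (x n)).source with hA
  have hAm (n : ℕ) : MeasurableSet (A n) :=
    MeasurableSet.disjointed (fun n => (c (x n)).open_source.measurableSet) n
  have hAs (n : ℕ) : A n ⊆ (c (x n)).source := disjointed_subset _ n
  have hAd : Pairwise (Function.onFun Disjoint A) := disjoint_disjointed _
  have hAu : ⋃ n, A n = Set.univ := by rw [hA, iUnion_disjointed, hx]
  have hA0 : A 0 = (c z).source := by rw [hA, disjointed_zero, hx0]
  set ν : Measure M := Measure.sum fun n => (chartVolume g (c (x n))).restrict (A n) with hν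
  have hle : vol g ≤ ν := by
    refine iSup_le fun y => Measure.le_iff.2 fun B hB => ?_
    have h1 : chartVolume g (c y) B = ∑' n, chartVolume g (c y) (B ∩ A n) := by
      rw [← measure_iUnion (fun i j hij => (hAd hij).mono Set.inter_subset_right
        Set.inter_subset_right) fun n => hB.inter (hAm n), ← Set.inter_iUnion, hAu, Set.inter_univ]
    change chartVolume g (c y) B ≤ _
    rw [h1, hν, Measure.sum_apply _ hB]
    refine ENNReal.tsum_le_tsum fun n => ?_
    rw [Measure.restrict_apply hB, ← chartVolume_inter_source (hB.inter (hAm n)),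
      chartVolume_congr (hmem y) (hmem (x n)) ((hB.inter (hAm n)).inter
        (c y).open_source.measurableSet) Set.inter_subset_right
        (fun w hw => hAs n hw.1.2)]
    exact measure_mono Set.inter_subset_left
  refine le_antisymm ((hle B).trans ?_) (le_iSup (fun x => chartVolume g (c x)) z B)
  rw [hν, Measure.sum_apply _ hB, tsum_eq_single 0]
  · rw [Measure.restrict_apply hB, hx0]
    exact measure_mono Set.inter_subset_left
  · intro n hn
    have : B ∩ A n = ∅ := by
      refine (Set.disjoint_iff_inter_eq_empty.1 ?_)
      exact (hAd hn.symm).mono_left (hA0 ▸ hBz)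
    rw [Measure.restrict_apply hB, this, measure_empty]

theorem vol_restrict_source (z : M) :
    (vol g).restrict (chartAt (EuclideanSpace ℝ (Fin m)) z).source =
      chartVolume g (chartAt _ z) := by
  have hs : MeasurableSet (chartAt (EuclideanSpace ℝ (Fin m)) z).source :=
    OpenPartialHomeomorph.open_source _ |>.measurableSet
  ext B hB
  rw [Measure.restrict_apply hB, vol_apply_of_subset z (hB.inter hs) Set.inter_subset_right,
    chartVolume_inter_source hB]

/-- The integral of a function supported in the domain of a chart. -/
theorem integral_vol_eq (z : M) {Φ : M → ℝ} (hΦ : AEStronglyMeasurable Φ (vol g))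
    (hs : ∀ x, x ∉ (chartAt (EuclideanSpace ℝ (Fin m)) z).source → Φ x = 0) :
    ∫ x, Φ x ∂(vol g) = ∫ y in (chartAt (EuclideanSpace ℝ (Fin m)) z).target,
      Φ ((chartAt (EuclideanSpace ℝ (Fin m)) z).symm y) * volDensity g (chartAt _ z) y := by
  set e := chartAt (EuclideanSpace ℝ (Fin m)) z with hedef
  have he : e ∈ IsManifold.maximalAtlas (𝓡 m) ∞ M := IsManifold.chart_mem_maximalAtlas z
  have hdm : AEMeasurable (fun y => ENNReal.ofReal (volDensity g e y))
      (volume.restrict e.target) :=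
    ((volDensity_continuousOn he).aemeasurable e.open_target.measurableSet).ennreal_ofReal
  rw [← setIntegral_eq_integral_of_forall_compl_eq_zero (s := e.source) hs]
  have hΦ' := hΦ.restrict (s := e.source)
  rw [vol_restrict_source z] at hΦ' ⊢
  rw [chartVolume] at hΦ' ⊢
  rw [integral_map ((aemeasurable_symm e).mono_ac (withDensity_absolutelyContinuous _ _)) hΦ']
  change ∫ y, Φ (e.symm y) ∂((volume.restrict e.target).withDensity
    fun y => ENNReal.ofReal (volDensity g e y)) = _
  rw [integral_withDensity_eq_integral_toReal_smul₀ hdm (by simp)]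
  refine integral_congr_ae (Filter.Eventually.of_forall fun y => ?_)
  simp only [smul_eq_mul]
  rw [ENNReal.toReal_ofReal (volDensity_nonneg _), mul_comm]

instance isFiniteMeasure_vol : IsFiniteMeasure (vol g) := by
  refine ⟨isCompact_univ.measure_lt_top_of_nhdsWithin fun z _ => ?_⟩
  rw [nhdsWithin_univ]
  set e := chartAt (EuclideanSpace ℝ (Fin m)) z with hedef
  have he : e ∈ IsManifold.maximalAtlas (𝓡 m) ∞ M := IsManifold.chart_mem_maximalAtlas z
  have hz : z ∈ e.source := mem_chart_source _ z
  obtain ⟨r, hr, hrt⟩ := Metric.nhds_basis_closedBall.mem_iff.1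
    (e.open_target.mem_nhds (e.map_source hz))
  refine ⟨e.source ∩ e ⁻¹' Metric.ball (e z) r, (e.isOpen_inter_preimage
    Metric.isOpen_ball).mem_nhds ⟨hz, Metric.mem_ball_self hr⟩, ?_⟩
  have hm : MeasurableSet (e.source ∩ e ⁻¹' Metric.ball (e z) r) :=
    (e.isOpen_inter_preimage Metric.isOpen_ball).measurableSet
  rw [vol_apply_of_subset z hm Set.inter_subset_left, chartVolume_apply g _ hm]
  refine (lintegral_mono_set (?_ : _ ⊆ Metric.closedBall (e z) r)).trans_lt ?_
  · rintro y ⟨hy, -, hyr⟩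
    rw [Set.mem_preimage, e.right_inv hy] at hyr
    exact Metric.ball_subset_closedBall hyr
  · have h := ((volDensity_continuousOn (g := g) he).mono hrt).integrableOn_compact
      (μ := volume) (isCompact_closedBall (e z) r)
    exact h.lintegral_lt_top

theorem integrable_of_continuous [T2Space M] {Φ : M → ℝ} (hΦ : Continuous Φ) :
    Integrable Φ (vol g) :=
  hΦ.integrable_of_hasCompactSupport (HasCompactSupport.of_compactSpace Φ)

end Volume

/-! ### Green's formula -/

section Jacobi

variable {m : ℕ} {y : EuclideanSpace ℝ (Fin m)}

theorem pd_det {A : EuclideanSpace ℝ (Fin m) → Matrix (Fin m) (Fin m) ℝ}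
    (hA : ∀ i j, DifferentiableAt ℝ (fun z => A z i j) y) (k : Fin m) :
    pd k (fun z => (A z).det) y =
      ∑ i, ((A y).updateCol i fun j => pd k (fun z => A z j i) y).det := by
  have hder (σ : Equiv.Perm (Fin m)) : HasFDerivAt (fun z => ∏ i, A z (σ i) i)
      (∑ i, (∏ j ∈ Finset.univ.erase i, A y (σ j) j) • fderiv ℝ (fun z => A z (σ i) i) y) y := by
    have := HasFDerivAt.finsetProd (u := Finset.univ) (g := fun i z => A z (σ i) i)
      (g' := fun i => fderiv ℝ (fun z => A z (σ i) i) y) (x := y)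
      fun i _ => (hA (σ i) i).hasFDerivAt
    exact this.congr_of_eventuallyEq (Filter.Eventually.of_forall fun z => by simp)
  have hprod (σ : Equiv.Perm (Fin m)) : DifferentiableAt ℝ
      (fun z => ∏ i, A z (σ i) i) y := (hder σ).differentiableAt
  have hpd (σ : Equiv.Perm (Fin m)) : pd k (fun z => ∏ i, A z (σ i) i) y =
      ∑ i, ∏ j, ((A y).updateCol i fun j => pd k (fun z => A z j i) y) (σ j) j := by
    rw [pd, (hder σ).fderiv]
    simp only [sum_apply, smul_apply, smul_eq_mul]
    refine Finset.sum_congr rfl fun i _ => ?_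
    rw [← Finset.mul_prod_erase Finset.univ _ (Finset.mem_univ i), Matrix.updateCol_self, mul_comm]
    congr 1
    refine Finset.prod_congr rfl fun j hj => ?_
    rw [Matrix.updateCol_ne (Finset.ne_of_mem_erase hj)]
  simp only [Matrix.det_apply']
  rw [pd_sum (Φ := fun (σ : Equiv.Perm (Fin m)) z => (Equiv.Perm.sign σ : ℝ) * ∏ i, A z (σ i) i) _ _
    fun σ _ => (hprod σ).const_mul _, Finset.sum_comm]
  refine Finset.sum_congr rfl fun σ _ => ?_
  rw [pd_const_mul k _ (hprod σ), hpd, Finset.mul_sum]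

/-- Jacobi's formula. -/
theorem pd_det_eq_mul {A : EuclideanSpace ℝ (Fin m) → Matrix (Fin m) (Fin m) ℝ}
    (hA : ∀ i j, DifferentiableAt ℝ (fun z => A z i j) y) (h0 : (A y).det ≠ 0) (k : Fin m) :
    pd k (fun z => (A z).det) y =
      (A y).det * ∑ i, ∑ j, (A y)⁻¹ i j * pd k (fun z => A z j i) y := by
  rw [pd_det hA, Finset.mul_sum]
  refine Finset.sum_congr rfl fun i _ => ?_
  rw [← Matrix.cramer_apply, Matrix.cramer_eq_adjugate_mulVec, Matrix.inv_def]
  simp only [Matrix.mulVec, dotProduct, Matrix.smul_apply, Ring.inverse_eq_inv, smul_eq_mul,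
    Finset.mul_sum]
  refine Finset.sum_congr rfl fun j _ => ?_
  field_simp

end Jacobi

section Green

open MeasureTheory

variable {m : ℕ} {M : Type*} [TopologicalSpace M] [ChartedSpace (EuclideanSpace ℝ (Fin m)) M]
  [IsManifold (𝓡 m) ∞ M] {g : RMetric m M}
  {e : OpenPartialHomeomorph M (EuclideanSpace ℝ (Fin m))} {y : EuclideanSpace ℝ (Fin m)}
  {x : M} {u v : M → ℝ}

/-- `∂_k √(det g) = √(det g) Γ^l_{kl}`. -/
theorem pd_volDensity (he : e ∈ IsManifold.maximalAtlas (𝓡 m) ∞ M) (hy : y ∈ e.target)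
    (k : Fin m) : pd k (volDensity g e) y =
      volDensity g e y * ∑ l, christoffel g e l k l y := by
  have hd (i j : Fin m) : DifferentiableAt ℝ (fun z => gram g e z i j) y :=
    (gram_contDiffAt he hy i j).differentiableAt (by simp)
  have hdet := gram_det_pos (g := g) he hy
  have h1 : ∑ i, ∑ j, (gram g e y)⁻¹ i j * pd k (fun z => gram g e z j i) y =
      2 * ∑ l, christoffel g e l k l y := by
    have hPG (i j : Fin m) : ∑ a, gramInv g e y i a * gram g e y a j = if i = j then 1 else 0 := by
      rw [← Matrix.mul_apply, gramInv_mul_gram he hy, Matrix.one_apply]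
    have e1 : ∑ i, ∑ j, gramInv g e y i j * ∑ l, christoffel g e l k j y * gram g e y l i =
        ∑ l, christoffel g e l k l y := by
      calc _ = ∑ i, ∑ j, ∑ l, christoffel g e l k j y * (gramInv g e y j i * gram g e y i l) := by
            refine Finset.sum_congr rfl fun i _ => Finset.sum_congr rfl fun j _ => ?_
            rw [Finset.mul_sum]
            exact Finset.sum_congr rfl fun l _ => by
              rw [gramInv_symm i j, gram_symm l i]; ring
        _ = ∑ j, ∑ l, ∑ i, christoffel g e l k j y * (gramInv g e y j i * gram g e y i l) := by
            rw [Finset.sum_comm]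
            exact Finset.sum_congr rfl fun j _ => Finset.sum_comm
        _ = _ := by simp [← Finset.mul_sum, hPG]
    have e2 : ∑ i, ∑ j, gramInv g e y i j * ∑ l, gram g e y j l * christoffel g e l k i y =
        ∑ l, christoffel g e l k l y := by
      calc _ = ∑ i, ∑ j, ∑ l, christoffel g e l k i y * (gramInv g e y i j * gram g e y j l) := by
            refine Finset.sum_congr rfl fun i _ => Finset.sum_congr rfl fun j _ => ?_
            rw [Finset.mul_sum]
            exact Finset.sum_congr rfl fun l _ => by ring
        _ = ∑ i, ∑ l, ∑ j, christoffel g e l k i y * (gramInv g e y i j * gram g e y j l) :=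
            Finset.sum_congr rfl fun j _ => Finset.sum_comm
        _ = _ := by simp [← Finset.mul_sum, hPG]
    change ∑ i, ∑ j, gramInv g e y i j * pd k (fun z => gram g e z j i) y = _
    simp only [pd_gram he hy, mul_add, Finset.sum_add_distrib]
    rw [e1, e2]; ring
  have h2 : pd k (volDensity g e) y = 1 / (2 * volDensity g e y) *
      pd k (fun z => (gram g e z).det) y :=
    pd_comp_real k (F := fun z => (gram g e z).det) (Real.hasDerivAt_sqrt hdet.ne')
      ((contDiffAt_det fun i j => gram_contDiffAt he hy i j).differentiableAt
        (by simp : (∞ : WithTop ℕ∞) ≠ 0))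
  have h3 : volDensity g e y * volDensity g e y = (gram g e y).det := Real.mul_self_sqrt hdet.le
  have h4 := (volDensity_pos (g := g) he hy).ne'
  rw [h2, pd_det_eq_mul hd hdet.ne', h1, ← h3]
  field_simp

/-- The divergence of the vector field `u √(det g) ∇v` in a chart. -/
theorem sum_pd_mul_gradComp {U V : EuclideanSpace ℝ (Fin m) → ℝ}
    (he : e ∈ IsManifold.maximalAtlas (𝓡 m) ∞ M) (hy : y ∈ e.target)
    (hU : DifferentiableAt ℝ U y) (hV : ContDiffAt ℝ 2 V y) :
    ∑ i, pd i (fun z => U z * volDensity g e z * gradComp g e V i z) y =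
      (gradDotLoc g e U V y + U y * lapLoc g e V y) * volDensity g e y := by
  have hρ : DifferentiableAt ℝ (volDensity g e) y :=
    (volDensity_contDiffAt he hy).differentiableAt (by simp)
  have h1 (i : Fin m) : pd i (fun z => U z * volDensity g e z * gradComp g e V i z) y =
      (pd i U y * volDensity g e y + U y * (volDensity g e y * ∑ l, christoffel g e l i l y)) *
        gradComp g e V i y + U y * volDensity g e y * pd i (gradComp g e V i) y := by
    rw [pd_mul (F := fun z => U z * volDensity g e z) i (hU.mul hρ)
      (differentiableAt_gradComp he hy hV i), pd_mul i hU hρ, pd_volDensity he hy]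
  have h2 : ∑ i, ∑ l, christoffel g e i i l y * gradComp g e V l y =
      ∑ i, (∑ l, christoffel g e l i l y) * gradComp g e V i y := by
    rw [Finset.sum_comm]
    refine Finset.sum_congr rfl fun i _ => ?_
    rw [Finset.sum_mul]
    exact Finset.sum_congr rfl fun l _ => by rw [christoffel_symm]
  rw [gradDotLoc_comm, gradDotLoc_eq_left, lapLoc_eq_div he hy hV, Finset.sum_add_distrib, h2]
  simp only [h1, mul_add, add_mul, Finset.sum_add_distrib, Finset.mul_sum, Finset.sum_mul]
  have e1 : ∑ i, pd i U y * volDensity g e y * gradComp g e V i y =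
      ∑ i, gradComp g e V i y * pd i U y * volDensity g e y :=
    Finset.sum_congr rfl fun i _ => by ring
  have e2 : ∑ i, U y * volDensity g e y * pd i (gradComp g e V i) y =
      ∑ i, U y * pd i (gradComp g e V i) y * volDensity g e y :=
    Finset.sum_congr rfl fun i _ => by ring
  have e3 : ∑ i, ∑ l, U y * (volDensity g e y * christoffel g e l i l y) * gradComp g e V i y =
      ∑ i, ∑ l, U y * (christoffel g e l i l y * gradComp g e V i y) * volDensity g e y :=
    Finset.sum_congr rfl fun i _ => Finset.sum_congr rfl fun l _ => by ring
  rw [e1, e2, e3]; ring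

theorem integral_pd_eq_zero {W : EuclideanSpace ℝ (Fin m) → ℝ} (hW : ContDiff ℝ 1 W)
    (hc : HasCompactSupport W) (i : Fin m) : ∫ z, pd i W z = 0 := by
  have hint : Integrable (pd i W) := by
    have h1 : Continuous (pd i W) :=
      (hW.continuous_fderiv (by simp)).clm_apply continuous_const
    refine h1.integrable_of_hasCompactSupport ?_
    exact (hc.fderiv (𝕜 := ℝ)).mono fun z hz => by
      contrapose! hz
      simp only [Function.mem_support, not_not] at hz
      simp [pd, hz]
  have := integral_mul_fderiv_eq_neg_fderiv_mul_of_integrable (μ := volume)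
    (f := fun _ : EuclideanSpace ℝ (Fin m) => (1 : ℝ)) (g := W)
    (v := EuclideanSpace.single i (1 : ℝ)) (by simp)
    (by simp only [one_mul]; exact hint) (by simpa using hW.continuous.integrable_of_hasCompactSupport hc)
    (fun z _ => differentiableAt_const _) (fun z _ => hW.differentiable (by simp) z)
  simpa [pd] using this

theorem gradDot_eq_zero_of_eventually (hu : ∀ᶠ z in nhds x, u z = 0) : gradDot g u v x = 0 := by
  have hx := mem_chart_source (EuclideanSpace ℝ (Fin m)) x
  have h (i : Fin m) : pd i (u ∘ (chartAt (EuclideanSpace ℝ (Fin m)) x).symm)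
      (chartAt _ x x) = 0 := by
    rw [pd_congr (F := u ∘ (chartAt (EuclideanSpace ℝ (Fin m)) x).symm) (H := fun _ => 0) i
      (eventually_comp_symm hx hu), pd_const]
  simp [gradDot, h]

variable [MeasurableSpace M] [BorelSpace M] [T2Space M] [CompactSpace M]

theorem gradDot_continuous (hu : ContMDiff (𝓡 m) 𝓘(ℝ, ℝ) 1 u) (hv : ContMDiff (𝓡 m) 𝓘(ℝ, ℝ) 1 v) :
    Continuous (gradDot g u v) :=
  continuous_iff_continuousAt.2 fun x =>
    (gradDot_contMDiffAt (k := 0) (l := 1) (by simp) (hu x) (hv x)).continuousAt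

theorem laplacian_continuous (hv : ContMDiff (𝓡 m) 𝓘(ℝ, ℝ) 2 v) :
    Continuous (laplacian g v) :=
  continuous_iff_continuousAt.2 fun x =>
    (laplacian_contMDiffAt (k := 0) (l := 2) (by simp) (hv x)).continuousAt

/-- Green's formula for a function `u` supported in one chart: the integrand is the divergence of the
compactly supported vector field `u √(det g) ∇v` on `ℝ^m`. -/
theorem green_of_tsupport_subset (z : M) (hu : ContMDiff (𝓡 m) 𝓘(ℝ, ℝ) 1 u)
    (hv : ContMDiff (𝓡 m) 𝓘(ℝ, ℝ) 2 v)
    (hs : tsupport u ⊆ (chartAt (EuclideanSpace ℝ (Fin m)) z).source) :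
    ∫ x, (gradDot g u v x + u x * laplacian g v x) ∂(vol g) = 0 := by
  have hcont : Continuous fun x => gradDot g u v x + u x * laplacian g v x :=
    (gradDot_continuous hu (hv.of_le (by norm_num))).add
      (hu.continuous.mul (laplacian_continuous hv))
  have hzero (x : M) (hx : x ∉ tsupport u) : gradDot g u v x + u x * laplacian g v x = 0 := by
    rw [gradDot_eq_zero_of_eventually, image_eq_zero_of_notMem_tsupport hx]
    · simp
    · filter_upwards [(isClosed_tsupport u).isOpen_compl.mem_nhds hx] with w hw
      exact image_eq_zero_of_notMem_tsupport hw
  rw [integral_vol_eq z hcont.aestronglyMeasurable fun x hx => hzero x fun h => hx (hs h)]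
  set e := chartAt (EuclideanSpace ℝ (Fin m)) z with hedef
  have he : e ∈ IsManifold.maximalAtlas (𝓡 m) ∞ M := IsManifold.chart_mem_maximalAtlas z
  set U := u ∘ e.symm with hU
  set V := v ∘ e.symm with hV
  -- the components of `u √(det g) ∇v`, extended by zero outside of the chart
  set W : Fin m → EuclideanSpace ℝ (Fin m) → ℝ := fun i =>
    e.target.indicator fun y => U y * volDensity g e y * gradComp g e V i y with hW
  set K := e '' tsupport u with hK
  have hKc : IsCompact K :=
    (isClosed_tsupport u).isCompact.image_of_continuousOn (e.continuousOn.mono hs)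
  have hW0 (i : Fin m) (y : EuclideanSpace ℝ (Fin m)) (hy : y ∉ K) : W i y = 0 := by
    by_cases hyt : y ∈ e.target
    · have : e.symm y ∉ tsupport u := fun h => hy ⟨_, h, e.right_inv hyt⟩
      simp [hW, hyt, hU, image_eq_zero_of_notMem_tsupport this]
    · simp [hW, hyt]
  have hW0' (i : Fin m) (y : EuclideanSpace ℝ (Fin m)) (hy : y ∉ K) :
      W i =ᶠ[nhds y] fun _ => 0 := by
    filter_upwards [hKc.isClosed.isOpen_compl.mem_nhds hy] with w hw using hW0 i w hw
  have hWt (i : Fin m) {y : EuclideanSpace ℝ (Fin m)} (hy : y ∈ e.target) :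
      W i =ᶠ[nhds y] fun y => U y * volDensity g e y * gradComp g e V i y := by
    filter_upwards [e.open_target.mem_nhds hy] with w hw
    simp [hW, hw]
  have hUc {y : EuclideanSpace ℝ (Fin m)} (hy : y ∈ e.target) : ContDiffAt ℝ 1 U y :=
    contDiffAt_comp_symm (by simp) he hy (hu _)
  have hVc {y : EuclideanSpace ℝ (Fin m)} (hy : y ∈ e.target) : ContDiffAt ℝ 2 V y :=
    contDiffAt_comp_symm two_le_infty he hy (hv _)
  have hWsm (i : Fin m) : ContDiff ℝ 1 (W i) := by
    refine contDiff_iff_contDiffAt.2 fun y => ?_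
    by_cases hy : y ∈ K
    · have hyt : y ∈ e.target := by
        obtain ⟨w, hw, rfl⟩ := hy; exact e.map_source (hs hw)
      refine ContDiffAt.congr_of_eventuallyEq ?_ (hWt i hyt)
      exact ((hUc hyt).mul ((volDensity_contDiffAt he hyt).of_le (by simp))).mul
        (gradComp_contDiffAt (k := 1) he hyt (hVc hyt) i)
    · exact contDiffAt_const.congr_of_eventuallyEq (hW0' i y hy)
  have hWc (i : Fin m) : HasCompactSupport (W i) :=
    HasCompactSupport.intro hKc fun y hy => hW0 i y hy
  have hsum : ∫ y, ∑ i, pd i (W i) y = 0 := by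
    rw [integral_finsetSum]
    · exact Finset.sum_eq_zero fun i _ => integral_pd_eq_zero (hWsm i) (hWc i) i
    · intro i _
      have h1 : Continuous (pd i (W i)) :=
        ((hWsm i).continuous_fderiv (by simp)).clm_apply continuous_const
      refine h1.integrable_of_hasCompactSupport (HasCompactSupport.intro hKc fun y hy => ?_)
      rw [pd_congr i (hW0' i y hy), pd_const]
  rw [← hsum, ← setIntegral_eq_integral_of_forall_compl_eq_zero (s := e.target)
    (f := fun y => ∑ i, pd i (W i) y)]
  · refine setIntegral_congr_fun e.open_target.measurableSet fun y hy => ?_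
    simp only [pd_congr _ (hWt _ hy)]
    rw [sum_pd_mul_gradComp he hy ((hUc hy).differentiableAt (by simp)) (hVc hy)]
    have hys := e.map_target hy
    rw [gradDot_eq_gradDotLoc he hys (hu _) ((hv _).of_le (by norm_num)),
      laplacian_eq_lapLoc he hys (hv _), e.right_inv hy]
    rfl
  · intro y hy
    refine Finset.sum_eq_zero fun i _ => ?_
    rw [pd_congr i (hW0' i y fun h => hy ?_), pd_const]
    obtain ⟨w, hw, rfl⟩ := h; exact e.map_source (hs hw)

theorem gradDot_sum_left {ι : Type*} (s : Finset ι) {w : ι → M → ℝ}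
    (hw : ∀ a ∈ s, ContMDiffAt (𝓡 m) 𝓘(ℝ, ℝ) 1 (w a) x) :
    gradDot g (fun z => ∑ a ∈ s, w a z) v x = ∑ a ∈ s, gradDot g (w a) v x := by
  unfold gradDot
  have h (i : Fin m) : pd i ((fun z => ∑ a ∈ s, w a z) ∘
      (chartAt (EuclideanSpace ℝ (Fin m)) x).symm) (chartAt _ x x) = _ :=
    pd_sum s i (Φ := fun a => w a ∘ (chartAt (EuclideanSpace ℝ (Fin m)) x).symm)
      (fun a ha => differentiableAt_chart (hw a ha))
  simp only [h, Finset.sum_mul, Finset.mul_sum]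
  calc _ = ∑ i, ∑ a ∈ s, ∑ j, _ := Finset.sum_congr rfl fun i _ => Finset.sum_comm
    _ = _ := Finset.sum_comm

/-- Green's formula on a compact manifold, by means of a partition of unity. -/
theorem integral_gradDot (hu : ContMDiff (𝓡 m) 𝓘(ℝ, ℝ) 1 u) (hv : ContMDiff (𝓡 m) 𝓘(ℝ, ℝ) 2 v) :
    ∫ x, gradDot g u v x ∂(vol g) = -∫ x, u x * laplacian g v x ∂(vol g) := by
  obtain ⟨t, -, ht⟩ := isCompact_univ.elim_nhds_subcover
    (fun x : M => (chartAt (EuclideanSpace ℝ (Fin m)) x).source)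
    (fun x _ => (OpenPartialHomeomorph.open_source _).mem_nhds (mem_chart_source _ x))
  obtain ⟨χ, hχ⟩ := SmoothPartitionOfUnity.exists_isSubordinate (𝓡 m) isClosed_univ
    (fun i : t => (chartAt (EuclideanSpace ℝ (Fin m)) (i : M)).source)
    (fun i => OpenPartialHomeomorph.open_source _) (fun x hx => by
      obtain ⟨i, hi, hxi⟩ := Set.mem_iUnion₂.1 (ht hx)
      exact Set.mem_iUnion.2 ⟨⟨i, hi⟩, hxi⟩)
  have hsum (x : M) : ∑ i, χ i x = 1 := by
    rw [← finsum_eq_sum_of_fintype]; exact χ.sum_eq_one (Set.mem_univ x)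
  have hχs (i : t) : ContMDiff (𝓡 m) 𝓘(ℝ, ℝ) 1 (χ i) := (χ i).contMDiff.of_le (by simp)
  have hw (i : t) : ContMDiff (𝓡 m) 𝓘(ℝ, ℝ) 1 (fun x => χ i x * u x) := (hχs i).mul hu
  have hu' : u = fun x => ∑ i, χ i x * u x := by
    funext x; rw [← Finset.sum_mul, hsum, one_mul]
  have hpart (i : t) := green_of_tsupport_subset (g := g) (i : M) (hw i) hv
    ((closure_mono (Function.support_mul_subset_left _ _)).trans (hχ i))
  have hint (i : t) : Integrable (fun x => gradDot g (fun x => χ i x * u x) v x +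
      χ i x * u x * laplacian g v x) (vol g) :=
    integrable_of_continuous ((gradDot_continuous (hw i) (hv.of_le (by norm_num))).add
      ((hw i).continuous.mul (laplacian_continuous hv)))
  have h0 : ∫ x, (gradDot g u v x + u x * laplacian g v x) ∂(vol g) = 0 := by
    have h1 (x : M) : gradDot g u v x + u x * laplacian g v x = ∑ i,
        (gradDot g (fun x => χ i x * u x) v x + χ i x * u x * laplacian g v x) := by
      rw [Finset.sum_add_distrib, ← gradDot_sum_left _ fun i _ => hw i x, ← hu',
        ← Finset.sum_mul, ← Finset.sum_mul, hsum, one_mul]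
    simp only [h1]
    rw [integral_finsetSum _ fun i _ => hint i]
    exact Finset.sum_eq_zero fun i _ => hpart i
  rw [integral_add (f := gradDot g u v) (g := fun x => u x * laplacian g v x)
    (integrable_of_continuous (gradDot_continuous hu (hv.of_le (by norm_num))))
    (integrable_of_continuous (hu.continuous.mul (laplacian_continuous hv)))] at h0
  linarith

end Green

/-! ### A Poincaré inequality on small convex cells -/

section Poincare

open MeasureTheory

variable {m : ℕ} {P Q U : Set (EuclideanSpace ℝ (Fin m))} {v : EuclideanSpace ℝ (Fin m) → ℝ}

/-- The squared Euclidean length of the gradient of `v`. -/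
def euclGradSq (v : EuclideanSpace ℝ (Fin m) → ℝ) (y : EuclideanSpace ℝ (Fin m)) : ℝ :=
  ∑ i, pd i v y ^ 2

theorem euclGradSq_nonneg (y : EuclideanSpace ℝ (Fin m)) : 0 ≤ euclGradSq v y :=
  Finset.sum_nonneg fun _ _ => sq_nonneg _

theorem measurable_euclGradSq : Measurable (euclGradSq v) :=
  Finset.measurable_sum _ fun _ _ => (measurable_fderiv_apply_const ℝ v _).pow_const 2

theorem fderiv_apply_sq_le (y h : EuclideanSpace ℝ (Fin m)) :
    fderiv ℝ v y h ^ 2 ≤ ‖h‖ ^ 2 * euclGradSq v y := by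
  rw [fderiv_eq_sum_pd, EuclideanSpace.norm_sq_eq]
  simpa [euclGradSq] using Finset.sum_mul_sq_le_sq_mul_sq Finset.univ (fun i => h i) fun i => pd i v y

theorem continuousOn_euclGradSq (hU : IsOpen U) (hv : ContDiffOn ℝ 1 v U) :
    ContinuousOn (euclGradSq v) U :=
  continuousOn_finsetSum _ fun _ _ =>
    ((hv.continuousOn_fderiv_of_isOpen hU le_rfl).clm_apply continuousOn_const).pow 2

theorem sq_integral_le_integral_sq {φ : ℝ → ℝ} (hφ : ContinuousOn φ (Set.Icc 0 1)) :
    (∫ t in (0 : ℝ)..1, φ t) ^ 2 ≤ ∫ t in (0 : ℝ)..1, φ t ^ 2 := by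
  have h01 : Set.uIcc (0 : ℝ) 1 = Set.Icc 0 1 := Set.uIcc_of_le zero_le_one
  set I := ∫ t in (0 : ℝ)..1, φ t with hI
  have h1 : IntervalIntegrable φ volume 0 1 := (h01 ▸ hφ).intervalIntegrable
  have h2 : IntervalIntegrable (fun t => φ t ^ 2) volume 0 1 :=
    ContinuousOn.intervalIntegrable (h01 ▸ hφ.pow 2)
  have h3 : 0 ≤ ∫ t in (0 : ℝ)..1, (φ t - I) ^ 2 :=
    intervalIntegral.integral_nonneg zero_le_one fun _ _ => sq_nonneg _
  have h4 : ∫ t in (0 : ℝ)..1, (φ t - I) ^ 2 = (∫ t in (0 : ℝ)..1, φ t ^ 2) - I ^ 2 := by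
    have : (fun t => (φ t - I) ^ 2) = fun t => φ t ^ 2 - (2 * I * φ t - I ^ 2) := by
      funext t; ring
    rw [this, intervalIntegral.integral_sub h2 ((h1.const_mul _).sub intervalIntegrable_const),
      intervalIntegral.integral_sub (h1.const_mul _) intervalIntegrable_const,
      intervalIntegral.integral_const_mul, ← hI]
    simp; ring
  linarith

/-- The fundamental theorem of calculus on the segment from `y` to `x`, with the Cauchy-Schwarz
inequality. -/
theorem sq_sub_le_integral_segment (hU : IsOpen U) (hv : ContDiffOn ℝ 1 v U)
    {x y : EuclideanSpace ℝ (Fin m)} (hxy : ∀ t ∈ Set.Icc (0 : ℝ) 1, y + t • (x - y) ∈ U) :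
    (v x - v y) ^ 2 ≤ ‖x - y‖ ^ 2 * ∫ t in (0 : ℝ)..1, euclGradSq v (y + t • (x - y)) := by
  have h01 : Set.uIcc (0 : ℝ) 1 = Set.Icc 0 1 := Set.uIcc_of_le zero_le_one
  have hline : Continuous fun t : ℝ => y + t • (x - y) := by fun_prop
  have hφ : ContinuousOn (fun t : ℝ => fderiv ℝ v (y + t • (x - y)) (x - y)) (Set.Icc 0 1) :=
    ((hv.continuousOn_fderiv_of_isOpen hU le_rfl).comp hline.continuousOn hxy).clm_apply
      continuousOn_const
  have hG : ContinuousOn (fun t : ℝ => euclGradSq v (y + t • (x - y))) (Set.Icc 0 1) :=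
    (continuousOn_euclGradSq hU hv).comp hline.continuousOn hxy
  have hder : ∀ t ∈ Set.uIcc (0 : ℝ) 1, HasDerivAt (fun t : ℝ => v (y + t • (x - y)))
      (fderiv ℝ v (y + t • (x - y)) (x - y)) t := by
    intro t ht
    rw [h01] at ht
    have h1 : HasFDerivAt v (fderiv ℝ v (y + t • (x - y))) (y + t • (x - y)) :=
      ((hv.contDiffAt (hU.mem_nhds (hxy t ht))).differentiableAt (by simp)).hasFDerivAt
    have h2 : HasDerivAt (fun t : ℝ => y + t • (x - y)) (x - y) t := by
      simpa using ((hasDerivAt_id t).smul_const (x - y)).const_add y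
    exact h1.comp_hasDerivAt t h2
  have hFTC := intervalIntegral.integral_eq_sub_of_hasDerivAt hder
    (ContinuousOn.intervalIntegrable (h01 ▸ hφ))
  simp only [one_smul, zero_smul, add_zero, add_sub_cancel] at hFTC
  rw [← hFTC, ← intervalIntegral.integral_const_mul]
  refine (sq_integral_le_integral_sq hφ).trans ?_
  refine intervalIntegral.integral_mono_on zero_le_one
    (ContinuousOn.intervalIntegrable (h01 ▸ hφ.pow 2))
    (ContinuousOn.intervalIntegrable (h01 ▸ hG.const_mul _)) fun t _ => fderiv_apply_sq_le _ _

theorem lintegral_comp_affine_le {G : EuclideanSpace ℝ (Fin m) → ENNReal} (hG : Measurable G)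
    (c : EuclideanSpace ℝ (Fin m)) {s : ℝ} (hs : 1 / 2 ≤ s) :
    ∫⁻ x, G (c + s • x) ≤ 2 ^ m * ∫⁻ x, G x := by
  have hs0 : 0 < s := by linarith
  have h1 : ∫⁻ x, G (c + s • x) =
      ∫⁻ x, G (c + x) ∂(Measure.map (fun x : EuclideanSpace ℝ (Fin m) => s • x) volume) :=
    (lintegral_map (f := fun x => G (c + x)) (hG.comp (measurable_const_add c))
      (measurable_const_smul s)).symm
  rw [h1, Measure.map_addHaar_smul _ hs0.ne', lintegral_smul_measure,
    lintegral_add_left_eq_self G c, finrank_euclideanSpace_fin, smul_eq_mul]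
  gcongr
  rw [show (2 : ENNReal) ^ m = ENNReal.ofReal (2 ^ m) by
    rw [ENNReal.ofReal_pow (by norm_num)]; simp]
  refine ENNReal.ofReal_le_ofReal ?_
  rw [abs_of_nonneg (by positivity), ← inv_pow]
  refine pow_le_pow_left₀ (by positivity) ?_ m
  rw [inv_le_comm₀ hs0 (by norm_num)]
  linarith

/-- The substitution `x ↦ y + t (x - y)` has Jacobian `t^m`, and `(1 - t)^m` as a function of `y`. One
of the two is at least `2^{-m}`, which decides the order of integration. -/
theorem lintegral_lintegral_segment_le {G : EuclideanSpace ℝ (Fin m) → ENNReal}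
    (hG : Measurable G) (P : Set (EuclideanSpace ℝ (Fin m))) (t : ℝ) :
    ∫⁻ x in P, ∫⁻ y in P, G (y + t • (x - y)) ≤ volume P * (2 ^ m * ∫⁻ x, G x) := by
  have hmeas : Measurable (Function.uncurry fun x y : EuclideanSpace ℝ (Fin m) =>
      G (y + t • (x - y))) := hG.comp (by fun_prop)
  rcases le_total (1 / 2) t with ht | ht
  · rw [lintegral_lintegral_swap hmeas.aemeasurable]
    calc _ ≤ ∫⁻ _ in P, 2 ^ m * ∫⁻ x, G x := by
          refine lintegral_mono fun y => ?_
          refine (setLIntegral_le_lintegral _ _).trans ?_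
          refine le_of_eq_of_le (lintegral_congr fun x => ?_)
            (lintegral_comp_affine_le hG (y - t • y) ht)
          congr 1; module
      _ = _ := by rw [setLIntegral_const, mul_comm]
  · calc _ ≤ ∫⁻ _ in P, 2 ^ m * ∫⁻ x, G x := by
          refine lintegral_mono fun x => ?_
          refine (setLIntegral_le_lintegral _ _).trans ?_
          refine le_of_eq_of_le (lintegral_congr fun y => ?_)
            (lintegral_comp_affine_le hG (t • x) (s := 1 - t) (by linarith))
          congr 1; module
      _ = _ := by rw [setLIntegral_const, mul_comm]

/-- Integrate the estimate along segments over all pairs of points of the convex set `P`. -/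
theorem lintegral_lintegral_sq_sub_le (hP : Convex ℝ P) (hPm : MeasurableSet P) (hU : IsOpen U)
    (hPU : P ⊆ U) (hv : ContDiffOn ℝ 1 v U) {C : ℝ} (hC : ∀ x ∈ P, ∀ y ∈ P, ‖x - y‖ ^ 2 ≤ C) :
    ∫⁻ x in P, ∫⁻ y in P, ENNReal.ofReal ((v x - v y) ^ 2) ≤
      ENNReal.ofReal C * (volume P * (2 ^ m * ∫⁻ x in P, ENNReal.ofReal (euclGradSq v x))) := by
  set G : EuclideanSpace ℝ (Fin m) → ENNReal :=
    P.indicator fun x => ENNReal.ofReal (euclGradSq v x) with hGdef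
  have hG : Measurable G := measurable_euclGradSq.ennreal_ofReal.indicator hPm
  have hseg (x : EuclideanSpace ℝ (Fin m)) (hx : x ∈ P) (y : EuclideanSpace ℝ (Fin m))
      (hy : y ∈ P) : ENNReal.ofReal ((v x - v y) ^ 2) ≤
        ENNReal.ofReal C * ∫⁻ t in Set.Ioc (0 : ℝ) 1, G (y + t • (x - y)) := by
    have hxy : ∀ t ∈ Set.Icc (0 : ℝ) 1, y + t • (x - y) ∈ P := fun t ht =>
      hP.add_smul_sub_mem hy hx ht
    have h1 := sq_sub_le_integral_segment hU hv fun t ht => hPU (hxy t ht)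
    have hcont : ContinuousOn (fun t : ℝ => euclGradSq v (y + t • (x - y))) (Set.Icc 0 1) :=
      (continuousOn_euclGradSq hU hv).comp (by fun_prop) fun t ht => hPU (hxy t ht)
    have hint : IntegrableOn (fun t : ℝ => euclGradSq v (y + t • (x - y))) (Set.Ioc 0 1) :=
      hcont.integrableOn_Icc.mono_set Set.Ioc_subset_Icc_self
    have h2 : ∫⁻ t in Set.Ioc (0 : ℝ) 1, G (y + t • (x - y)) =
        ENNReal.ofReal (∫ t in (0 : ℝ)..1, euclGradSq v (y + t • (x - y))) := by
      rw [intervalIntegral.integral_of_le zero_le_one, ofReal_integral_eq_lintegral_ofReal hint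
        (Filter.Eventually.of_forall fun t => euclGradSq_nonneg _)]
      refine setLIntegral_congr_fun measurableSet_Ioc fun t ht => ?_
      simp [hGdef, hxy t (Set.Ioc_subset_Icc_self ht)]
    rw [h2, ← ENNReal.ofReal_mul ((sq_nonneg _).trans (hC x hx y hy))]
    refine ENNReal.ofReal_le_ofReal (h1.trans ?_)
    gcongr
    · exact intervalIntegral.integral_nonneg zero_le_one fun t _ => euclGradSq_nonneg _
    · exact hC x hx y hy
  have hmeas : Measurable fun q : (EuclideanSpace ℝ (Fin m) × ℝ) × EuclideanSpace ℝ (Fin m) =>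
      G (q.2 + q.1.2 • (q.1.1 - q.2)) := hG.comp (by fun_prop)
  calc _ ≤ ∫⁻ x in P, ∫⁻ y in P,
        ENNReal.ofReal C * ∫⁻ t in Set.Ioc (0 : ℝ) 1, G (y + t • (x - y)) :=
        setLIntegral_mono' hPm fun x hx => setLIntegral_mono' hPm fun y hy => hseg x hx y hy
    _ = ENNReal.ofReal C * ∫⁻ x in P, ∫⁻ y in P,
          ∫⁻ t in Set.Ioc (0 : ℝ) 1, G (y + t • (x - y)) := by
        simp_rw [lintegral_const_mul' _ _ ENNReal.ofReal_ne_top]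
    _ = ENNReal.ofReal C * ∫⁻ t in Set.Ioc (0 : ℝ) 1, ∫⁻ x in P, ∫⁻ y in P,
          G (y + t • (x - y)) := by
        congr 1
        rw [← lintegral_lintegral_swap (f := fun x t => ∫⁻ y in P, G (y + t • (x - y)))
          (hmeas.lintegral_prod_right' (ν := volume.restrict P)).aemeasurable]
        refine lintegral_congr fun x => lintegral_lintegral_swap ?_
        exact (hG.comp (by fun_prop : Measurable fun q : EuclideanSpace ℝ (Fin m) × ℝ =>
          q.1 + q.2 • (x - q.1))).aemeasurable
    _ ≤ ENNReal.ofReal C * ∫⁻ _ in Set.Ioc (0 : ℝ) 1, volume P * (2 ^ m * ∫⁻ x, G x) := by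
        gcongr with t
        exact lintegral_lintegral_segment_le hG P t
    _ = _ := by
        rw [setLIntegral_const, Real.volume_Ioc, hGdef, lintegral_indicator hPm]
        simp

/-- The double integral of `(f x - f y)²` is twice the variance of `f`, up to normalisation. -/
theorem integral_integral_sq_sub {X : Type*} [MeasurableSpace X] {μ : Measure X}
    [IsFiniteMeasure μ] {f : X → ℝ} (hf : Integrable f μ) (hf2 : Integrable (fun x => f x ^ 2) μ) :
    ∫⁻ x, ∫⁻ y, ENNReal.ofReal ((f x - f y) ^ 2) ∂μ ∂μ =
      ENNReal.ofReal (2 * μ.real Set.univ * (∫ x, f x ^ 2 ∂μ) - 2 * (∫ x, f x ∂μ) ^ 2) := by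
  have hexp (x : X) : (fun y => (f x - f y) ^ 2) =
      fun y => f x ^ 2 + (f y ^ 2 - 2 * f x * f y) := by
    funext y; ring
  have hin (x : X) : Integrable (fun y => (f x - f y) ^ 2) μ := by
    rw [hexp]
    exact (integrable_const _).add (hf2.sub (hf.const_mul _))
  have hval (x : X) : ∫ y, (f x - f y) ^ 2 ∂μ =
      f x ^ 2 * μ.real Set.univ + ((∫ y, f y ^ 2 ∂μ) - 2 * f x * ∫ y, f y ∂μ) := by
    rw [hexp, integral_add (g := fun y => f y ^ 2 - 2 * f x * f y) (integrable_const _)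
      (hf2.sub (hf.const_mul _)), integral_sub hf2 (hf.const_mul _), integral_const_mul,
      integral_const, smul_eq_mul, mul_comm]
  have hin2 : Integrable (fun x => ∫ y, (f x - f y) ^ 2 ∂μ) μ := by
    simp only [hval]
    exact (hf2.mul_const _).add ((integrable_const _).sub ((hf.const_mul 2).mul_const _))
  simp_rw [← fun x => ofReal_integral_eq_lintegral_ofReal (hin x)
    (Filter.Eventually.of_forall fun y => sq_nonneg (f x - f y))]
  rw [← ofReal_integral_eq_lintegral_ofReal hin2
    (Filter.Eventually.of_forall fun x => integral_nonneg fun y => sq_nonneg _)]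
  congr 1
  simp only [hval]
  rw [integral_add (g := fun x => (∫ y, f y ^ 2 ∂μ) - 2 * f x * ∫ y, f y ∂μ) (hf2.mul_const _)
    ((integrable_const _).sub ((hf.const_mul 2).mul_const _)),
    integral_sub (integrable_const _) ((hf.const_mul 2).mul_const _), integral_mul_const,
    integral_mul_const, integral_const_mul, integral_const, smul_eq_mul]
  ring

/-- The Poincaré inequality on a convex set, obtained by integrating `∇v` along segments. -/
theorem integral_sq_le_of_convex (hP : Convex ℝ P) (hPm : MeasurableSet P) (hU : IsOpen U)
    (hQ : IsCompact Q) (hPQ : P ⊆ Q) (hQU : Q ⊆ U) (hv : ContDiffOn ℝ 1 v U) {C : ℝ}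
    (hC0 : 0 ≤ C) (hC : ∀ x ∈ P, ∀ y ∈ P, ‖x - y‖ ^ 2 ≤ C) :
    ∫ x in P, v x ^ 2 ≤
      (volume.real P)⁻¹ * (∫ x in P, v x) ^ 2 + C * 2 ^ m * ∫ x in P, euclGradSq v x := by
  have hfin : volume P < ⊤ := (measure_mono hPQ).trans_lt hQ.measure_lt_top
  have : IsFiniteMeasure (volume.restrict P) := ⟨by simpa using hfin⟩
  have hvQ : ContinuousOn v Q := hv.continuousOn.mono hQU
  have h1 : IntegrableOn v P := (hvQ.integrableOn_compact hQ).mono_set hPQ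
  have h2 : IntegrableOn (fun x => v x ^ 2) P :=
    ((hvQ.pow 2).integrableOn_compact hQ).mono_set hPQ
  have h3 : IntegrableOn (euclGradSq v) P :=
    (((continuousOn_euclGradSq hU hv).mono hQU).integrableOn_compact hQ).mono_set hPQ
  have hG0 : 0 ≤ ∫ x in P, euclGradSq v x := integral_nonneg fun _ => euclGradSq_nonneg _
  rcases eq_or_ne (volume.real P) 0 with h0 | h0
  · have : volume.restrict P = 0 := by
      rw [Measure.restrict_eq_zero]
      exact ((measureReal_eq_zero_iff hfin.ne).1 h0)
    simp [this]
  have hV : 0 < volume.real P := lt_of_le_of_ne measureReal_nonneg (Ne.symm h0)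
  have key := lintegral_lintegral_sq_sub_le hP hPm hU (hPQ.trans hQU) hv hC
  rw [integral_integral_sq_sub h1 h2, ← ofReal_integral_eq_lintegral_ofReal h3
    (Filter.Eventually.of_forall fun _ => euclGradSq_nonneg _),
    show (2 : ENNReal) ^ m = ENNReal.ofReal (2 ^ m) by
      rw [ENNReal.ofReal_pow (by norm_num)]; simp,
    ← ofReal_measureReal hfin.ne, ← ENNReal.ofReal_mul (by positivity),
    ← ENNReal.ofReal_mul (by positivity), ← ENNReal.ofReal_mul hC0,
    ENNReal.ofReal_le_ofReal_iff (by positivity), measureReal_restrict_apply_univ] at key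
  have hG1 : 0 ≤ C * 2 ^ m * ∫ x in P, euclGradSq v x := by positivity
  have key2 : volume.real P * ∫ x in P, v x ^ 2 ≤
      volume.real P * ((volume.real P)⁻¹ * (∫ x in P, v x) ^ 2 +
        C * 2 ^ m * ∫ x in P, euclGradSq v x) := by
    rw [mul_add, mul_inv_cancel_left₀ h0]
    nlinarith
  exact le_of_mul_le_mul_left key2 hV

/-- The cell with index `z` of the lattice of side `1 / k`. -/
def latticeCell (k : ℝ) (z : Fin m → ℤ) : Set (EuclideanSpace ℝ (Fin m)) :=
  {y | ∀ i, ⌊k * y i⌋ = z i}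

theorem convex_latticeCell (k : ℝ) (z : Fin m → ℤ) : Convex ℝ (latticeCell k z) := by
  intro x hx y hy a b ha hb hab i
  have h1 := Int.floor_eq_iff.1 (hx i)
  have h2 := Int.floor_eq_iff.1 (hy i)
  rw [Int.floor_eq_iff]
  have : k * (a • x + b • y) i = a * (k * x i) + b * (k * y i) := by simp; ring
  rw [this]
  obtain rfl : b = 1 - a := by linarith
  constructor
  · nlinarith
  · rcases ha.eq_or_lt with rfl | ha'
    · simpa using h2.2
    · nlinarith

theorem measurableSet_latticeCell (k : ℝ) (z : Fin m → ℤ) : MeasurableSet (latticeCell k z) := by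
  have : latticeCell k z = ⋂ i, (fun y : EuclideanSpace ℝ (Fin m) => ⌊k * y i⌋) ⁻¹' {z i} := by
    ext y; simp [latticeCell]
  rw [this]
  refine MeasurableSet.iInter fun i => ?_
  have hm : Measurable fun y : EuclideanSpace ℝ (Fin m) => k * y i :=
    (by fun_prop : Continuous fun y : EuclideanSpace ℝ (Fin m) => k * y i).measurable
  exact hm.floor (measurableSet_singleton _)

theorem norm_sub_sq_le_of_mem_latticeCell {k : ℝ} (hk : 0 < k) {z : Fin m → ℤ}
    {x y : EuclideanSpace ℝ (Fin m)} (hx : x ∈ latticeCell k z) (hy : y ∈ latticeCell k z) :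
    ‖x - y‖ ^ 2 ≤ m / k ^ 2 := by
  rw [EuclideanSpace.norm_sq_eq]
  have h (i : Fin m) : ‖(x - y) i‖ ^ 2 ≤ 1 / k ^ 2 := by
    have h1 := Int.floor_eq_iff.1 (hx i)
    have h2 := Int.floor_eq_iff.1 (hy i)
    rw [Real.norm_eq_abs, sq_abs, le_div_iff₀ (by positivity), ← mul_pow]
    have : (x - y) i * k = k * x i - k * y i := by simp; ring
    rw [this, sq_le_one_iff_abs_le_one, abs_le]
    constructor <;> linarith
  calc _ ≤ ∑ _i : Fin m, 1 / k ^ 2 := Finset.sum_le_sum fun i _ => h i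
    _ = _ := by simp; ring

theorem exists_finset_latticeCell_cover {k : ℝ} (hk : 0 < k) (hQ : Bornology.IsBounded Q) :
    ∃ Z : Finset (Fin m → ℤ), Q ⊆ ⋃ z ∈ Z, latticeCell k z := by
  obtain ⟨R, hR⟩ := hQ.exists_norm_le
  refine ⟨Fintype.piFinset fun _ => Finset.Icc ⌊-(k * R)⌋ ⌊k * R⌋, fun y hy => ?_⟩
  refine Set.mem_iUnion₂.2 ⟨fun i => ⌊k * y i⌋, ?_, fun i => rfl⟩
  rw [Fintype.mem_piFinset]
  intro i
  have h1 : |y i| ≤ R := (PiLp.norm_apply_le y i).trans (hR y hy)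
  rw [abs_le] at h1
  rw [Finset.mem_Icc]
  constructor <;> refine Int.floor_mono ?_ <;> nlinarith

/-- Up to an arbitrarily small multiple of the Dirichlet integral, the `L²` norm on a compact
convex set is controlled by finitely many averages. -/
theorem exists_integral_sq_le (hQ : IsCompact Q) (hQc : Convex ℝ Q) (hU : IsOpen U) (hQU : Q ⊆ U)
    {ε : ℝ} (hε : 0 < ε) :
    ∃ (Z : Finset (Fin m → ℤ)) (P : (Fin m → ℤ) → Set (EuclideanSpace ℝ (Fin m))),
      (∀ z, MeasurableSet (P z) ∧ P z ⊆ Q) ∧ ∀ v, ContDiffOn ℝ 1 v U →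
        ∫ x in Q, v x ^ 2 ≤ ε * (∫ x in Q, euclGradSq v x) +
          ∑ z ∈ Z, (volume.real (P z))⁻¹ * (∫ x in P z, v x) ^ 2 := by
  -- the side `1 / k` of the cells makes the constant of the Poincaré inequality at most `ε`
  obtain ⟨k, hk, hkε⟩ : ∃ k : ℝ, 0 < k ∧ m / k ^ 2 * 2 ^ m ≤ ε := by
    refine ⟨1 + (m : ℝ) * 2 ^ m / ε, by positivity, ?_⟩
    set c : ℝ := (m : ℝ) * 2 ^ m / ε with hc
    have hc0 : 0 ≤ c := by positivity
    have h1 : (m : ℝ) * 2 ^ m = ε * c := by rw [hc]; field_simp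
    rw [div_mul_eq_mul_div, h1, div_le_iff₀ (by positivity)]
    exact mul_le_mul_of_nonneg_left (by nlinarith) hε.le
  obtain ⟨Z, hZ⟩ := exists_finset_latticeCell_cover hk hQ.isBounded
  set P : (Fin m → ℤ) → Set (EuclideanSpace ℝ (Fin m)) := fun z => Q ∩ latticeCell k z with hP
  have hPm (z : Fin m → ℤ) : MeasurableSet (P z) :=
    hQ.isClosed.measurableSet.inter (measurableSet_latticeCell k z)
  refine ⟨Z, P, fun z => ⟨hPm z, Set.inter_subset_left⟩, fun v hv => ?_⟩
  have hQP : Q = ⋃ z ∈ Z, P z := by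
    rw [hP, ← Set.inter_iUnion₂]
    exact (Set.inter_eq_left.2 hZ).symm
  have hdisj : (Z : Set (Fin m → ℤ)).Pairwise (Function.onFun Disjoint P) := by
    intro z _ z' _ hzz
    refine Set.disjoint_left.2 fun y hy hy' => hzz (funext fun i => ?_)
    rw [← hy.2 i, hy'.2 i]
  have hvQ : ContinuousOn v Q := hv.continuousOn.mono hQU
  have hsplit {f : EuclideanSpace ℝ (Fin m) → ℝ} (hf : ContinuousOn f Q) :
      ∫ x in Q, f x = ∑ z ∈ Z, ∫ x in P z, f x := by
    conv_lhs => rw [hQP]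
    exact integral_biUnion_finset Z (fun z _ => hPm z) hdisj fun z _ =>
      (hf.integrableOn_compact hQ).mono_set Set.inter_subset_left
  rw [hsplit (f := fun x => v x ^ 2) (hvQ.pow 2),
    hsplit ((continuousOn_euclGradSq hU hv).mono hQU), Finset.mul_sum, ← Finset.sum_add_distrib]
  refine Finset.sum_le_sum fun z _ => ?_
  have := integral_sq_le_of_convex (hQc.inter (convex_latticeCell k z)) (hPm z) hU hQ
    Set.inter_subset_left hQU hv (by positivity)
    fun x hx y hy => norm_sub_sq_le_of_mem_latticeCell hk hx.2 hy.2
  have hG0 : 0 ≤ ∫ x in P z, euclGradSq v x := integral_nonneg fun _ => euclGradSq_nonneg _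
  have := mul_le_mul_of_nonneg_right hkε hG0
  linarith

end Poincare

/-! ### Compact self-adjoint operators and spectral gaps -/

section SpectralGap

variable {V L : Type*} [SeminormedAddCommGroup V] [InnerProductSpace ℝ V] [NormedAddCommGroup L]
  [InnerProductSpace ℝ L]

open scoped InnerProductSpace

/-- A map is precompact if, up to small multiples of the norm of its source, it is controlled by
finitely many linear functionals. -/
theorem totallyBounded_image_closedBall {J : V →L[ℝ] L}
    (hJ : ∀ ε > 0, ∃ (ι : Type) (_ : Fintype ι) (ℓ : ι → V →L[ℝ] ℝ), ∀ u,
      ‖J u‖ ^ 2 ≤ ε * ‖u‖ ^ 2 + ∑ i, ℓ i u ^ 2) :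
    TotallyBounded (J '' Metric.closedBall 0 1) := by
  refine Metric.totallyBounded_iff.2 fun δ hδ => ?_
  -- two points of the unit ball are at distance at most `2`, whence the constant `δ² / 8`
  obtain ⟨ι, _, ℓ, hℓ⟩ := hJ (δ ^ 2 / 8) (by positivity)
  set n := Fintype.card ι
  have hη : 0 < δ / (2 * (n + 1)) := by positivity
  have hbdd : Bornology.IsBounded (ContinuousLinearMap.pi ℓ '' Metric.closedBall 0 1) :=
    (ContinuousLinearMap.pi ℓ).lipschitz.isBounded_image Metric.isBounded_closedBall
  obtain ⟨t, hts, htf, ht⟩ := Metric.finite_approx_of_totallyBounded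
    (hbdd.isCompact_closure.totallyBounded.subset subset_closure) _ hη
  replace hts : ∀ a, a ∈ t → ∃ w, w ∈ Metric.closedBall (0 : V) 1 ∧
    ContinuousLinearMap.pi ℓ w = a := fun a ha => hts ha
  choose! w hw hwt using hts
  refine ⟨(fun a => J (w a)) '' t, htf.image _, ?_⟩
  rintro _ ⟨u, hu, rfl⟩
  obtain ⟨a, hat, ha⟩ := Set.mem_iUnion₂.1 (ht ⟨u, hu, rfl⟩)
  refine Set.mem_iUnion₂.2 ⟨J (w a), ⟨a, hat, rfl⟩, ?_⟩
  have hdist : ‖u - w a‖ ≤ 2 := by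
    have h1 := hw a hat
    rw [mem_closedBall_zero_iff] at hu h1
    exact (norm_sub_le _ _).trans (by linarith)
  have hcoord (i : ι) : ℓ i (u - w a) ^ 2 ≤ (δ / (2 * (n + 1))) ^ 2 := by
    have h1 : |ℓ i u - a i| < δ / (2 * (n + 1)) := (dist_le_pi_dist _ a i).trans_lt ha
    have h2 : a i = ℓ i (w a) := (congrFun (hwt a hat) i).symm
    rw [map_sub, ← h2, ← sq_abs]
    exact pow_le_pow_left₀ (abs_nonneg _) h1.le 2
  have h3 := hℓ (u - w a)
  have h4 : ∑ i, ℓ i (u - w a) ^ 2 ≤ n * (δ / (2 * (n + 1))) ^ 2 := by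
    simpa [n] using Finset.sum_le_sum fun i (_ : i ∈ Finset.univ) => hcoord i
  have h5 : n * (δ / (2 * (n + 1))) ^ 2 ≤ δ ^ 2 / 4 := by
    rw [div_pow, mul_div_assoc', div_le_div_iff₀ (by positivity) (by norm_num)]
    have : (n : ℝ) ≤ (n + 1) ^ 2 := by nlinarith [(Nat.cast_nonneg n : (0 : ℝ) ≤ n)]
    nlinarith [sq_nonneg δ]
  have h6 : ‖u - w a‖ ^ 2 ≤ 4 := by nlinarith [norm_nonneg (u - w a)]
  rw [Metric.mem_ball, dist_eq_norm, ← map_sub]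
  refine lt_of_pow_lt_pow_left₀ 2 hδ.le ?_
  nlinarith [sq_nonneg δ]

variable [CompleteSpace L]

/-- The extension of an operator to the completion of its source. -/
def extendToCompletion (J : V →L[ℝ] L) : UniformSpace.Completion V →L[ℝ] L :=
  J.extend UniformSpace.Completion.toComplL

theorem extendToCompletion_coe (J : V →L[ℝ] L) (u : V) : extendToCompletion J u = J u :=
  ContinuousLinearMap.extend_eq J UniformSpace.Completion.denseRange_coe
    (UniformSpace.Completion.isUniformInducing_coe V) u

theorem norm_extendToCompletion_le {J : V →L[ℝ] L} (hJ : ∀ u, ‖J u‖ ≤ ‖u‖)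
    (x : UniformSpace.Completion V) : ‖extendToCompletion J x‖ ≤ ‖x‖ := by
  refine UniformSpace.Completion.induction_on x
    (isClosed_le (by fun_prop) (by fun_prop)) fun u => ?_
  rw [extendToCompletion_coe, UniformSpace.Completion.norm_coe]
  exact hJ u

theorem isCompactOperator_extendToCompletion {J : V →L[ℝ] L}
    (hJ : TotallyBounded (J '' Metric.closedBall 0 1)) :
    IsCompactOperator (extendToCompletion J) := by
  refine (isCompactOperator_iff_isCompact_closure_image_ball
    (extendToCompletion J : UniformSpace.Completion V →ₗ[ℝ] L) one_pos).2 ?_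
  refine hJ.closure.isCompact_of_isClosed isClosed_closure |>.of_isClosed_subset
    isClosed_closure (closure_minimal ?_ isClosed_closure)
  have hdense : Dense (Set.range ((↑) : V → UniformSpace.Completion V)) :=
    UniformSpace.Completion.denseRange_coe
  have h1 := hdense.open_subset_closure_inter
    (Metric.isOpen_ball (x := (0 : UniformSpace.Completion V)) (ε := 1))
  refine (Set.image_mono h1).trans ((image_closure_subset_closure_image
    (extendToCompletion J).continuous).trans (closure_mono ?_))
  rintro _ ⟨_, ⟨hx, u, rfl⟩, rfl⟩
  refine ⟨u, ?_, (extendToCompletion_coe J u).symm⟩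
  rw [mem_ball_zero_iff, UniformSpace.Completion.norm_coe] at hx
  exact mem_closedBall_zero_iff.2 hx.le

/-- A quadratic form which is diagonal in the eigenvectors of a compact self-adjoint operator is
nonnegative as soon as it is so on eigenvectors. -/
theorem inner_sub_apply_nonneg {T : L →L[ℝ] L} (hT : IsCompactOperator T)
    (hs : (T : L →ₗ[ℝ] L).IsSymmetric) {c : ℝ}
    (hc : ∀ (t : ℝ) (w : L), w ≠ 0 → T w = t • w → 0 ≤ (1 - t) * (1 - c * t)) (h : L) :
    0 ≤ ⟪h - T h, h - c • T h⟫_ℝ := by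
  classical
  set K : Submodule ℝ L := ⨆ μ, Module.End.eigenspace (T : L →ₗ[ℝ] L) μ with hK
  have hdense : K.topologicalClosure = ⊤ := by
    rw [Submodule.topologicalClosure_eq_top_iff]
    exact ContinuousLinearMap.orthogonalComplement_iSup_eigenspaces_eq_bot hT hs
  have hclosed : IsClosed {h : L | 0 ≤ ⟪h - T h, h - c • T h⟫_ℝ} :=
    isClosed_le continuous_const (by fun_prop)
  have hsub : (K : Set L) ⊆ {h : L | 0 ≤ ⟪h - T h, h - c • T h⟫_ℝ} := by
    intro h hh
    obtain ⟨f, hf, rfl⟩ := (Submodule.mem_iSup_iff_exists_finsupp _ _).1 hh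
    have hTf (μ : ℝ) : T (f μ) = μ • f μ := Module.End.mem_eigenspace_iff.1 (hf μ)
    have h1 : (f.sum fun _ x => x) - T (f.sum fun _ x => x) =
        ∑ μ ∈ f.support, (1 - μ) • f μ := by
      rw [Finsupp.sum, map_sum, ← Finset.sum_sub_distrib]
      exact Finset.sum_congr rfl fun μ _ => by rw [hTf, sub_smul, one_smul]
    have h2 : (f.sum fun _ x => x) - c • T (f.sum fun _ x => x) =
        ∑ μ ∈ f.support, (1 - c * μ) • f μ := by
      rw [Finsupp.sum, map_sum, Finset.smul_sum, ← Finset.sum_sub_distrib]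
      exact Finset.sum_congr rfl fun μ _ => by rw [hTf, sub_smul, one_smul, smul_smul]
    have horth {μ ν : ℝ} (hμν : μ ≠ ν) : ⟪f μ, f ν⟫_ℝ = 0 := by
      have := hs (f μ) (f ν)
      simp only [ContinuousLinearMap.coe_coe, hTf, inner_smul_left, inner_smul_right] at this
      have h3 : (μ - ν) * ⟪f μ, f ν⟫_ℝ = 0 := by
        simp only [conj_trivial] at this; linarith
      exact (mul_eq_zero.1 h3).resolve_left (sub_ne_zero.2 hμν)
    change 0 ≤ ⟪_, _⟫_ℝ
    rw [h1, h2, sum_inner]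
    refine Finset.sum_nonneg fun μ hμ => ?_
    rw [inner_sum, Finset.sum_eq_single μ]
    · rw [inner_smul_left, inner_smul_right, real_inner_self_eq_norm_sq, ← mul_assoc]
      exact mul_nonneg (hc μ (f μ) (Finsupp.mem_support_iff.1 hμ) (hTf μ)) (sq_nonneg _)
    · intro ν _ hν
      rw [inner_smul_left, inner_smul_right, horth hν.symm]; simp
    · exact fun hn => absurd hμ hn
  have := hclosed.closure_subset_iff.2 hsub
  have hmem : h ∈ closure (K : Set L) := by
    rw [← Submodule.topologicalClosure_coe, hdense]; trivial
  exact this hmem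

/-- An abstract spectral gap. The relation `∀ φ, ⟪f, φ⟫ = ⟪h, J φ⟫` is the weak form of
`h = (1 + A) f` for the operator `A` whose quadratic form is `‖u‖² - ‖J u‖²`; then `A f = h - J f`.
If `c` is a lower bound of the positive eigenvalues of `A`, then `‖A f‖² ≥ c ⟨A f, f⟩`. -/
theorem inner_sub_nonneg_of_spectral_gap {J : V →L[ℝ] L} (hJ1 : ∀ u, ‖J u‖ ≤ ‖u‖)
    (hJ : ∀ ε > 0, ∃ (ι : Type) (_ : Fintype ι) (ℓ : ι → V →L[ℝ] ℝ), ∀ u,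
      ‖J u‖ ^ 2 ≤ ε * ‖u‖ ^ 2 + ∑ i, ℓ i u ^ 2) {c : ℝ}
    (hc : ∀ (w : L) (μ : ℝ), w ≠ 0 → 0 < μ →
      (∀ (f : V) (h : L), (∀ φ, ⟪f, φ⟫_ℝ = ⟪h, J φ⟫_ℝ) → ⟪w, h⟫_ℝ = (1 + μ) * ⟪w, J f⟫_ℝ) → c ≤ μ)
    {f : V} {h : L} (hfh : ∀ φ, ⟪f, φ⟫_ℝ = ⟪h, J φ⟫_ℝ) :
    0 ≤ ⟪h - J f, h - (1 + c) • J f⟫_ℝ := by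
  set K := extendToCompletion J with hK
  set T : L →L[ℝ] L := K ∘L K.adjoint with hT
  have hTc : IsCompactOperator T :=
    (isCompactOperator_extendToCompletion (totallyBounded_image_closedBall hJ)).comp_clm _
  have hTi (w w' : L) : ⟪T w, w'⟫_ℝ = ⟪K.adjoint w, K.adjoint w'⟫_ℝ := by
    rw [hT, ContinuousLinearMap.comp_apply, ContinuousLinearMap.adjoint_inner_right]
  have hTs : (T : L →ₗ[ℝ] L).IsSymmetric := fun w w' => by
    simp only [ContinuousLinearMap.coe_coe]
    rw [hTi, ← real_inner_comm w, hTi, real_inner_comm]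
  have hTf {f : V} {h : L} (hfh : ∀ φ, ⟪f, φ⟫_ℝ = ⟪h, J φ⟫_ℝ) : T h = J f := by
    have h1 : K.adjoint h = (f : UniformSpace.Completion V) := by
      refine ext_inner_right ℝ fun φ => ?_
      refine UniformSpace.Completion.induction_on φ
        (isClosed_eq (by fun_prop) (by fun_prop)) fun φ => ?_
      rw [ContinuousLinearMap.adjoint_inner_left, UniformSpace.Completion.inner_coe, hfh, hK,
        extendToCompletion_coe]
    rw [hT, ContinuousLinearMap.comp_apply, h1, hK, extendToCompletion_coe]
  -- `T = K K*` is the inverse of `1 + A`: an eigenvalue `t` in `(0, 1)` of `T` corresponds to the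
  -- eigenvalue `1 / t - 1` of `A`
  have key := inner_sub_apply_nonneg hTc hTs (c := 1 + c) (fun t w hw htw => ?_) h
  · rwa [hTf hfh] at key
  have hw0 : 0 < ‖w‖ ^ 2 := by positivity
  have h1 : t * ‖w‖ ^ 2 = ‖K.adjoint w‖ ^ 2 := by
    rw [← real_inner_self_eq_norm_sq, ← real_inner_self_eq_norm_sq, ← hTi, htw,
      inner_smul_left]; simp
  have ht0 : 0 ≤ t := by
    by_contra! ht
    nlinarith [sq_nonneg ‖K.adjoint w‖]
  have hnorm : ‖K.adjoint w‖ ≤ ‖w‖ := by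
    have h2 : ‖K.adjoint‖ ≤ 1 := by
      rw [LinearIsometryEquiv.norm_map]
      exact ContinuousLinearMap.opNorm_le_bound _ zero_le_one fun x => by
        simpa using norm_extendToCompletion_le hJ1 x
    simpa using (K.adjoint.le_opNorm w).trans (mul_le_mul_of_nonneg_right h2 (norm_nonneg w))
  have ht1 : t ≤ 1 := by
    by_contra! ht
    have := pow_le_pow_left₀ (norm_nonneg _) hnorm 2
    nlinarith
  -- for `t = 0` and `t = 1` the product is nonnegative for every `c`
  rcases ht0.eq_or_lt with rfl | ht0
  · simp
  rcases ht1.eq_or_lt with rfl | ht1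
  · simp
  have hμ : 0 < 1 / t - 1 := by
    rw [sub_pos, lt_div_iff₀ ht0]; linarith
  have hle := hc w (1 / t - 1) hw hμ fun f h hfh => by
    have h2 : t * ⟪w, h⟫_ℝ = ⟪w, J f⟫_ℝ := by
      rw [← hTf hfh]
      have := hTs w h
      simp only [ContinuousLinearMap.coe_coe, htw, inner_smul_left] at this
      simpa using this
    rw [← h2]; field_simp; ring
  refine mul_nonneg (by linarith) ?_
  have : (1 + c) * t ≤ (1 + (1 / t - 1)) * t := by gcongr
  have h3 : (1 + (1 / t - 1)) * t = 1 := by field_simp; ring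
  linarith

end SpectralGap

/-! ### The Rellich theorem -/

section Rellich

open MeasureTheory

variable {m : ℕ} {M : Type*} [TopologicalSpace M] [ChartedSpace (EuclideanSpace ℝ (Fin m)) M]
  [IsManifold (𝓡 m) ∞ M] {g : RMetric m M}
  {e : OpenPartialHomeomorph M (EuclideanSpace ℝ (Fin m))} {y : EuclideanSpace ℝ (Fin m)}
  {F : EuclideanSpace ℝ (Fin m) → ℝ} {x : M} {u v w : M → ℝ}

theorem gradDotLoc_self_nonneg (he : e ∈ IsManifold.maximalAtlas (𝓡 m) ∞ M) (hy : y ∈ e.target) :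
    0 ≤ gradDotLoc g e F F y := by
  have := (gramInv_posDef (g := g) he hy).posSemidef.dotProduct_mulVec_nonneg fun i => pd i F y
  refine this.trans_eq ?_
  simp only [dotProduct, Matrix.mulVec, gradDotLoc, Finset.mul_sum]
  refine Finset.sum_congr rfl fun i _ => Finset.sum_congr rfl fun j _ => ?_
  simp; ring

theorem gradSq_nonneg (u : M → ℝ) (x : M) : 0 ≤ gradSq g u x :=
  gradDotLoc_self_nonneg (g := g) (IsManifold.chart_mem_maximalAtlas x)
    (OpenPartialHomeomorph.map_source _ (mem_chart_source _ x))

/-- The largest eigenvalue of `g` is at most its trace. -/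
theorem euclGradSq_le_trace_mul (he : e ∈ IsManifold.maximalAtlas (𝓡 m) ∞ M)
    (hy : y ∈ e.target) :
    euclGradSq F y ≤ (∑ i, gram g e y i i) * gradDotLoc g e F F y := by
  rw [euclGradSq, Finset.sum_mul]
  refine Finset.sum_le_sum fun i _ => ?_
  have h := sq_le_inv_diag_mul (gramInv_posDef (g := g) he hy) (fun i => pd i F y) i
  rw [gramInv, Matrix.nonsing_inv_nonsing_inv _ (gram_det_pos (g := g) he hy).ne'.isUnit] at h
  refine h.trans_eq ?_
  simp only [gradDotLoc, gramInv, mul_assoc]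

theorem gradDot_add_left (hu : ContMDiffAt (𝓡 m) 𝓘(ℝ, ℝ) 1 u x)
    (hv : ContMDiffAt (𝓡 m) 𝓘(ℝ, ℝ) 1 v x) :
    gradDot g (fun z => u z + v z) w x = gradDot g u w x + gradDot g v w x := by
  unfold gradDot
  have h (i : Fin m) : pd i ((fun z => u z + v z) ∘
      (chartAt (EuclideanSpace ℝ (Fin m)) x).symm) (chartAt _ x x) = _ :=
    pd_add (F := u ∘ (chartAt (EuclideanSpace ℝ (Fin m)) x).symm)
      (H := v ∘ (chartAt (EuclideanSpace ℝ (Fin m)) x).symm) i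
      (differentiableAt_chart hu) (differentiableAt_chart hv)
  simp only [h, add_mul, mul_add, Finset.sum_add_distrib]

theorem gradDot_const_mul_left (c : ℝ) (hu : ContMDiffAt (𝓡 m) 𝓘(ℝ, ℝ) 1 u x) :
    gradDot g (fun z => c * u z) w x = c * gradDot g u w x :=
  gradDot_comp_left (φ := fun t => c * t) (by simpa using (hasDerivAt_id (u x)).const_mul c) hu

variable [MeasurableSpace M] [BorelSpace M] [T2Space M] [CompactSpace M]

theorem sq_integral_le_measure_mul {X : Type*} [MeasurableSpace X] {μ : Measure X}
    [IsFiniteMeasure μ] {f : X → ℝ} (hf : Integrable f μ) (hf2 : Integrable (fun x => f x ^ 2) μ) :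
    (∫ x, f x ∂μ) ^ 2 ≤ μ.real Set.univ * ∫ x, f x ^ 2 ∂μ := by
  set I := ∫ x, f x ∂μ with hI
  set V := μ.real Set.univ with hV
  have hV0 : 0 ≤ V := measureReal_nonneg
  rcases hV0.eq_or_lt with h0 | h0
  · have : μ = 0 := by
      rw [← Measure.measure_univ_eq_zero]
      exact (measureReal_eq_zero_iff (measure_ne_top _ _)).1 h0.symm
    simp [hI, this]
  have h1 : 0 ≤ ∫ x, (V * f x - I) ^ 2 ∂μ := integral_nonneg fun _ => sq_nonneg _
  have h2 : ∫ x, (V * f x - I) ^ 2 ∂μ = V ^ 2 * (∫ x, f x ^ 2 ∂μ) - V * I ^ 2 := by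
    have : (fun x => (V * f x - I) ^ 2) =
        fun x => V ^ 2 * f x ^ 2 - (2 * V * I * f x - I ^ 2) := by
      funext x; ring
    rw [this, integral_sub (g := fun x => 2 * V * I * f x - I ^ 2) (hf2.const_mul _)
      ((hf.const_mul _).sub (integrable_const _)),
      integral_sub (hf.const_mul _) (integrable_const _), integral_const_mul, integral_const_mul,
      integral_const, smul_eq_mul, ← hI, ← hV]
    ring
  have h3 : 0 ≤ V * (V * (∫ x, f x ^ 2 ∂μ) - I ^ 2) := by
    rw [h2] at h1; linarith
  have := nonneg_of_mul_nonneg_right h3 h0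
  linarith

theorem gradSq_continuous (hu : ContMDiff (𝓡 m) 𝓘(ℝ, ℝ) 1 u) : Continuous (gradSq g u) :=
  gradDot_continuous hu hu

/-- The space of functions of class `C¹`, to be equipped with the seminorm of `H¹`. The metric is an
argument so that the scalar product can be an instance. Its completion plays the role of `H¹`. -/
def C1Space (_ : RMetric m M) : Type _ := C^1⟮𝓡 m, M; 𝓘(ℝ, ℝ), ℝ⟯

namespace C1Space

instance : AddCommGroup (C1Space g) := inferInstanceAs (AddCommGroup C^1⟮𝓡 m, M; 𝓘(ℝ, ℝ), ℝ⟯)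

instance : Module ℝ (C1Space g) := inferInstanceAs (Module ℝ C^1⟮𝓡 m, M; 𝓘(ℝ, ℝ), ℝ⟯)

/-- The function underlying an element of `C1Space`. -/
def toFun (u : C1Space g) : M → ℝ :=
  DFunLike.coe (F := C^1⟮𝓡 m, M; 𝓘(ℝ, ℝ), ℝ⟯) u

instance : CoeFun (C1Space g) fun _ => M → ℝ := ⟨toFun⟩

/-- A function of class `C¹` as an element of `C1Space`. -/
def mk (u : M → ℝ) (hu : ContMDiff (𝓡 m) 𝓘(ℝ, ℝ) 1 u) : C1Space g :=
  (⟨u, hu⟩ : C^1⟮𝓡 m, M; 𝓘(ℝ, ℝ), ℝ⟯)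

theorem mk_apply (hu : ContMDiff (𝓡 m) 𝓘(ℝ, ℝ) 1 u) (x : M) : (mk u hu : C1Space g) x = u x := rfl

theorem contMDiff (u : C1Space g) : ContMDiff (𝓡 m) 𝓘(ℝ, ℝ) 1 u :=
  ContMDiffMap.contMDiff (I := 𝓡 m) (I' := 𝓘(ℝ, ℝ)) (n := 1) u

theorem continuous (u : C1Space g) : Continuous u := u.contMDiff.continuous

theorem add_apply (u v : C1Space g) (x : M) : (u + v) x = u x + v x := rfl

theorem smul_apply (c : ℝ) (u : C1Space g) (x : M) : (c • u) x = c * u x := rfl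

/-- The scalar product of `H¹`. -/
instance core : PreInnerProductSpace.Core ℝ (C1Space g) where
  inner u v := ∫ x, (u x * v x + gradDot g u v x) ∂(vol g)
  conj_inner_symm u v := by
    simp only [conj_trivial]
    exact integral_congr_ae (Filter.Eventually.of_forall fun x => by
      simp only [gradDot_comm (u := u) (v := v)]; ring)
  re_inner_nonneg u := by
    refine integral_nonneg fun x => ?_
    have := gradSq_nonneg (g := g) u x
    have h2 := mul_self_nonneg (u x)
    exact add_nonneg h2 this
  add_left u v w := by
    have hint (u v : C1Space g) : Integrable (fun x => u x * v x + gradDot g u v x) (vol g) :=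
      integrable_of_continuous ((u.continuous.mul v.continuous).add
        (gradDot_continuous u.contMDiff v.contMDiff))
    rw [← integral_add (hint u w) (hint v w)]
    refine integral_congr_ae (Filter.Eventually.of_forall fun x => ?_)
    have h : gradDot g (u + v : C1Space g) w x = gradDot g u w x + gradDot g v w x :=
      gradDot_add_left (u.contMDiff x) (v.contMDiff x)
    simp only [h, add_apply]; ring
  smul_left u v c := by
    simp only [conj_trivial]
    rw [← integral_const_mul]
    refine integral_congr_ae (Filter.Eventually.of_forall fun x => ?_)
    have h : gradDot g (c • u : C1Space g) v x = c * gradDot g u v x :=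
      gradDot_const_mul_left c (u.contMDiff x)
    simp only [h, smul_apply]; ring

instance : SeminormedAddCommGroup (C1Space g) :=
  InnerProductSpace.Core.toSeminormedAddCommGroup (𝕜 := ℝ)

instance : InnerProductSpace ℝ (C1Space g) := InnerProductSpace.ofCore core

theorem inner_eq (u v : C1Space g) :
    inner ℝ u v = ∫ x, (u x * v x + gradDot g u v x) ∂(vol g) := rfl

theorem integrable_sq (u : C1Space g) : Integrable (fun x => u x ^ 2) (vol g) :=
  integrable_of_continuous (u.continuous.pow 2)

theorem integrable_gradSq (u : C1Space g) : Integrable (gradSq g u) (vol g) :=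
  integrable_of_continuous (gradSq_continuous u.contMDiff)

theorem norm_sq_eq (u : C1Space g) :
    ‖u‖ ^ 2 = (∫ x, u x ^ 2 ∂(vol g)) + ∫ x, gradSq g u x ∂(vol g) := by
  rw [← real_inner_self_eq_norm_sq, inner_eq, ← integral_add u.integrable_sq u.integrable_gradSq]
  simp only [sq, gradSq]

end C1Space

/-- The part of the manifold which is the image of `Q` in the chart at `z`. -/
theorem setIntegral_image_symm (z : M) {Q : Set (EuclideanSpace ℝ (Fin m))} (hQ : IsCompact Q)
    (hQt : Q ⊆ (chartAt (EuclideanSpace ℝ (Fin m)) z).target) {Φ : M → ℝ} (hΦ : Continuous Φ) :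
    ∫ x in (chartAt (EuclideanSpace ℝ (Fin m)) z).symm '' Q, Φ x ∂(vol g) =
      ∫ y in Q, Φ ((chartAt (EuclideanSpace ℝ (Fin m)) z).symm y) *
        volDensity g (chartAt _ z) y := by
  set e := chartAt (EuclideanSpace ℝ (Fin m)) z
  have hA : MeasurableSet (e.symm '' Q) :=
    (hQ.image_of_continuousOn (e.continuousOn_symm.mono hQt)).isClosed.measurableSet
  rw [← integral_indicator hA, integral_vol_eq z (hΦ.aestronglyMeasurable.indicator hA)]
  · have h1 : ∀ y ∈ e.target, (e.symm '' Q).indicator Φ (e.symm y) * volDensity g e y =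
        Q.indicator (fun y => Φ (e.symm y) * volDensity g e y) y := by
      intro y hy
      by_cases hyQ : y ∈ Q
      · simp [hyQ, Set.mem_image_of_mem e.symm hyQ]
      · have : e.symm y ∉ e.symm '' Q := by
          rintro ⟨y', hy', h⟩
          exact hyQ (e.symm.injOn (hQt hy') hy h ▸ hy')
        simp [hyQ, this]
    rw [setIntegral_congr_fun e.open_target.measurableSet h1,
      setIntegral_indicator hQ.isClosed.measurableSet, Set.inter_eq_right.2 hQt]
  · intro x hx
    refine Set.indicator_of_notMem ?_ _
    rintro ⟨y, hy, rfl⟩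
    exact hx (e.map_target (hQt hy))

/-- Comparison of Euclidean and Riemannian quantities in a compact part of a chart. -/
theorem exists_chart_bounds (z : M) {Q : Set (EuclideanSpace ℝ (Fin m))} (hQ : IsCompact Q)
    (hQt : Q ⊆ (chartAt (EuclideanSpace ℝ (Fin m)) z).target) :
    ∃ a b c : ℝ, 0 < a ∧ 0 < b ∧ 0 < c ∧
      (∀ y ∈ Q, a ≤ volDensity g (chartAt _ z) y ∧ volDensity g (chartAt _ z) y ≤ b) ∧
      ∀ u : M → ℝ, ContMDiff (𝓡 m) 𝓘(ℝ, ℝ) 1 u → ∀ y ∈ Q,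
        euclGradSq (u ∘ (chartAt (EuclideanSpace ℝ (Fin m)) z).symm) y ≤
          c * gradSq g u ((chartAt (EuclideanSpace ℝ (Fin m)) z).symm y) := by
  set e := chartAt (EuclideanSpace ℝ (Fin m)) z
  have he : e ∈ IsManifold.maximalAtlas (𝓡 m) ∞ M := IsManifold.chart_mem_maximalAtlas z
  have hρ : ContinuousOn (volDensity g e) Q := (volDensity_continuousOn he).mono hQt
  have htr : ContinuousOn (fun y => ∑ i, gram g e y i i) Q :=
    continuousOn_finsetSum _ fun i _ y hy =>
      (gram_contDiffAt he (hQt hy) i i).continuousAt.continuousWithinAt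
  obtain ⟨c, hc⟩ := hQ.exists_bound_of_continuousOn htr
  obtain ⟨b, hb⟩ := hQ.exists_bound_of_continuousOn hρ
  obtain ⟨a, ha0, ha⟩ : ∃ a, 0 < a ∧ ∀ y ∈ Q, a ≤ volDensity g e y := by
    rcases Q.eq_empty_or_nonempty with rfl | hne
    · exact ⟨1, one_pos, by simp⟩
    · obtain ⟨y₀, hy₀, hmin⟩ := hQ.exists_isMinOn hne hρ
      exact ⟨_, volDensity_pos he (hQt hy₀), fun y hy => hmin hy⟩
  refine ⟨a, max b 1, max c 1, ha0, by positivity, by positivity, fun y hy => ⟨ha y hy,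
    ((le_abs_self _).trans (hb y hy)).trans (le_max_left _ _)⟩, fun u hu y hy => ?_⟩
  refine (euclGradSq_le_trace_mul (g := g) he (hQt hy)).trans ?_
  have h1 : gradSq g u (e.symm y) = gradDotLoc g e (u ∘ e.symm) (u ∘ e.symm) y := by
    rw [gradSq, gradDot_eq_gradDotLoc he (e.map_target (hQt hy)) (hu _) (hu _),
      e.right_inv (hQt hy)]
  rw [h1]
  exact mul_le_mul_of_nonneg_right (((le_abs_self _).trans (hc y hy)).trans (le_max_left _ _))
    (gradDotLoc_self_nonneg he (hQt hy))

/-- A local form of the Rellich theorem: on a neighbourhood of every point, the `L²` norm is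
controlled by finitely many functionals up to a small multiple of the Dirichlet integral. -/
theorem exists_nhds_setIntegral_sq_le (z : M) :
    ∃ A ∈ nhds z, ∀ ε > 0, ∃ (ι : Type) (_ : Fintype ι) (ℓ : ι → C1Space g →L[ℝ] ℝ),
      ∀ u : C1Space g,
      ∫ x in A, u x ^ 2 ∂(vol g) ≤ ε * (∫ x, gradSq g u x ∂(vol g)) + ∑ i, ℓ i u ^ 2 := by
  set e := chartAt (EuclideanSpace ℝ (Fin m)) z with hedef
  have he : e ∈ IsManifold.maximalAtlas (𝓡 m) ∞ M := IsManifold.chart_mem_maximalAtlas z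
  have hz : z ∈ e.source := mem_chart_source _ z
  obtain ⟨r, hr, hrt⟩ := Metric.nhds_basis_closedBall.mem_iff.1
    (e.open_target.mem_nhds (e.map_source hz))
  set Q := Metric.closedBall (e z) r with hQdef
  have hQ : IsCompact Q := isCompact_closedBall _ _
  obtain ⟨a, b, c, ha, hb, hc, hab, hgrad⟩ := exists_chart_bounds (g := g) z hQ hrt
  have hAn : e.symm '' Q ∈ nhds z := by
    have := e.symm.image_mem_nhds (e.map_source hz) (Metric.closedBall_mem_nhds (e z) hr)
    rwa [e.left_inv hz] at this
  have hcomp {Φ : M → ℝ} (hΦ : Continuous Φ) : ContinuousOn (fun y => Φ (e.symm y)) Q :=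
    hΦ.comp_continuousOn (e.continuousOn_symm.mono hrt)
  have hint {Φ : EuclideanSpace ℝ (Fin m) → ℝ} (hΦ : ContinuousOn Φ Q) : IntegrableOn Φ Q :=
    hΦ.integrableOn_compact hQ
  have hρ : ContinuousOn (volDensity g e) Q := (volDensity_continuousOn he).mono hrt
  -- integrals in the chart are controlled by integrals over the manifold
  have hlower {Φ : M → ℝ} (hΦ : Continuous Φ) (hΦ0 : ∀ x, 0 ≤ Φ x) :
      ∫ y in Q, Φ (e.symm y) ≤ a⁻¹ * ∫ x, Φ x ∂(vol g) := by
    rw [le_inv_mul_iff₀ ha, ← integral_const_mul]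
    refine le_trans ?_ (setIntegral_le_integral (s := e.symm '' Q) (integrable_of_continuous hΦ)
      (Filter.Eventually.of_forall hΦ0))
    rw [setIntegral_image_symm z hQ hrt hΦ]
    refine setIntegral_mono_on (hint ((hcomp hΦ).const_mul a)) (hint ((hcomp hΦ).mul hρ))
      hQ.isClosed.measurableSet fun y hy => ?_
    rw [mul_comm]
    exact mul_le_mul_of_nonneg_left (hab y hy).1 (hΦ0 _)
  -- integrals over parts of the chart are continuous functionals on `H¹`
  have hP (P : Set (EuclideanSpace ℝ (Fin m))) (hPm : MeasurableSet P) (hPQ : P ⊆ Q) :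
      ∃ ℓ : C1Space g →L[ℝ] ℝ, ∀ u, ℓ u = ∫ y in P, u (e.symm y) := by
    have hintP (u : C1Space g) : IntegrableOn (fun y => u (e.symm y)) P :=
      (hint (hcomp u.continuous)).mono_set hPQ
    refine ⟨LinearMap.mkContinuous
      { toFun := fun u => ∫ y in P, u (e.symm y)
        map_add' := fun u v => integral_add (hintP u) (hintP v)
        map_smul' := fun k u => integral_const_mul k _ } (√(volume.real Q * a⁻¹)) fun u => ?_,
      fun u => rfl⟩
    change |∫ y in P, u (e.symm y)| ≤ _
    rw [← Real.sqrt_sq (norm_nonneg u), ← Real.sqrt_mul (by positivity)]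
    refine Real.abs_le_sqrt ?_
    have hfin : volume Q < ⊤ := hQ.measure_lt_top
    have : IsFiniteMeasure (volume.restrict P) :=
      ⟨by simpa using (measure_mono hPQ).trans_lt hfin⟩
    have hsqQ := hint (Φ := fun y => u (e.symm y) ^ 2) ((hcomp u.continuous).pow 2)
    refine (sq_integral_le_measure_mul (hintP u) (hsqQ.mono_set hPQ)).trans ?_
    rw [measureReal_restrict_apply_univ, mul_assoc]
    have hu0 : 0 ≤ ∫ x, gradSq g u x ∂(vol g) := integral_nonneg fun x => gradSq_nonneg _ _
    have h1 : ∫ y in P, u (e.symm y) ^ 2 ≤ ∫ y in Q, u (e.symm y) ^ 2 :=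
      setIntegral_mono_set hsqQ (Filter.Eventually.of_forall fun _ => sq_nonneg _)
        (Filter.Eventually.of_forall hPQ)
    have h2 := hlower (u.continuous.pow 2) fun x => sq_nonneg _
    have h3 : (∫ x, u x ^ 2 ∂(vol g)) ≤ ‖u‖ ^ 2 := by rw [u.norm_sq_eq]; linarith
    refine mul_le_mul (measureReal_mono hPQ hfin.ne) (h1.trans (h2.trans ?_))
      (integral_nonneg fun _ => sq_nonneg _) measureReal_nonneg
    exact mul_le_mul_of_nonneg_left h3 (by positivity)
  refine ⟨_, hAn, fun ε hε => ?_⟩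
  -- the constants of the comparison with the Euclidean metric are absorbed into `ε`
  obtain ⟨Z, P, hPQ, hZ⟩ := exists_integral_sq_le hQ (convex_closedBall _ _) e.open_target hrt
    (ε := ε * a / (b * c)) (by positivity)
  choose ℓ hℓ using fun i : Z => hP (P i) (hPQ i).1 (hPQ i).2
  refine ⟨Z, inferInstance, fun i => √(b * (volume.real (P i))⁻¹) • ℓ i, fun u => ?_⟩
  have hv : ContDiffOn ℝ 1 (u ∘ e.symm) e.target := fun y hy =>
    (contDiffAt_comp_symm (by simp) he hy (u.contMDiff _)).contDiffWithinAt
  have h1 : ∫ x in e.symm '' Q, u x ^ 2 ∂(vol g) ≤ b * ∫ y in Q, (u ∘ e.symm) y ^ 2 := by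
    rw [setIntegral_image_symm z hQ hrt (Φ := fun x => u x ^ 2) (u.continuous.pow 2),
      ← integral_const_mul]
    refine setIntegral_mono_on (hint (((hcomp u.continuous).pow 2).mul hρ))
      (hint (((hcomp u.continuous).pow 2).const_mul b)) hQ.isClosed.measurableSet fun y hy => ?_
    rw [mul_comm]
    exact mul_le_mul_of_nonneg_right (hab y hy).2 (sq_nonneg _)
  have h2 : ∫ y in Q, euclGradSq (u ∘ e.symm) y ≤ c * (a⁻¹ * ∫ x, gradSq g u x ∂(vol g)) := by
    refine le_trans ?_ (mul_le_mul_of_nonneg_left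
      (hlower (gradSq_continuous u.contMDiff) (gradSq_nonneg _)) hc.le)
    rw [← integral_const_mul]
    exact setIntegral_mono_on (hint ((continuousOn_euclGradSq e.open_target hv).mono hrt))
      (hint ((hcomp (gradSq_continuous u.contMDiff)).const_mul c))
      hQ.isClosed.measurableSet fun y hy => hgrad u u.contMDiff y hy
  have h3 : ∑ i : Z, ((√(b * (volume.real (P i))⁻¹) • ℓ i) u) ^ 2 =
      b * ∑ i ∈ Z, (volume.real (P i))⁻¹ * (∫ y in P i, (u ∘ e.symm) y) ^ 2 := by
    rw [← Finset.sum_coe_sort Z, Finset.mul_sum]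
    refine Finset.sum_congr rfl fun i _ => ?_
    rw [_root_.smul_apply, hℓ, smul_eq_mul, mul_pow, Real.sq_sqrt (by positivity), mul_assoc]
    rfl
  rw [h3]
  refine h1.trans ((mul_le_mul_of_nonneg_left (hZ _ hv) hb.le).trans ?_)
  rw [mul_add]
  refine add_le_add ?_ le_rfl
  calc b * (ε * a / (b * c) * ∫ y in Q, euclGradSq (u ∘ e.symm) y)
      ≤ b * (ε * a / (b * c) * (c * (a⁻¹ * ∫ x, gradSq g u x ∂(vol g)))) := by gcongr
    _ = _ := by field_simp

/-- The Rellich theorem: the inclusion of `H¹` in `L²` is compact. Compactness is expressed by finitely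
many functionals which control the `L²` norm up to a small multiple of the Dirichlet integral. -/
theorem exists_integral_sq_le_gradSq (g : RMetric m M) (ε : ℝ) (hε : 0 < ε) :
    ∃ (ι : Type) (_ : Fintype ι) (ℓ : ι → C1Space g →L[ℝ] ℝ),
      ∀ u : C1Space g,
      ∫ x, u x ^ 2 ∂(vol g) ≤ ε * (∫ x, gradSq g u x ∂(vol g)) + ∑ i, ℓ i u ^ 2 := by
  have key := isCompact_univ.induction_on (X := M) (p := fun A => ∀ ε > 0,
    ∃ (ι : Type) (_ : Fintype ι) (ℓ : ι → C1Space g →L[ℝ] ℝ),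
      ∀ u : C1Space g,
      ∫ x in A, u x ^ 2 ∂(vol g) ≤ ε * (∫ x, gradSq g u x ∂(vol g)) + ∑ i, ℓ i u ^ 2)
    ?_ ?_ ?_ ?_ ε hε
  · simpa using key
  · intro ε hε
    refine ⟨Empty, inferInstance, fun i => i.elim, fun u => ?_⟩
    have : 0 ≤ ∫ x, gradSq g u x ∂(vol g) := integral_nonneg fun x => gradSq_nonneg _ _
    simpa using mul_nonneg hε.le this
  · intro A B hAB hB ε hε
    obtain ⟨ι, hι, ℓ, h⟩ := hB ε hε
    refine ⟨ι, hι, ℓ, fun u => le_trans ?_ (h u)⟩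
    exact setIntegral_mono_set u.integrable_sq.integrableOn
      (Filter.Eventually.of_forall fun _ => sq_nonneg _) (Filter.Eventually.of_forall hAB)
  · intro A B hA hB ε hε
    obtain ⟨ι, hι, ℓ, h⟩ := hA (ε / 2) (by positivity)
    obtain ⟨ι', hι', ℓ', h'⟩ := hB (ε / 2) (by positivity)
    refine ⟨ι ⊕ ι', inferInstance, Sum.elim ℓ ℓ', fun u => ?_⟩
    have h1 : ∫ x in A ∪ B, u x ^ 2 ∂(vol g) ≤
        (∫ x in A, u x ^ 2 ∂(vol g)) + ∫ x in B, u x ^ 2 ∂(vol g) := by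
      rw [← integral_add_measure u.integrable_sq.integrableOn u.integrable_sq.integrableOn]
      exact integral_mono_measure (Measure.restrict_union_le _ _)
        (Filter.Eventually.of_forall fun _ => sq_nonneg _)
        (Integrable.add_measure u.integrable_sq.integrableOn u.integrable_sq.integrableOn)
    rw [Fintype.sum_sum_type]
    simp only [Sum.elim_inl, Sum.elim_inr]
    linarith [h u, h' u]
  · intro z _
    obtain ⟨A, hA, h⟩ := exists_nhds_setIntegral_sq_le (g := g) z
    exact ⟨A, mem_nhdsWithin_of_mem_nhds hA, h⟩

end Rellich

/-! ### The spectral gap of the Laplace–Beltrami operator -/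

section LaplacianGap

open MeasureTheory

variable {m : ℕ} {M : Type*} [TopologicalSpace M] [ChartedSpace (EuclideanSpace ℝ (Fin m)) M]
  [IsManifold (𝓡 m) ∞ M] {g : RMetric m M} [MeasurableSpace M] [BorelSpace M] [T2Space M]
  [CompactSpace M] {u v : M → ℝ}

theorem memLp_of_continuous (hu : Continuous u) : MemLp u 2 (vol g) :=
  hu.memLp_of_hasCompactSupport (HasCompactSupport.of_compactSpace u)

theorem inner_toLp (hu : MemLp u 2 (vol g)) (hv : MemLp v 2 (vol g)) :
    inner ℝ (hu.toLp u) (hv.toLp v) = ∫ x, u x * v x ∂(vol g) := by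
  rw [L2.inner_def]
  refine integral_congr_ae ?_
  filter_upwards [hu.coeFn_toLp, hv.coeFn_toLp] with x h1 h2
  rw [h1, h2]; simp [mul_comm]

theorem C1Space.memLp (u : C1Space g) : MemLp u 2 (vol g) := memLp_of_continuous u.continuous

theorem C1Space.norm_toLp_sq (u : C1Space g) :
    ‖u.memLp.toLp u‖ ^ 2 = ∫ x, u x ^ 2 ∂(vol g) := by
  rw [← real_inner_self_eq_norm_sq, inner_toLp]
  simp only [sq]

theorem C1Space.norm_toLp_le (u : C1Space g) : ‖u.memLp.toLp u‖ ≤ ‖u‖ := by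
  refine le_of_sq_le_sq ?_ (norm_nonneg _)
  rw [u.norm_toLp_sq, u.norm_sq_eq]
  have : 0 ≤ ∫ x, gradSq g u x ∂(vol g) := integral_nonneg fun x => gradSq_nonneg _ _
  linarith

/-- The inclusion of `C¹` functions, with the norm of `H¹`, in `L²`. -/
def C1Space.toL2 (g : RMetric m M) : C1Space g →L[ℝ] Lp ℝ 2 (vol g) :=
  LinearMap.mkContinuous
    { toFun := fun u => u.memLp.toLp u
      map_add' := fun u v => MemLp.toLp_add u.memLp v.memLp
      map_smul' := fun c u => MemLp.toLp_const_smul c u.memLp } 1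
    fun u => by rw [one_mul]; exact u.norm_toLp_le

theorem C1Space.toL2_apply (u : C1Space g) : C1Space.toL2 g u = u.memLp.toLp u := rfl

/-- A function `f` of class `C²` solves `f - Δf = h` in the weak sense. -/
theorem C1Space.inner_mk_eq {f : M → ℝ} (hf : ContMDiff (𝓡 m) 𝓘(ℝ, ℝ) 2 f)
    (hh : MemLp (fun x => f x - laplacian g f x) 2 (vol g)) (φ : C1Space g) :
    inner ℝ (C1Space.mk f (hf.of_le (by norm_num)) : C1Space g) φ =
      inner ℝ (hh.toLp _) (C1Space.toL2 g φ) := by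
  rw [C1Space.toL2_apply, inner_toLp, C1Space.inner_eq]
  have hf1 : ContMDiff (𝓡 m) 𝓘(ℝ, ℝ) 1 f := hf.of_le (by norm_num)
  have h1 : Integrable (fun x => f x * φ x) (vol g) :=
    integrable_of_continuous (hf.continuous.mul φ.continuous)
  have h2 : Integrable (fun x => φ x * laplacian g f x) (vol g) :=
    integrable_of_continuous (φ.continuous.mul (laplacian_continuous hf))
  have h3 : Integrable (gradDot g f φ) (vol g) :=
    integrable_of_continuous (gradDot_continuous hf1 φ.contMDiff)
  have h4 := integral_gradDot (g := g) φ.contMDiff hf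
  have h5 : ∫ x, gradDot g f φ x ∂(vol g) = ∫ x, gradDot g φ f x ∂(vol g) :=
    integral_congr_ae (Filter.Eventually.of_forall fun x => gradDot_comm)
  change ∫ x, (f x * φ x + gradDot g f φ x) ∂(vol g) = _
  rw [integral_add h1 h3, h5, h4, ← sub_eq_add_neg, ← integral_sub h1 h2]
  exact integral_congr_ae (Filter.Eventually.of_forall fun x => by simp only; ring)

theorem lambdaOne_le {μ : ℝ} (hμ : 0 < μ) (h : IsEigenvalue g μ) : lambdaOne g ≤ μ :=
  csInf_le ⟨0, fun _ h => h.1.le⟩ ⟨hμ, h⟩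

/-- The spectral gap of `-Δ`, in the form `∫ (Δf)² ≥ λ₁ ∫ |∇f|²`. The eigenvectors provided by the
spectral theorem are eigenfunctions in the sense of distributions, as in the definition of `λ₁`, so
that no regularity theory is needed. -/
theorem lambdaOne_mul_integral_gradSq_le {f : M → ℝ} (hf : ContMDiff (𝓡 m) 𝓘(ℝ, ℝ) 2 f) :
    lambdaOne g * ∫ x, gradSq g f x ∂(vol g) ≤ ∫ x, laplacian g f x ^ 2 ∂(vol g) := by
  have hf1 : ContMDiff (𝓡 m) 𝓘(ℝ, ℝ) 1 f := hf.of_le (by norm_num)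
  have hh {f : M → ℝ} (hf : ContMDiff (𝓡 m) 𝓘(ℝ, ℝ) 2 f) :
      MemLp (fun x => f x - laplacian g f x) 2 (vol g) :=
    memLp_of_continuous (hf.continuous.sub (laplacian_continuous hf))
  have hΔ : Continuous (laplacian g f) := laplacian_continuous hf
  have key := inner_sub_nonneg_of_spectral_gap (J := C1Space.toL2 g) (c := lambdaOne g)
    (fun u => u.norm_toLp_le) (fun ε hε => ?_) (fun w μ hw hμ hwμ => ?_)
    (C1Space.inner_mk_eq hf (hh hf))
  · have e1 : (hh hf).toLp _ - C1Space.toL2 g (C1Space.mk f hf1) =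
        (memLp_of_continuous (g := g) hΔ.neg).toLp _ := by
      rw [C1Space.toL2_apply, ← MemLp.toLp_sub]
      refine MemLp.toLp_congr _ _ (Filter.Eventually.of_forall fun x => ?_)
      simp [C1Space.mk_apply]
    have e2 : (hh hf).toLp _ - (1 + lambdaOne g) • C1Space.toL2 g (C1Space.mk f hf1) =
        (memLp_of_continuous (g := g) (hΔ.neg.sub
          (continuous_const (y := lambdaOne g) |>.mul hf.continuous))).toLp _ := by
      rw [C1Space.toL2_apply, ← MemLp.toLp_const_smul, ← MemLp.toLp_sub]
      refine MemLp.toLp_congr _ _ (Filter.Eventually.of_forall fun x => ?_)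
      simp [C1Space.mk_apply]; ring
    rw [e1, e2, inner_toLp] at key
    have h1 : Integrable (fun x => laplacian g f x ^ 2) (vol g) :=
      integrable_of_continuous (hΔ.pow 2)
    have h2 : Integrable (fun x => f x * laplacian g f x) (vol g) :=
      integrable_of_continuous (hf.continuous.mul hΔ)
    have h3 : ∫ x, (-laplacian g f x) * (-laplacian g f x - lambdaOne g * f x) ∂(vol g) =
        (∫ x, laplacian g f x ^ 2 ∂(vol g)) +
          lambdaOne g * ∫ x, f x * laplacian g f x ∂(vol g) := by
      rw [← integral_const_mul, ← integral_add h1 (h2.const_mul _)]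
      exact integral_congr_ae (Filter.Eventually.of_forall fun x => by simp only; ring)
    have h4 : ∫ x, gradSq g f x ∂(vol g) = -∫ x, f x * laplacian g f x ∂(vol g) :=
      integral_gradDot hf1 hf
    have h5 : 0 ≤ ∫ x, (-laplacian g f x) * (-laplacian g f x - lambdaOne g * f x) ∂(vol g) := key
    rw [h3] at h5
    rw [h4]; linarith
  · obtain ⟨ι, hι, ℓ, h⟩ := exists_integral_sq_le_gradSq g ε hε
    refine ⟨ι, hι, ℓ, fun u => ?_⟩
    rw [C1Space.toL2_apply, u.norm_toLp_sq, u.norm_sq_eq]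
    have : 0 ≤ ∫ x, u x ^ 2 ∂(vol g) := integral_nonneg fun x => sq_nonneg _
    nlinarith [h u, mul_nonneg hε.le this]
  · refine lambdaOne_le hμ ⟨w, Lp.memLp w, fun h => hw ((Lp.eq_zero_iff_ae_eq_zero).2 h),
      fun φ hφ => ?_⟩
    -- test the eigenvector `w` with `φ`, which solves `(1 - Δ) φ = φ - Δφ` weakly
    have hφ2 : ContMDiff (𝓡 m) 𝓘(ℝ, ℝ) 2 φ := hφ.of_le two_le_infty
    have hw1 {ψ : M → ℝ} (hψ : MemLp ψ 2 (vol g)) :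
        inner ℝ w (hψ.toLp ψ) = ∫ x, w x * ψ x ∂(vol g) := by
      rw [← inner_toLp (Lp.memLp w) hψ, Lp.toLp_coeFn]
    have hint {ψ : M → ℝ} (hψ : Continuous ψ) : Integrable (fun x => w x * ψ x) (vol g) :=
      (Lp.memLp w).integrable_mul (memLp_of_continuous hψ)
    have h1 := hwμ _ _ (C1Space.inner_mk_eq hφ2 (hh hφ2))
    rw [C1Space.toL2_apply, hw1, hw1] at h1
    have h2 : ∫ x, w x * (φ x - laplacian g φ x) ∂(vol g) =
        (∫ x, w x * φ x ∂(vol g)) + ∫ x, w x * (-laplacian g φ x) ∂(vol g) := by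
      rw [← integral_add (hint hφ.continuous)
        (hint (ψ := fun x => -laplacian g φ x) (laplacian_continuous hφ2).neg)]
      exact integral_congr_ae (Filter.Eventually.of_forall fun x => by simp only; ring)
    rw [h2] at h1
    have h3 : ∫ x, w x * (C1Space.mk φ (hφ2.of_le (by norm_num)) : C1Space g) x ∂(vol g) =
      ∫ x, w x * φ x ∂(vol g) := rfl
    rw [h3] at h1
    linarith

end LaplacianGap

/-! ### Integral identities with the weight `p ^ (1 - n)` -/

section Weighted

open MeasureTheory

variable {m : ℕ} {M : Type*} [TopologicalSpace M] [ChartedSpace (EuclideanSpace ℝ (Fin m)) M]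
  [IsManifold (𝓡 m) ∞ M] {g : RMetric m M} {p v : M → ℝ} {x : M} {n : ℝ}

theorem contMDiff_rpow {k : WithTop ℕ∞} (hp : ContMDiff (𝓡 m) 𝓘(ℝ, ℝ) k p) (h0 : ∀ x, 0 < p x)
    (r : ℝ) : ContMDiff (𝓡 m) 𝓘(ℝ, ℝ) k (fun x => p x ^ r) := fun x =>
  ContMDiffAt.comp (I' := 𝓘(ℝ, ℝ)) (g := fun t : ℝ => t ^ r) x
    (Real.contDiffAt_rpow_const_of_ne (h0 x).ne').contMDiffAt (hp x)

theorem gradDot_rpow_left (hp : ContMDiffAt (𝓡 m) 𝓘(ℝ, ℝ) 1 p x) (h0 : 0 < p x) (r : ℝ) :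
    gradDot g (fun z => p z ^ r) v x = r * p x ^ (r - 1) * gradDot g p v x :=
  gradDot_comp_left (φ := fun t => t ^ r) (Real.hasDerivAt_rpow_const (Or.inl h0.ne')) hp

theorem gradSq_rpow (hp : ContMDiffAt (𝓡 m) 𝓘(ℝ, ℝ) 1 p x) (h0 : 0 < p x) (r : ℝ) :
    gradSq g (fun z => p z ^ r) x = (r * p x ^ (r - 1)) ^ 2 * gradSq g p x := by
  rw [gradSq, gradDot_rpow_left hp h0, gradDot_comm, gradDot_rpow_left hp h0, gradSq]
  ring

theorem laplacian_rpow (hp : ContMDiffAt (𝓡 m) 𝓘(ℝ, ℝ) 2 p x) (h0 : 0 < p x) (r : ℝ) :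
    laplacian g (fun z => p z ^ r) x =
      r * p x ^ (r - 1) * (laplacian g p x + (r - 1) * (gradSq g p x / p x)) := by
  rw [laplacian_comp (φ := fun t => t ^ r) (φ' := fun t => r * t ^ (r - 1))
    (φ'' := r * ((r - 1) * p x ^ (r - 1 - 1))) ?_ ?_ hp, Real.rpow_sub_one h0.ne' (r - 1)]
  · ring
  · filter_upwards [eventually_ne_nhds h0.ne'] with t ht
    exact Real.hasDerivAt_rpow_const (Or.inl ht)
  · exact (Real.hasDerivAt_rpow_const (Or.inl h0.ne')).const_mul r

variable [MeasurableSpace M] [BorelSpace M] [T2Space M] [CompactSpace M]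

/-- The integral `∫ Φ p^r`. -/
def weightedIntegral (g : RMetric m M) (p : M → ℝ) (r : ℝ) (Φ : M → ℝ) : ℝ :=
  ∫ x, Φ x * p x ^ r ∂(vol g)

theorem integrable_mul_rpow (hp : Continuous p) (h0 : ∀ x, 0 < p x) (r : ℝ) {Φ : M → ℝ}
    (hΦ : Continuous Φ) : Integrable (fun x => Φ x * p x ^ r) (vol g) :=
  integrable_of_continuous (hΦ.mul (hp.rpow_const fun x => Or.inl (h0 x).ne'))

theorem laplacian_contMDiff_one (hp : ContMDiff (𝓡 m) 𝓘(ℝ, ℝ) 3 p) :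
    ContMDiff (𝓡 m) 𝓘(ℝ, ℝ) 1 (laplacian g p) := fun x =>
  laplacian_contMDiffAt (k := 1) (l := 3) (by norm_num) (hp x)

theorem gradSq_contMDiff_two (hp : ContMDiff (𝓡 m) 𝓘(ℝ, ℝ) 3 p) :
    ContMDiff (𝓡 m) 𝓘(ℝ, ℝ) 2 (gradSq g p) := fun x =>
  gradSq_contMDiffAt (k := 2) (l := 3) (by norm_num) (hp x)

theorem gammaTwo_continuous (hp : ContMDiff (𝓡 m) 𝓘(ℝ, ℝ) 3 p) : Continuous (gammaTwo g p) :=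
  ((laplacian_continuous (gradSq_contMDiff_two hp)).const_mul _).sub
    (gradDot_continuous (hp.of_le (by norm_num)) (laplacian_contMDiff_one hp))

/-- Green's formula with test function `Φ p^r`. -/
theorem green_rpow (hp : ContMDiff (𝓡 m) 𝓘(ℝ, ℝ) 3 p) (h0 : ∀ x, 0 < p x) {Φ : M → ℝ}
    (hΦ : ContMDiff (𝓡 m) 𝓘(ℝ, ℝ) 1 Φ) (hv : ContMDiff (𝓡 m) 𝓘(ℝ, ℝ) 2 v) (r : ℝ) :
    weightedIntegral g p r (gradDot g Φ v) +
        r * weightedIntegral g p (r - 1) (fun x => Φ x * gradDot g p v x) =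
      -weightedIntegral g p r (fun x => Φ x * laplacian g v x) := by
  have hp1 : ContMDiff (𝓡 m) 𝓘(ℝ, ℝ) 1 p := hp.of_le (by norm_num)
  have hv1 : ContMDiff (𝓡 m) 𝓘(ℝ, ℝ) 1 v := hv.of_le (by norm_num)
  have hw := contMDiff_rpow hp1 h0 r
  have h1 := integral_gradDot (g := g) (hΦ.mul hw) hv
  simp only [weightedIntegral]
  rw [← integral_const_mul, ← integral_add
    (integrable_mul_rpow hp.continuous h0 r (gradDot_continuous hΦ hv1))
    ((integrable_mul_rpow hp.continuous h0 (r - 1) (Φ := fun x => Φ x * gradDot g p v x)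
      (hΦ.continuous.mul (gradDot_continuous hp1 hv1))).const_mul r)]
  refine Eq.trans (integral_congr_ae (Filter.Eventually.of_forall fun x => ?_))
    (h1.trans (congrArg Neg.neg (integral_congr_ae (Filter.Eventually.of_forall fun x => ?_))))
  · have h2 : gradDot g (Φ * fun x => p x ^ r) v x = _ :=
      gradDot_mul_left (w := v) (hΦ x) (hw x)
    rw [h2, gradDot_rpow_left (hp1 x) (h0 x)]
    ring
  · simp only [Pi.mul_apply]; ring

/-- The integrated form of the Bochner formula. -/
theorem weightedIntegral_gammaTwo (hp : ContMDiff (𝓡 m) 𝓘(ℝ, ℝ) 3 p) (h0 : ∀ x, 0 < p x) :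
    weightedIntegral g p (1 - n) (gammaTwo g p) =
      (n - 1) / 2 * weightedIntegral g p (-n) (gradDot g p (gradSq g p)) +
        weightedIntegral g p (1 - n) (fun x => laplacian g p x ^ 2) -
        (n - 1) * weightedIntegral g p (-n) (fun x => laplacian g p x * gradSq g p x) := by
  have hp1 : ContMDiff (𝓡 m) 𝓘(ℝ, ℝ) 1 p := hp.of_le (by norm_num)
  have ha := gradSq_contMDiff_two (g := g) hp
  have hD := laplacian_contMDiff_one (g := g) hp
  have hr : 1 - n - 1 = -n := by ring
  have h1 := green_rpow (g := g) hp h0 (Φ := fun _ => 1) contMDiff_const ha (1 - n)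
  have h2 := green_rpow (g := g) hp h0 hD (hp.of_le (by norm_num)) (1 - n)
  rw [hr] at h1 h2
  have h3 : weightedIntegral g p (1 - n) (gradDot g (fun _ => 1) (gradSq g p)) = 0 := by
    have : gradDot g (fun _ : M => (1 : ℝ)) (gradSq g p) = fun _ => 0 := by
      funext x
      have := gradDot_comp_left (g := g) (φ := fun _ => (1 : ℝ)) (w := gradSq g p)
        (hasDerivAt_const (p x) 1) (hp1 x)
      simpa using this
    simp [weightedIntegral, this]
  have h4 : weightedIntegral g p (1 - n) (gammaTwo g p) =
      1 / 2 * weightedIntegral g p (1 - n) (fun x => 1 * laplacian g (gradSq g p) x) -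
        weightedIntegral g p (1 - n) (gradDot g (laplacian g p) p) := by
    simp only [weightedIntegral]
    rw [← integral_const_mul, ← integral_sub
      ((integrable_mul_rpow hp.continuous h0 (1 - n)
        (Φ := fun x => 1 * laplacian g (gradSq g p) x) (continuous_const.mul (laplacian_continuous ha))).const_mul _)
      (integrable_mul_rpow hp.continuous h0 (1 - n) (gradDot_continuous hD hp1))]
    refine integral_congr_ae (Filter.Eventually.of_forall fun x => ?_)
    simp only [gammaTwo, gradDot_comm (u := p) (v := laplacian g p)]
    ring
  have h5 : weightedIntegral g p (-n) (fun x => laplacian g p x * gradDot g p p x) =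
      weightedIntegral g p (-n) (fun x => laplacian g p x * gradSq g p x) := rfl
  have h6 : weightedIntegral g p (1 - n) (fun x => laplacian g p x * laplacian g p x) =
      weightedIntegral g p (1 - n) (fun x => laplacian g p x ^ 2) := by simp only [sq]
  have h7 : weightedIntegral g p (-n) (fun x => 1 * gradDot g p (gradSq g p) x) =
      weightedIntegral g p (-n) (gradDot g p (gradSq g p)) := by simp only [one_mul]
  rw [h3, h7] at h1
  rw [h5, h6] at h2
  rw [h4]
  linarith

theorem weightedIntegral_gradDot_gradSq (hp : ContMDiff (𝓡 m) 𝓘(ℝ, ℝ) 3 p)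
    (h0 : ∀ x, 0 < p x) :
    weightedIntegral g p (-n) (gradDot g p (gradSq g p)) =
      n * weightedIntegral g p (-n - 1) (fun x => gradSq g p x ^ 2) -
        weightedIntegral g p (-n) (fun x => laplacian g p x * gradSq g p x) := by
  have ha := gradSq_contMDiff_two (g := g) hp
  have h1 := green_rpow (g := g) hp h0 (ha.of_le (by norm_num)) (hp.of_le (by norm_num)) (-n)
  have h2 : weightedIntegral g p (-n) (gradDot g (gradSq g p) p) =
      weightedIntegral g p (-n) (gradDot g p (gradSq g p)) := by
    unfold weightedIntegral; simp only [gradDot_comm (v := p)]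
  have h3 : weightedIntegral g p (-n - 1) (fun x => gradSq g p x * gradDot g p p x) =
      weightedIntegral g p (-n - 1) (fun x => gradSq g p x ^ 2) := by
    simp only [sq]; rfl
  have h4 : weightedIntegral g p (-n) (fun x => gradSq g p x * laplacian g p x) =
      weightedIntegral g p (-n) (fun x => laplacian g p x * gradSq g p x) := by
    simp only [mul_comm]
  rw [h2, h3, h4] at h1
  linarith

theorem rpow_neg_eq_div (h0 : 0 < p x) (n : ℝ) : p x ^ (-n) = p x ^ (1 - n) / p x := by
  rw [show -n = 1 - n - 1 by ring, Real.rpow_sub_one h0.ne']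

theorem rpow_neg_sub_one_eq_div (h0 : 0 < p x) (n : ℝ) :
    p x ^ (-n - 1) = p x ^ (1 - n) / p x ^ 2 := by
  rw [Real.rpow_sub_one h0.ne', rpow_neg_eq_div h0, div_div, sq]

/-- The curvature inequality, integrated against `p ^ (1 - n)` with the tensor
`-(s g + (t / p) dp ⊗ dp)`, where `s` is optimal at every point. -/
theorem kappa_mul_weightedIntegral_le (hm : m ≠ 0) (hp : ContMDiff (𝓡 m) 𝓘(ℝ, ℝ) 3 p)
    (h0 : ∀ x, 0 < p x) (t : ℝ) :
    kappa g * weightedIntegral g p (1 - n) (gradSq g p) ≤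
      weightedIntegral g p (1 - n) (gammaTwo g p) -
        (weightedIntegral g p (1 - n) (fun x => laplacian g p x ^ 2) +
          2 * t * weightedIntegral g p (-n) (fun x => laplacian g p x * gradSq g p x) +
          t ^ 2 * weightedIntegral g p (-n - 1) (fun x => gradSq g p x ^ 2)) / m +
        t ^ 2 * weightedIntegral g p (-n - 1) (fun x => gradSq g p x ^ 2) +
        t * weightedIntegral g p (-n) (gradDot g p (gradSq g p)) := by
  have hp1 : ContMDiff (𝓡 m) 𝓘(ℝ, ℝ) 1 p := hp.of_le (by norm_num)
  have ha := gradSq_contMDiff_two (g := g) hp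
  have ha1 : ContMDiff (𝓡 m) 𝓘(ℝ, ℝ) 1 (gradSq g p) := ha.of_le (by norm_num)
  have hD := laplacian_contMDiff_one (g := g) hp
  have hint (r : ℝ) {Φ : M → ℝ} (hΦ : Continuous Φ) :=
    integrable_mul_rpow (g := g) hp.continuous h0 r hΦ
  have iE := (hint (1 - n) ha.continuous).const_mul (kappa g)
  have iG := hint (1 - n) (gammaTwo_continuous (g := g) hp)
  have iX := hint (1 - n) (Φ := fun x => laplacian g p x ^ 2) (hD.continuous.pow 2)
  have iY := (hint (-n) (Φ := fun x => laplacian g p x * gradSq g p x)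
    (hD.continuous.mul ha.continuous)).const_mul (2 * t)
  have iZ := (hint (-n - 1) (Φ := fun x => gradSq g p x ^ 2) (ha.continuous.pow 2)).const_mul (t ^ 2)
  have iH := (hint (-n) (gradDot_continuous (g := g) hp1 ha1)).const_mul t
  simp only [weightedIntegral, ← integral_const_mul]
  rw [← integral_add' iX iY, ← integral_add' (iX.add iY) iZ, ← integral_div,
    ← integral_sub' iG (((iX.add iY).add iZ).div_const _),
    ← integral_add' (iG.sub (((iX.add iY).add iZ).div_const _)) iZ,
    ← integral_add' ((iG.sub (((iX.add iY).add iZ).div_const _)).add iZ) iH]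
  refine integral_mono iE
    (((iG.sub (((iX.add iY).add iZ).div_const _)).add iZ).add iH) fun x => ?_
  have hpx := h0 x
  have hw : 0 < p x ^ (1 - n) := Real.rpow_pos_of_pos hpx _
  have hmR : (m : ℝ) ≠ 0 := Nat.cast_ne_zero.2 hm
  -- this `s` removes the trace of the shifted Hessian
  have key := kappa_mul_gradSq_le (g := g) (hp x)
    (-(laplacian g p x + t * gradSq g p x / p x) / m) (t / p x)
  have := mul_le_mul_of_nonneg_right key hw.le
  simp only [Pi.add_apply, Pi.sub_apply, rpow_neg_eq_div hpx, rpow_neg_sub_one_eq_div hpx]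
  rw [← mul_assoc]
  refine this.trans_eq ?_
  field_simp
  ring

/-- The spectral gap inequality for the function `p ^ ((3 - n) / 2)`, whose gradient has the squared
length `|∇p|² p ^ (1 - n)` up to a constant. -/
theorem lambdaOne_mul_weightedIntegral_le (hn : n ≠ 3) (hp : ContMDiff (𝓡 m) 𝓘(ℝ, ℝ) 3 p)
    (h0 : ∀ x, 0 < p x) :
    lambdaOne g * weightedIntegral g p (1 - n) (gradSq g p) ≤
      weightedIntegral g p (1 - n) (fun x => laplacian g p x ^ 2) -
        (n - 1) * weightedIntegral g p (-n) (fun x => laplacian g p x * gradSq g p x) +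
        (n - 1) ^ 2 / 4 * weightedIntegral g p (-n - 1) (fun x => gradSq g p x ^ 2) := by
  have hp1 : ContMDiff (𝓡 m) 𝓘(ℝ, ℝ) 1 p := hp.of_le (by norm_num)
  have hp2 : ContMDiff (𝓡 m) 𝓘(ℝ, ℝ) 2 p := hp.of_le (by norm_num)
  have ha := gradSq_contMDiff_two (g := g) hp
  have hD := laplacian_contMDiff_one (g := g) hp
  have hint (r : ℝ) {Φ : M → ℝ} (hΦ : Continuous Φ) :=
    integrable_mul_rpow (g := g) hp.continuous h0 r hΦ
  have iX := hint (1 - n) (Φ := fun x => laplacian g p x ^ 2) (hD.continuous.pow 2)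
  have iY := (hint (-n) (Φ := fun x => laplacian g p x * gradSq g p x)
    (hD.continuous.mul ha.continuous)).const_mul (n - 1)
  have iZ := (hint (-n - 1) (Φ := fun x => gradSq g p x ^ 2)
    (ha.continuous.pow 2)).const_mul ((n - 1) ^ 2 / 4)
  set s : ℝ := (3 - n) / 2 with hs
  have hs0 : 0 < s ^ 2 := by
    have : s ≠ 0 := by rw [hs]; intro h; apply hn; linarith
    positivity
  have key := lambdaOne_mul_integral_gradSq_le (g := g) (contMDiff_rpow hp2 h0 s)
  have hsq (x : M) : (p x ^ (s - 1)) ^ 2 = p x ^ (1 - n) := by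
    rw [← Real.rpow_natCast, ← Real.rpow_mul (h0 x).le]
    congr 1; rw [hs]; push_cast; ring
  have h1 : ∫ x, gradSq g (fun z => p z ^ s) x ∂(vol g) =
      s ^ 2 * weightedIntegral g p (1 - n) (gradSq g p) := by
    unfold weightedIntegral
    rw [← integral_const_mul]
    refine integral_congr_ae (Filter.Eventually.of_forall fun x => ?_)
    simp only [gradSq_rpow (hp1 x) (h0 x), mul_pow, hsq]; ring
  have h2 : ∫ x, laplacian g (fun z => p z ^ s) x ^ 2 ∂(vol g) =
      s ^ 2 * (weightedIntegral g p (1 - n) (fun x => laplacian g p x ^ 2) -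
        (n - 1) * weightedIntegral g p (-n) (fun x => laplacian g p x * gradSq g p x) +
        (n - 1) ^ 2 / 4 * weightedIntegral g p (-n - 1) (fun x => gradSq g p x ^ 2)) := by
    simp only [weightedIntegral, ← integral_const_mul]
    rw [← integral_sub' iX iY, ← integral_add' (iX.sub iY) iZ, ← integral_const_mul]
    refine integral_congr_ae (Filter.Eventually.of_forall fun x => ?_)
    have hpx := h0 x
    simp only [Pi.sub_apply, Pi.add_apply, laplacian_rpow (hp2 x) hpx, mul_pow, hsq, rpow_neg_eq_div hpx,
      rpow_neg_sub_one_eq_div hpx]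
    rw [show s - 1 = -(n - 1) / 2 by rw [hs]; ring]
    field_simp
    ring
  rw [h1, h2] at key
  refine le_of_mul_le_mul_left ?_ hs0
  linarith

/-- The combination of the curvature and the spectral gap inequalities with weights `A` and `B`.
The parameter `t` is chosen so that the integrals of `Δp |∇p|²` cancel. -/
theorem weightedIntegral_gammaTwo_ge (hm : m ≠ 0) (hn : n ≠ 3)
    (hp : ContMDiff (𝓡 m) 𝓘(ℝ, ℝ) 3 p) (h0 : ∀ x, 0 < p x) {A B t : ℝ} (hA : 0 ≤ A)
    (hB : 0 ≤ B) (hAB : A * (1 - 1 / m) + B = 1 - 1 / (n - 1))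
    (ht : A * t * (1 + 2 / m) = 3 / 2 * (n - 1) * (1 - A) - B * (n - 1)) :
    (A * kappa g + B * lambdaOne g) * weightedIntegral g p (1 - n) (gradSq g p) +
        (n * (n - 1) / 2 * (1 - A) - A * t * n - A * t ^ 2 * (1 - 1 / m) - B * (n - 1) ^ 2 / 4) *
          weightedIntegral g p (-n - 1) (fun x => gradSq g p x ^ 2) ≤
      weightedIntegral g p (1 - n) (gammaTwo g p) -
        1 / (n - 1) * weightedIntegral g p (1 - n) (fun x => laplacian g p x ^ 2) := by
  have h1 := weightedIntegral_gammaTwo (g := g) (n := n) hp h0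
  have h2 := weightedIntegral_gradDot_gradSq (g := g) (n := n) hp h0
  have h3 := mul_le_mul_of_nonneg_left
    (kappa_mul_weightedIntegral_le (g := g) (n := n) hm hp h0 t) hA
  have h4 := mul_le_mul_of_nonneg_left (lambdaOne_mul_weightedIntegral_le (g := g) hn hp h0) hB
  rw [h2] at h1 h3
  rw [h1] at h3 ⊢
  set X := weightedIntegral g p (1 - n) (fun x => laplacian g p x ^ 2)
  set Y := weightedIntegral g p (-n) (fun x => laplacian g p x * gradSq g p x)
  set Z := weightedIntegral g p (-n - 1) (fun x => gradSq g p x ^ 2)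
  set E := weightedIntegral g p (1 - n) (gradSq g p)
  have hX : (A * (1 - 1 / m) + B) * X = (1 - 1 / (n - 1)) * X := by rw [hAB]
  have hY : A * t * (1 + 2 / m) * Y = (3 / 2 * (n - 1) * (1 - A) - B * (n - 1)) * Y := by rw [ht]
  have e1 : (X + 2 * t * Y + t ^ 2 * Z) / (m : ℝ) =
      1 / m * X + t * (2 / m) * Y + t ^ 2 * (1 / m) * Z := by ring
  rw [e1] at h3
  linarith

end Weighted

/-! ### The choice of the constants -/

section Constants

variable {d n : ℝ}

/-- The nontrivial factor of the denominator of `θ_⋆` does not vanish. -/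
theorem thetaStar_denominator_pos (hd : 3 ≤ d) (hn : d < n) :
    0 < d * (n ^ 2 - n - 4) - n ^ 2 + 3 * n + 2 := by
  nlinarith [mul_pos (sub_pos.2 hn) (sub_pos.2 hn), mul_nonneg (sub_nonneg.2 hd) (sub_pos.2 hn).le,
    mul_nonneg (mul_nonneg (sub_nonneg.2 hd) (sub_pos.2 hn).le) (sub_pos.2 hn).le,
    mul_nonneg (mul_nonneg (sub_nonneg.2 hd) (sub_pos.2 hn).le) (sub_nonneg.2 hd),
    mul_nonneg (mul_nonneg (sub_nonneg.2 hd) (sub_nonneg.2 hd)) (sub_nonneg.2 hd),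
    mul_nonneg (sub_nonneg.2 hd) (sub_nonneg.2 hd)]

theorem thetaStar_nonpos (hd : 3 ≤ d) (hn : d < n) : thetaStar d n ≤ 0 := by
  refine div_nonpos_of_nonpos_of_nonneg (mul_nonpos_of_nonneg_of_nonpos ?_ ?_) ?_
  · exact mul_nonneg (by linarith) (by linarith)
  · nlinarith [mul_nonneg (sub_nonneg.2 hd) (sub_pos.2 hn).le]
  · exact mul_nonneg (by linarith) (thetaStar_denominator_pos hd hn).le

theorem weight_thetaStar (hd : 3 ≤ d) (hn : d < n) :
    1 + (n - d) / ((d - 1) * (n - 1)) * thetaStar d n * ((d - 1) / (d - 2)) =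
      (d - 1) * (d - 2) * (n + 1) ^ 2 /
        ((d + 1) * (d * (n ^ 2 - n - 4) - n ^ 2 + 3 * n + 2)) := by
  have hN := (thetaStar_denominator_pos hd hn).ne'
  have h1 : d - 1 ≠ 0 := by linarith
  have h2 : d - 2 ≠ 0 := by linarith
  have h3 : n - 1 ≠ 0 := by linarith
  have h4 : d + 1 ≠ 0 := by linarith
  rw [thetaStar]
  generalize hNe : d * (n ^ 2 - n - 4) - n ^ 2 + 3 * n + 2 = N at *
  field_simp
  rw [← hNe]; ring

/-- For every `θ`, the weights of `κ` and `λ₁` in `λ_θ` are such that the integrals of `(Δp)²`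
cancel. -/
theorem weight_add_weight (hd : 3 ≤ d) (hn : d < n) (θ : ℝ) :
    (1 + (n - d) / ((d - 1) * (n - 1)) * θ * ((d - 1) / (d - 2))) * (1 - 1 / (d - 1)) +
      (n - d) / ((d - 1) * (n - 1)) * (1 - θ) = 1 - 1 / (n - 1) := by
  have h1 : d - 1 ≠ 0 := by linarith
  have h2 : d - 2 ≠ 0 := by linarith
  have h3 : n - 1 ≠ 0 := by linarith
  field_simp
  ring

/-- The value `θ_⋆` is the one for which the integral of `|∇p|⁴` disappears. -/
theorem remainder_thetaStar_eq_zero (hd : 3 ≤ d) (hn : d < n) {A B t : ℝ}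
    (hA : A = 1 + (n - d) / ((d - 1) * (n - 1)) * thetaStar d n * ((d - 1) / (d - 2)))
    (hB : B = (n - d) / ((d - 1) * (n - 1)) * (1 - thetaStar d n))
    (ht : A * t * (1 + 2 / (d - 1)) = 3 / 2 * (n - 1) * (1 - A) - B * (n - 1)) :
    n * (n - 1) / 2 * (1 - A) - A * t * n - A * t ^ 2 * (1 - 1 / (d - 1)) -
      B * (n - 1) ^ 2 / 4 = 0 := by
  have hAB := weight_add_weight hd hn (thetaStar d n)
  rw [← hA, ← hB] at hAB
  rw [weight_thetaStar hd hn] at hA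
  have hN := (thetaStar_denominator_pos hd hn)
  have h1 : 0 < d - 1 := by linarith
  have h2 : 0 < d - 2 := by linarith
  have h3 : 0 < n - 1 := by linarith
  have h4 : 0 < d + 1 := by linarith
  have h5 : 0 < n + 1 := by linarith
  generalize hNe : d * (n ^ 2 - n - 4) - n ^ 2 + 3 * n + 2 = N at *
  have hA0 : A ≠ 0 := by rw [hA]; positivity
  have hB' : B = 1 - 1 / (n - 1) - A * (1 - 1 / (d - 1)) := by linarith
  have ht' : t = (3 / 2 * (n - 1) * (1 - A) - B * (n - 1)) / (A * (1 + 2 / (d - 1))) := by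
    have : (1 + 2 / (d - 1)) ≠ 0 := by positivity
    field_simp at ht ⊢
    linarith
  have h6 : d - 1 + 2 ≠ 0 := by linarith
  rw [ht', hB', hA]
  have h7 : 1 + 2 / (d - 1) = (d + 1) / (d - 1) := by field_simp; ring
  rw [h7]
  field_simp
  rw [← hNe]; ring

/-- With `θ = 1`, a positive multiple of the integral of `|∇p|⁴` is left over. -/
theorem remainder_one_pos (hd : 3 ≤ d) (hn : d < n) {A t : ℝ}
    (hA : A = 1 + (n - d) / ((d - 1) * (n - 1)) * 1 * ((d - 1) / (d - 2)))
    (ht : A * t * (1 + 2 / (d - 1)) = 3 / 2 * (n - 1) * (1 - A)) :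
    0 < n * (n - 1) / 2 * (1 - A) - A * t * n - A * t ^ 2 * (1 - 1 / (d - 1)) := by
  have h0 : 0 < n - d := by linarith
  have h1 : 0 < d - 1 := by linarith
  have h2 : 0 < d - 2 := by linarith
  have h3 : 0 < n - 1 := by linarith
  have h4 : 0 < d + 1 := by linarith
  have h5 : 0 < n - 2 := by linarith
  have hA' : A = (d - 1) * (n - 2) / ((n - 1) * (d - 2)) := by
    rw [hA]; field_simp; ring
  have hA0 : A ≠ 0 := by rw [hA']; positivity
  have ht' : t = 3 / 2 * (n - 1) * (1 - A) / (A * ((d + 1) / (d - 1))) := by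
    have h7 : 1 + 2 / (d - 1) = (d + 1) / (d - 1) := by field_simp; ring
    rw [h7] at ht
    field_simp at ht ⊢
    linarith
  have key : n * (n - 1) / 2 * (1 - A) - A * t * n - A * t ^ 2 * (1 - 1 / (d - 1)) =
      (n - d) / (4 * (d + 1) ^ 2 * (n - 2)) *
        (4 * n * (n - 2) * (d + 1) - 9 * (n - 1) * (n - d)) := by
    rw [ht', hA']
    field_simp
    ring
  rw [key]
  refine mul_pos (by positivity) ?_
  nlinarith [mul_nonneg (sub_nonneg.2 hd) h0.le]

end Constants

/-! ### The round sphere in stereographic coordinates -/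

section Sphere

open scoped InnerProductSpace

variable {m : ℕ}

/-- The function `ρ = 1 / (|y|² + 4)`; the conformal factor of the stereographic chart, which in Mathlib
projects from distance two, is `16 ρ²`. -/
def stereoFactor (y : EuclideanSpace ℝ (Fin m)) : ℝ := (‖y‖ ^ 2 + 4)⁻¹

theorem stereoFactor_pos (y : EuclideanSpace ℝ (Fin m)) : 0 < stereoFactor y := by
  unfold stereoFactor; positivity

theorem stereoFactor_zero : stereoFactor (0 : EuclideanSpace ℝ (Fin m)) = 1 / 4 := by
  simp [stereoFactor]

theorem hasFDerivAt_stereoFactor (y : EuclideanSpace ℝ (Fin m)) :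
    HasFDerivAt stereoFactor (-(2 * stereoFactor y ^ 2) • innerSL ℝ y) y := by
  have h1 : HasFDerivAt (fun y : EuclideanSpace ℝ (Fin m) => ‖y‖ ^ 2 + 4) (2 • innerSL ℝ y) y :=
    (hasStrictFDerivAt_norm_sq y).hasFDerivAt.add_const 4
  have h0 : ‖y‖ ^ 2 + 4 ≠ 0 := by positivity
  have h2 := (hasDerivAt_inv h0).comp_hasFDerivAt y h1
  refine h2.congr_fderiv ?_
  ext z
  simp [stereoFactor]
  ring

theorem differentiableAt_stereoFactor (y : EuclideanSpace ℝ (Fin m)) :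
    DifferentiableAt ℝ stereoFactor y := (hasFDerivAt_stereoFactor y).differentiableAt

theorem pd_stereoFactor (i : Fin m) (y : EuclideanSpace ℝ (Fin m)) :
    pd i stereoFactor y = -2 * y i * stereoFactor y ^ 2 := by
  rw [pd, (hasFDerivAt_stereoFactor y).fderiv]
  simp [EuclideanSpace.inner_single_right]
  ring

/-- Near the centre of projection, the inverse stereographic projection is
`y ↦ 4 ρ ι y + (8 ρ - 1) x`, where `ρ = 1 / (|y|² + 4)`, for an isometry `ι` of `ℝ^m` with the orthogonal
complement of `x`. -/
theorem exists_stereographic_chart (x : UnitSphere m) :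
    ∃ ι : EuclideanSpace ℝ (Fin m) →ₗᵢ[ℝ] EuclideanSpace ℝ (Fin (m + 1)),
      (∀ y, ⟪ι y, (x : EuclideanSpace ℝ (Fin (m + 1)))⟫_ℝ = 0) ∧
      (∀ y, ((chartAt (EuclideanSpace ℝ (Fin m)) x).symm y : EuclideanSpace ℝ (Fin (m + 1))) =
        (4 * stereoFactor y) • ι y + (8 * stereoFactor y - 1) • (x : EuclideanSpace ℝ _)) ∧
      (chartAt (EuclideanSpace ℝ (Fin m)) x).target = Set.univ ∧
      chartAt (EuclideanSpace ℝ (Fin m)) x x = 0 := by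
  have hfact : Fact (Module.finrank ℝ (EuclideanSpace ℝ (Fin (m + 1))) = m + 1) := ⟨by simp⟩
  set U := (OrthonormalBasis.fromOrthogonalSpanSingleton (𝕜 := ℝ) m
    (ne_zero_of_mem_unit_sphere (-x))).repr with hU
  set ι : EuclideanSpace ℝ (Fin m) →ₗᵢ[ℝ] EuclideanSpace ℝ (Fin (m + 1)) :=
    (Submodule.subtypeₗᵢ _).comp U.symm.toLinearIsometry with hι
  have htarget : (chartAt (EuclideanSpace ℝ (Fin m)) x).target = Set.univ :=
    stereographic'_target (-x)
  have hsymm (y : EuclideanSpace ℝ (Fin m)) :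
      ((chartAt (EuclideanSpace ℝ (Fin m)) x).symm y : EuclideanSpace ℝ (Fin (m + 1))) =
        (4 * stereoFactor y) • ι y + (8 * stereoFactor y - 1) • (x : EuclideanSpace ℝ _) := by
    -- the preferred chart at `x` projects from the antipodal point `-x`
    have h1 := stereographic'_symm_apply (n := m) (-x) y
    have h2 : ‖((U.symm y : _) : EuclideanSpace ℝ (Fin (m + 1)))‖ = ‖y‖ := by
      rw [← Submodule.coe_norm, U.symm.norm_map]
    refine h1.trans ?_
    dsimp only
    rw [← hU, h2]
    have h0 : ‖y‖ ^ 2 + 4 ≠ 0 := by positivity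
    have h3 : 8 * stereoFactor y - 1 = (‖y‖ ^ 2 + 4)⁻¹ * (4 - ‖y‖ ^ 2) := by
      rw [stereoFactor]; field_simp; ring
    have h4 : ((U.symm y : _) : EuclideanSpace ℝ (Fin (m + 1))) = ι y := rfl
    rw [h3, h4, coe_neg_sphere, stereoFactor]
    module
  refine ⟨ι, fun y => ?_, hsymm, htarget, ?_⟩
  · have := (U.symm y).2
    rw [Submodule.mem_orthogonal_singleton_iff_inner_left] at this
    have h5 : ⟪((U.symm y : _) : EuclideanSpace ℝ (Fin (m + 1))), (x : EuclideanSpace ℝ _)⟫_ℝ = 0 := by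
      simpa [inner_neg_right] using this
    exact h5
  · have h0 : (chartAt (EuclideanSpace ℝ (Fin m)) x).symm 0 = x := by
      ext1
      rw [hsymm]
      rw [stereoFactor_zero, map_zero, smul_zero, zero_add]
      norm_num
    have h1 := (chartAt (EuclideanSpace ℝ (Fin m)) x).right_inv
      (htarget ▸ Set.mem_univ (0 : EuclideanSpace ℝ (Fin m)))
    rwa [h0] at h1

/-- The round metric is conformal to the Euclidean one in stereographic coordinates. -/
theorem gram_round (x : UnitSphere m) (y : EuclideanSpace ℝ (Fin m)) (i j : Fin m) :
    gram (roundMetric m) (chartAt _ x) y i j = if i = j then 16 * stereoFactor y ^ 2 else 0 := by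
  obtain ⟨ι, hιx, hsymm, htarget, -⟩ := exists_stereographic_chart x
  set e := chartAt (EuclideanSpace ℝ (Fin m)) x
  have hfact : Fact (Module.finrank ℝ (EuclideanSpace ℝ (Fin (m + 1))) = m + 1) := ⟨by simp⟩
  have he : e ∈ IsManifold.maximalAtlas (𝓡 m) ∞ (UnitSphere m) :=
    IsManifold.chart_mem_maximalAtlas x
  have hy : y ∈ e.target := by rw [htarget]; trivial
  set X : EuclideanSpace ℝ (Fin (m + 1)) := (x : EuclideanSpace ℝ (Fin (m + 1))) with hX
  have hfun : (fun y => ((e.symm y : UnitSphere m) : EuclideanSpace ℝ (Fin (m + 1)))) =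
      fun y => (4 * stereoFactor y) • ι y + (8 * stereoFactor y - 1) • X :=
    funext hsymm
  have hder (i : Fin m) : sphereDeriv m (e.symm y) (coordVec e y i) =
      (4 * stereoFactor y) • ι (EuclideanSpace.single i 1) -
        (8 * y i * stereoFactor y ^ 2) • ι y - (16 * y i * stereoFactor y ^ 2) • X := by
    have h1 : MDifferentiableAt (𝓡 m) 𝓘(ℝ, EuclideanSpace ℝ (Fin (m + 1)))
        (fun y : UnitSphere m => (y : EuclideanSpace ℝ (Fin (m + 1)))) (e.symm y) :=
      (contMDiff_coe_sphere (m := 1) (n := m)).mdifferentiable (by simp) _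
    have h2 : MDifferentiableAt (𝓡 m) (𝓡 m) e.symm y :=
      (mdifferentiable_of_mem_maximalAtlas he).mdifferentiableAt_symm hy
    have h3 : sphereDeriv m (e.symm y) (coordVec e y i) =
        fderiv ℝ (fun y => ((e.symm y : UnitSphere m) : EuclideanSpace ℝ (Fin (m + 1)))) y
          (EuclideanSpace.single i 1) := by
      have h4 := mfderiv_comp y h1 h2
      rw [← mfderiv_eq_fderiv]
      exact (congrArg (fun L => L (EuclideanSpace.single i (1 : ℝ))) h4).symm
    have h5 := (((hasFDerivAt_stereoFactor y).const_mul 4).smul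
      ι.toContinuousLinearMap.hasFDerivAt).add
        ((((hasFDerivAt_stereoFactor y).const_mul 8).sub_const 1).smul_const X)
    have h6 : HasFDerivAt (fun y => (4 * stereoFactor y) • ι y + (8 * stereoFactor y - 1) • X)
      _ y := h5
    rw [h3, hfun, h6.fderiv]
    simp [EuclideanSpace.inner_single_right]
    module
  have hXX : ⟪X, X⟫_ℝ = 1 := by
    rw [real_inner_self_eq_norm_sq, hX, norm_eq_of_mem_sphere]; norm_num
  have hιX (y : EuclideanSpace ℝ (Fin m)) : ⟪X, ι y⟫_ℝ = 0 := by rw [real_inner_comm, hιx]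
  have hq : ‖y‖ ^ 2 * stereoFactor y = 1 - 4 * stereoFactor y := by
    have h0 : ‖y‖ ^ 2 + 4 ≠ 0 := by positivity
    rw [stereoFactor]; field_simp; ring
  have hgram : gram (roundMetric m) e y i j =
      ⟪sphereDeriv m (e.symm y) (coordVec e y i), sphereDeriv m (e.symm y) (coordVec e y j)⟫_ℝ :=
    rfl
  rw [hgram, hder, hder]
  simp only [inner_sub_left, inner_sub_right, inner_smul_left, inner_smul_right,
    LinearIsometry.inner_map_map, hιx, hιX, hXX, EuclideanSpace.inner_single_left,
    EuclideanSpace.inner_single_right, real_inner_self_eq_norm_sq, conj_trivial]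
  have h7 : (EuclideanSpace.single i (1 : ℝ)) j = if i = j then 1 else 0 := by simp [eq_comm]
  rw [h7]
  split_ifs <;> linear_combination (64 * y i * y j * stereoFactor y ^ 3) * hq

end Sphere

/-! ### The Ricci curvature and the spectral gap of the round sphere -/

section Sphere

open scoped InnerProductSpace
open MeasureTheory

variable {m : ℕ}

instance : Nonempty (UnitSphere m) := ⟨⟨EuclideanSpace.single 0 1, by simp⟩⟩

theorem gramInv_round (x : UnitSphere m) (y : EuclideanSpace ℝ (Fin m)) (i j : Fin m) :
    gramInv (roundMetric m) (chartAt _ x) y i j =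
      if i = j then (16 * stereoFactor y ^ 2)⁻¹ else 0 := by
  have h0 : 16 * stereoFactor y ^ 2 ≠ 0 := by have := stereoFactor_pos y; positivity
  have h1 : gram (roundMetric m) (chartAt (EuclideanSpace ℝ (Fin m)) x) y =
      (16 * stereoFactor y ^ 2) • (1 : Matrix (Fin m) (Fin m) ℝ) := by
    ext i j
    simp [gram_round, Matrix.one_apply]
  have h2 : gramInv (roundMetric m) (chartAt (EuclideanSpace ℝ (Fin m)) x) y =
      (16 * stereoFactor y ^ 2)⁻¹ • (1 : Matrix (Fin m) (Fin m) ℝ) := by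
    rw [gramInv, h1]
    refine Matrix.inv_eq_left_inv ?_
    rw [smul_mul_smul_comm, inv_mul_cancel₀ h0, one_mul, one_smul]
  rw [h2]
  simp [Matrix.one_apply]

theorem pd_gram_round (x : UnitSphere m) (y : EuclideanSpace ℝ (Fin m)) (i j l : Fin m) :
    pd l (fun z => gram (roundMetric m) (chartAt _ x) z i j) y =
      if i = j then -64 * y l * stereoFactor y ^ 3 else 0 := by
  have h : (fun z => gram (roundMetric m) (chartAt (EuclideanSpace ℝ (Fin m)) x) z i j) =
      fun z => (if i = j then (16 : ℝ) else 0) * (stereoFactor z * stereoFactor z) := by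
    funext z
    rw [gram_round]
    split_ifs <;> ring
  have hd := differentiableAt_stereoFactor y
  rw [h, pd_const_mul l _ (hd.fun_mul hd), pd_mul l hd hd, pd_stereoFactor]
  split_ifs <;> ring

theorem christoffel_round (x : UnitSphere m) (y : EuclideanSpace ℝ (Fin m)) (k i j : Fin m) :
    christoffel (roundMetric m) (chartAt _ x) k i j y =
      (-2 * stereoFactor y) * ((if j = k then 1 else 0) * y i + (if i = k then 1 else 0) * y j -
        (if i = j then 1 else 0) * y k) := by
  have h0 : stereoFactor y ≠ 0 := (stereoFactor_pos y).ne'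
  rw [christoffel]
  simp only [gramInv_round, pd_gram_round, ite_mul, zero_mul, Finset.sum_ite_eq, Finset.mem_univ,
    if_true]
  split_ifs <;> field_simp <;> ring

theorem christoffel_round_zero (x : UnitSphere m) (k i j : Fin m) :
    christoffel (roundMetric m) (chartAt _ x) k i j 0 = 0 := by
  simp [christoffel_round]

theorem pd_christoffel_round_zero (x : UnitSphere m) (k i j l : Fin m) :
    pd l (christoffel (roundMetric m) (chartAt _ x) k i j) 0 =
      -(1 / 2) * ((if j = k then 1 else 0) * (if l = i then 1 else 0) +
        (if i = k then 1 else 0) * (if l = j then 1 else 0) -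
        (if i = j then 1 else 0) * (if l = k then 1 else 0)) := by
  have hl (a : ℝ) (i : Fin m) : DifferentiableAt ℝ
      (fun z : EuclideanSpace ℝ (Fin m) => a * z i) 0 :=
    (differentiableAt_coord i).const_mul a
  rw [funext (christoffel_round x · k i j),
    pd_mul l ((differentiableAt_stereoFactor 0).const_mul (-2))
      (((hl _ _).fun_add (hl _ _)).fun_sub (hl _ _)),
    pd_sub l ((hl _ _).fun_add (hl _ _)) (hl _ _), pd_add l (hl _ _) (hl _ _),
    pd_const_mul l _ (differentiableAt_coord _), pd_const_mul l _ (differentiableAt_coord _),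
    pd_const_mul l _ (differentiableAt_coord _), pd_coord, pd_coord, pd_coord, stereoFactor_zero]
  simp only [PiLp.zero_apply]
  ring

theorem ricciCoord_round_zero (x : UnitSphere m) (i j : Fin m) :
    ricciCoord (roundMetric m) (chartAt _ x) i j 0 = if i = j then (m : ℝ) - 1 else 0 := by
  rw [ricciCoord]
  simp only [christoffel_round_zero, mul_zero, Finset.sum_const_zero, add_zero, sub_zero,
    pd_christoffel_round_zero, ← Finset.mul_sum, Finset.sum_add_distrib, Finset.sum_sub_distrib,
    mul_ite, mul_one, ite_true, Finset.sum_ite_eq, Finset.sum_ite_eq', Finset.mem_univ,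
    Finset.sum_const, Finset.card_univ, Fintype.card_fin, nsmul_eq_mul]
  by_cases h : i = j
  · subst h
    simp
    ring
  · simp [h, Ne.symm h]

theorem chartAt_self_sphere (x : UnitSphere m) : chartAt (EuclideanSpace ℝ (Fin m)) x x = 0 := by
  obtain ⟨-, -, -, -, h⟩ := exists_stereographic_chart x
  exact h

/-- The round metric is an Einstein metric. It suffices to compute at the centre of each chart, where
the Christoffel symbols vanish. -/
theorem ricci_round (x : UnitSphere m) (v : TangentSpace (𝓡 m) x) :
    ricci (roundMetric m) x v v = ((m : ℝ) - 1) * (roundMetric m).inner x v v := by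
  rw [inner_eq_sum_gram, ricci, chartAt_self_sphere]
  simp only [ricciCoord_round_zero, gram_round, stereoFactor_zero, ite_mul, zero_mul,
    Finset.sum_ite_eq, Finset.mem_univ, if_true, Finset.mul_sum]
  exact Finset.sum_congr rfl fun i _ => by ring

theorem le_kappa_round (hm : 0 < m) : (m : ℝ) - 1 ≤ kappa (roundMetric m) := by
  refine le_csInf ?_ ?_
  · obtain ⟨x⟩ : Nonempty (UnitSphere m) := inferInstance
    obtain ⟨v, hv⟩ := vecCoord_surjective x (Pi.single (⟨0, hm⟩ : Fin m) (1 : ℝ))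
    refine ⟨_, x, v, ?_, rfl⟩
    rw [inner_eq_sum_gram, chartAt_self_sphere]
    simp only [gram_round, hv, stereoFactor_zero, Pi.single_apply]
    simp
    norm_num
  · rintro r ⟨x, v, hv, rfl⟩
    rw [ricci_round, hv, mul_one]

/-- The restrictions to the sphere of linear functions are eigenfunctions of the Laplace-Beltrami
operator. -/
theorem laplacian_round_inner (a : EuclideanSpace ℝ (Fin (m + 1))) (x : UnitSphere m) :
    laplacian (roundMetric m) (fun z => ⟪a, (z : EuclideanSpace ℝ (Fin (m + 1)))⟫_ℝ) x =
      -(m * ⟪a, (x : EuclideanSpace ℝ (Fin (m + 1)))⟫_ℝ) := by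
  obtain ⟨ι, -, hsymm, -, h0⟩ := exists_stereographic_chart x
  rw [laplacian, h0]
  set b := ⟪a, (x : EuclideanSpace ℝ (Fin (m + 1)))⟫_ℝ with hb
  set L : EuclideanSpace ℝ (Fin m) →L[ℝ] ℝ := (innerSL ℝ a).comp ι.toContinuousLinearMap with hL
  have hu : (fun z : UnitSphere m => ⟪a, (z : EuclideanSpace ℝ (Fin (m + 1)))⟫_ℝ) ∘
      (chartAt (EuclideanSpace ℝ (Fin m)) x).symm =
      fun y => stereoFactor y * (4 * L y + 8 * b) + -b := by
    funext y
    simp only [Function.comp_apply, hsymm, inner_add_right, inner_smul_right, hL,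
      ContinuousLinearMap.comp_apply, innerSL_apply_apply, ← hb]
    change _ = stereoFactor y * (4 * ⟪a, ι y⟫_ℝ + 8 * b) + -b
    ring
  have hρ (y : EuclideanSpace ℝ (Fin m)) := differentiableAt_stereoFactor y
  have hA (y : EuclideanSpace ℝ (Fin m)) : DifferentiableAt ℝ (fun y => 4 * L y + 8 * b) y :=
    (L.differentiableAt.const_mul 4).add_const _
  have hpL (i : Fin m) (y : EuclideanSpace ℝ (Fin m)) :
      pd i (fun y => 4 * L y + 8 * b) y = 4 * L (EuclideanSpace.single i 1) := by
    rw [pd_add i (L.differentiableAt.const_mul 4) (differentiableAt_const _), pd_const,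
      pd_const_mul i _ L.differentiableAt, add_zero, pd, L.fderiv]
  -- written as `y_i` times a function, so that the second derivative at the origin is immediate
  have hp (i : Fin m) : pd i (fun y => stereoFactor y * (4 * L y + 8 * b) + -b) = fun y =>
      y i * (-2 * (stereoFactor y * stereoFactor y) * (4 * L y + 8 * b)) +
        (4 * L (EuclideanSpace.single i 1)) * stereoFactor y := by
    funext y
    rw [pd_add i ((hρ y).fun_mul (hA y)) (differentiableAt_const _), pd_const, pd_mul i (hρ y) (hA y),
      hpL, pd_stereoFactor]
    ring
  have hpp (i : Fin m) : pd i (pd i (fun y => stereoFactor y * (4 * L y + 8 * b) + -b)) 0 = -b := by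
    have hq : DifferentiableAt ℝ (fun y : EuclideanSpace ℝ (Fin m) =>
        -2 * (stereoFactor y * stereoFactor y) * (4 * L y + 8 * b)) 0 :=
      (((hρ 0).fun_mul (hρ 0)).const_mul (-2)).fun_mul (hA 0)
    rw [hp, pd_add i ((differentiableAt_coord i).fun_mul hq) ((hρ 0).const_mul _),
      pd_mul i (differentiableAt_coord i) hq, pd_coord, pd_const_mul i _ (hρ 0), pd_stereoFactor,
      stereoFactor_zero, map_zero]
    simp
    ring
  simp only [gramInv_round, hessianCoord, hu, christoffel_round_zero, stereoFactor_zero, zero_mul,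
    Finset.sum_const_zero, sub_zero, ite_mul, Finset.sum_ite_eq, Finset.mem_univ, if_true, hpp]
  simp
  norm_num

/-- The total volume of a nonempty compact manifold is positive. -/
theorem vol_ne_zero {M : Type*} [TopologicalSpace M] [ChartedSpace (EuclideanSpace ℝ (Fin m)) M]
    [IsManifold (𝓡 m) ∞ M] [MeasurableSpace M] [BorelSpace M] [CompactSpace M] [Nonempty M]
    (g : RMetric m M) : vol g ≠ 0 := by
  intro h
  obtain ⟨z⟩ := ‹Nonempty M›
  set e := chartAt (EuclideanSpace ℝ (Fin m)) z with he
  have he' : e ∈ IsManifold.maximalAtlas (𝓡 m) ∞ M := IsManifold.chart_mem_maximalAtlas z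
  have hs : MeasurableSet e.source := e.open_source.measurableSet
  have h1 := vol_apply_of_subset (g := g) z hs subset_rfl
  have h3 : e.target ∩ e.symm ⁻¹' e.source = e.target :=
    Set.inter_eq_left.2 fun y hy => e.map_target hy
  rw [h, Measure.coe_zero, Pi.zero_apply, ← he, chartVolume_apply g e hs, h3, eq_comm,
    setLIntegral_eq_zero_iff' e.open_target.measurableSet
      (((volDensity_continuousOn he').aemeasurable e.open_target.measurableSet).ennreal_ofReal)] at h1
  have h2 : volume e.target = 0 := by
    refine measure_mono_null ?_ (ae_iff.1 h1)
    intro y hy hy'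
    exact (ENNReal.ofReal_pos.2 (volDensity_pos (g := g) he' hy)).ne' (hy' hy)
  exact (e.open_target.measure_pos volume ⟨e z, e.map_source (mem_chart_source _ z)⟩).ne' h2

/-- One of the coordinates of `ℝ^{m+1}` is an eigenfunction, as they do not all vanish at a point of the
sphere. -/
theorem isEigenvalue_round (m : ℕ) : IsEigenvalue (roundMetric m) m := by
  have hfact : Fact (Module.finrank ℝ (EuclideanSpace ℝ (Fin (m + 1))) = m + 1) := ⟨by simp⟩
  have hsm (a : EuclideanSpace ℝ (Fin (m + 1))) : ContMDiff (𝓡 m) 𝓘(ℝ, ℝ) ∞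
      (fun z : UnitSphere m => ⟪a, (z : EuclideanSpace ℝ (Fin (m + 1)))⟫_ℝ) :=
    (innerSL ℝ a).contMDiff.comp (contMDiff_coe_sphere (m := ∞) (n := m))
  obtain ⟨i, hi⟩ : ∃ i, ¬ (fun z : UnitSphere m =>
      ⟪EuclideanSpace.single i (1 : ℝ), (z : EuclideanSpace ℝ (Fin (m + 1)))⟫_ℝ)
        =ᵐ[vol (roundMetric m)] 0 := by
    by_contra! hcon
    refine vol_ne_zero (roundMetric m) (ae_eq_bot.1 (Filter.eventually_false_iff_eq_bot.1 ?_))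
    filter_upwards [ae_all_iff.2 hcon] with x hx
    refine ne_zero_of_mem_unit_sphere x ?_
    ext i
    simpa [EuclideanSpace.inner_single_left] using hx i
  refine ⟨_, memLp_of_continuous (hsm _).continuous, hi, fun φ hφ => ?_⟩
  set u := fun z : UnitSphere m =>
      ⟪EuclideanSpace.single i (1 : ℝ), (z : EuclideanSpace ℝ (Fin (m + 1)))⟫_ℝ with hu
  have h1 := integral_gradDot (g := roundMetric m) ((hsm (EuclideanSpace.single i 1)).of_le
    (by simp)) (hφ.of_le two_le_infty)
  have h2 := integral_gradDot (g := roundMetric m) (hφ.of_le (by simp))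
    ((hsm (EuclideanSpace.single i 1)).of_le two_le_infty)
  have h3 : gradDot (roundMetric m) φ u = gradDot (roundMetric m) u φ :=
    funext fun x => gradDot_comm
  simp only [laplacian_round_inner] at h2
  simp only [mul_neg, integral_neg] at h2 ⊢
  rw [← h1, ← integral_const_mul]
  change ∫ x, gradDot (roundMetric m) φ u x ∂_ = _ at h2
  rw [h3, neg_neg] at h2
  rw [h2]
  exact integral_congr_ae (.of_forall fun x => by ring)

theorem lambdaOne_round_le (hm : 0 < m) : lambdaOne (roundMetric m) ≤ m :=
  lambdaOne_le (Nat.cast_pos.2 hm) (isEigenvalue_round m)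

end Sphere

/-! ### The integral inequality -/

section Inequality

open MeasureTheory

variable {m : ℕ}

section General

variable {M : Type*} [TopologicalSpace M] [ChartedSpace (EuclideanSpace ℝ (Fin m)) M]
  [IsManifold (𝓡 m) ∞ M] {g : RMetric m M} [MeasurableSpace M] [BorelSpace M] [T2Space M]
  [CompactSpace M] {p : M → ℝ} {n : ℝ}

theorem weightedIntegral_kM (hp : ContMDiff (𝓡 m) 𝓘(ℝ, ℝ) 3 p) (h0 : ∀ x, 0 < p x) (n α : ℝ) :
    weightedIntegral g p (1 - n) (kM g n α p) =
      weightedIntegral g p (1 - n) (gammaTwo g p) -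
        1 / (n - 1) * weightedIntegral g p (1 - n) (fun x => laplacian g p x ^ 2) -
        (n - 2) * α ^ 2 * weightedIntegral g p (1 - n) (gradSq g p) := by
  have hi {Φ : M → ℝ} (hΦ : Continuous Φ) :=
    integrable_mul_rpow (g := g) hp.continuous h0 (1 - n) hΦ
  have h1 := hi (gammaTwo_continuous (g := g) hp)
  have h2 := (hi (Φ := fun x => laplacian g p x ^ 2)
    ((laplacian_contMDiff_one hp).continuous.pow 2)).const_mul (1 / (n - 1))
  have h3 := (hi (gradSq_contMDiff_two (g := g) hp).continuous).const_mul ((n - 2) * α ^ 2)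
  simp only [weightedIntegral]
  rw [← integral_const_mul, ← integral_const_mul, ← integral_sub h1 h2,
    ← integral_sub (h1.sub' h2) h3]
  refine integral_congr_ae (.of_forall fun x => ?_)
  simp only [kM, gammaTwo]
  ring

/-- The linear equation for the parameter `t` of the shifted Hessian. -/
theorem exists_shift {A d : ℝ} (hA : 0 < A) (hd : 1 < d) (c : ℝ) :
    ∃ t, A * t * (1 + 2 / (d - 1)) = c := by
  have : 0 < d - 1 := by linarith
  have : A * (1 + 2 / (d - 1)) ≠ 0 := by positivity
  exact ⟨c / (A * (1 + 2 / (d - 1))), by field_simp⟩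

/-- The inequality on an arbitrary compact manifold, with the weights given by `θ_⋆`. -/
theorem weightedIntegral_kM_ge {d : ℝ} (hd : 3 ≤ d) (hm : d = m + 1) (hn : d < n)
    (hp : ContMDiff (𝓡 m) 𝓘(ℝ, ℝ) 3 p) (h0 : ∀ x, 0 < p x) (α : ℝ) :
    (lambdaStar g d n - (n - 2) * α ^ 2) * weightedIntegral g p (1 - n) (gradSq g p) ≤
      weightedIntegral g p (1 - n) (kM g n α p) := by
  have hm' : (m : ℝ) = d - 1 := by linarith
  have hm0 : m ≠ 0 := by rintro rfl; simp at hm'; linarith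
  set A := 1 + (n - d) / ((d - 1) * (n - 1)) * thetaStar d n * ((d - 1) / (d - 2)) with hA
  set B := (n - d) / ((d - 1) * (n - 1)) * (1 - thetaStar d n) with hB
  have h1 : 0 < d - 1 := by linarith
  have h2 : 0 < d - 2 := by linarith
  have h3 : 0 < n - 1 := by linarith
  have h4 : 0 < n - d := by linarith
  have hA0 : 0 < A := by
    have := thetaStar_denominator_pos hd hn
    have h5 : 0 < d + 1 := by linarith
    have h6 : 0 < n + 1 := by linarith
    rw [hA, weight_thetaStar hd hn]
    positivity
  have hB0 : 0 ≤ B := mul_nonneg (by positivity) (by linarith [thetaStar_nonpos hd hn])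
  obtain ⟨t, ht⟩ := exists_shift (d := d) hA0 (by linarith)
    (3 / 2 * (n - 1) * (1 - A) - B * (n - 1))
  have key := weightedIntegral_gammaTwo_ge (g := g) (n := n) hm0 (by linarith) hp h0 hA0.le hB0
    (t := t) (by rw [hm']; exact weight_add_weight hd hn _) (by rwa [hm'])
  rw [hm', remainder_thetaStar_eq_zero hd hn hA hB ht, zero_mul, add_zero] at key
  rw [weightedIntegral_kM hp h0]
  have hl : lambdaStar g d n = A * kappa g + B * lambdaOne g := rfl
  rw [hl]
  linarith

end General

/-- On the sphere, the choice `θ = 1` gives a better constant than `θ_⋆`, by the bounds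
`κ ≥ d - 2` and `λ₁ ≤ d - 1`. -/
theorem lambdaStar_round_le {d n : ℝ} (hd : 3 ≤ d) (hm : d = m + 1) (hn : d < n) :
    lambdaStar (roundMetric m) d n ≤
      (1 + (n - d) / ((d - 1) * (n - 1)) * 1 * ((d - 1) / (d - 2))) * kappa (roundMetric m) := by
  have hm' : (m : ℝ) = d - 1 := by linarith
  have hm0 : 0 < m := by
    rw [← Nat.cast_pos (α := ℝ)]; linarith
  have hκ := le_kappa_round hm0
  have hl := lambdaOne_round_le hm0
  rw [hm'] at hκ hl
  have h1 : 0 < d - 1 := by linarith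
  have h2 : 0 < d - 2 := by linarith
  have h3 : 0 < n - 1 := by linarith
  have h4 : 0 < n - d := by linarith
  have h5 : lambdaOne (roundMetric m) ≤ (d - 1) / (d - 2) * kappa (roundMetric m) := by
    rw [div_mul_eq_mul_div, le_div_iff₀ h2]
    nlinarith
  have h6 : 0 ≤ (n - d) / ((d - 1) * (n - 1)) * (1 - thetaStar d n) :=
    mul_nonneg (by positivity) (by linarith [thetaStar_nonpos hd hn])
  have h7 := mul_le_mul_of_nonneg_left h5 h6
  rw [lambdaStar, lambdaTheta]
  linarith

/-- The improved inequality on the sphere: with `θ = 1` instead of `θ_⋆`, no spectral gap is used and a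
positive multiple of the integral of `|∇p|⁴ p ^ (-n - 1)` remains. -/
theorem exists_weightedIntegral_kM_round_ge {d n : ℝ} (hd : 3 ≤ d) (hm : d = m + 1) (hn : d < n) :
    ∃ ζ : ℝ, 0 < ζ ∧ ∀ (α : ℝ) (p : UnitSphere m → ℝ), ContMDiff (𝓡 m) 𝓘(ℝ, ℝ) 3 p →
      (∀ x, 0 < p x) →
      (lambdaStar (roundMetric m) d n - (n - 2) * α ^ 2) *
          weightedIntegral (roundMetric m) p (1 - n) (gradSq (roundMetric m) p) +
        ζ * (n - d) * weightedIntegral (roundMetric m) p (-n - 1)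
          (fun x => gradSq (roundMetric m) p x ^ 2) ≤
      weightedIntegral (roundMetric m) p (1 - n) (kM (roundMetric m) n α p) := by
  have hfact : Fact (Module.finrank ℝ (EuclideanSpace ℝ (Fin (m + 1))) = m + 1) := ⟨by simp⟩
  have hm' : (m : ℝ) = d - 1 := by linarith
  have hm0 : m ≠ 0 := by rintro rfl; simp at hm'; linarith
  have h1 : 0 < d - 1 := by linarith
  have h2 : 0 < d - 2 := by linarith
  have h3 : 0 < n - 1 := by linarith
  have h4 : 0 < n - d := by linarith
  set A := 1 + (n - d) / ((d - 1) * (n - 1)) * 1 * ((d - 1) / (d - 2)) with hA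
  have hA0 : 0 < A := by positivity
  have hAB : A * (1 - 1 / (d - 1)) + 0 = 1 - 1 / (n - 1) := by
    have := weight_add_weight hd hn 1
    rwa [sub_self, mul_zero, ← hA] at this
  obtain ⟨t, ht⟩ := exists_shift (d := d) hA0 (by linarith) (3 / 2 * (n - 1) * (1 - A))
  have hc := remainder_one_pos hd hn hA ht
  set c := n * (n - 1) / 2 * (1 - A) - A * t * n - A * t ^ 2 * (1 - 1 / (d - 1)) with hcdef
  refine ⟨c / (n - d), by positivity, fun α p hp h0 => ?_⟩
  have key := weightedIntegral_gammaTwo_ge (g := roundMetric m) (n := n) hm0 (by linarith) hp h0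
    hA0.le le_rfl (t := t) (by rw [hm']; exact hAB) (by rw [hm', ht]; ring)
  rw [hm', zero_mul, zero_mul, zero_div, sub_zero, add_zero, ← hcdef] at key
  rw [weightedIntegral_kM hp h0, div_mul_cancel₀ _ h4.ne']
  have hE : 0 ≤ weightedIntegral (roundMetric m) p (1 - n) (gradSq (roundMetric m) p) :=
    integral_nonneg fun x => mul_nonneg (gradSq_nonneg _ _) (Real.rpow_nonneg (h0 x).le _)
  have := mul_le_mul_of_nonneg_right (lambdaStar_round_le hd hm hn) hE
  linarith

end Inequality

end CylinderRigidity

end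

theorem mainTheorem7 (d m : ℕ) (hd : 3 ≤ d) (hm : d = m + 1) (n : ℝ) (hn : (d : ℝ) < n) :
    (∀ (M : Type*) [TopologicalSpace M] [T2Space M] [CompactSpace M] [ConnectedSpace M]
      [ChartedSpace (EuclideanSpace ℝ (Fin m)) M] [IsManifold (𝓡 m) ∞ M]
      [MeasurableSpace M] [BorelSpace M] (g : CylinderRigidity.RMetric m M)
      (α : ℝ) (p : M → ℝ), ContMDiff (𝓡 m) 𝓘(ℝ, ℝ) 3 p → (∀ x, 0 < p x) →
      ∫ x, CylinderRigidity.kM g n α p x * p x ^ (1 - n) ∂(CylinderRigidity.vol g) ≥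
        (CylinderRigidity.lambdaStar g d n - (n - 2) * α ^ 2) *
          ∫ x, CylinderRigidity.gradSq g p x * p x ^ (1 - n) ∂(CylinderRigidity.vol g)) ∧
    (∃ ζ : ℝ, 0 < ζ ∧ ∀ (α : ℝ) (p : CylinderRigidity.UnitSphere m → ℝ),
      ContMDiff (𝓡 m) 𝓘(ℝ, ℝ) 3 p → (∀ x, 0 < p x) →
      ∫ x, CylinderRigidity.kM (CylinderRigidity.roundMetric m) n α p x * p x ^ (1 - n)
          ∂(CylinderRigidity.vol (CylinderRigidity.roundMetric m)) ≥
        (CylinderRigidity.lambdaStar (CylinderRigidity.roundMetric m) d n - (n - 2) * α ^ 2) *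
          (∫ x, CylinderRigidity.gradSq (CylinderRigidity.roundMetric m) p x * p x ^ (1 - n)
            ∂(CylinderRigidity.vol (CylinderRigidity.roundMetric m)))
        + ζ * (n - d) *
          ∫ x, CylinderRigidity.gradSq (CylinderRigidity.roundMetric m) p x ^ 2 / p x ^ 2 *
              p x ^ (1 - n)
            ∂(CylinderRigidity.vol (CylinderRigidity.roundMetric m))) := by
  have hd' : (3 : ℝ) ≤ d := by exact_mod_cast hd
  have hm' : (d : ℝ) = m + 1 := by exact_mod_cast hm
  refine ⟨fun M _ _ _ _ _ _ _ _ g α p hp h0 =>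
    CylinderRigidity.weightedIntegral_kM_ge hd' hm' hn hp h0 α, ?_⟩
  obtain ⟨ζ, hζ, h⟩ := CylinderRigidity.exists_weightedIntegral_kM_round_ge hd' hm' hn
  refine ⟨ζ, hζ, fun α p hp h0 => (h α p hp h0).trans_eq' ?_⟩
  congr 2
  refine MeasureTheory.integral_congr_ae (.of_forall fun x => ?_)
  simp only [CylinderRigidity.rpow_neg_sub_one_eq_div (h0 x)]
  ring
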